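/- **Phase plane.** For $R>0$ let $K(R)=\frac{1}{R}\exp\left(\frac{R^2-1}{2}\right)$; let $R^-:[1,\infty)\to(0,1]$ and $R^+:[1,\infty)\to[1,\infty)$ be the inverses of the restrictions of $K$ to $(0,1]$ and $[1,\infty)$. A nonradial plane curve satisfying the shrinker equation $\bar k+x^\perp=0$ ($\bar k$ the curvature vector, $x^\perp$ the normal part of the position), traversed counterclockwise around the origin, satisfies $K(R)=c\sin\psi$ with a constant $c\ge 1$, its energy, where $R=|x|$ and $\psi\in(0,\pi)$ is the angle from $x$ to the unit tangent. Let $c_*=\frac{2}{\sqrt3}$ and $\bar c=e^{(1.3065-1)/2}=e^{0.15325}$. For $c> c_*$ put $R_A=R^+(\frac{\sqrt3}{2}c)$, $R_D=R^-(\frac{\sqrt3}{2}c)$ and $$h_1(c)=\int_{\pi/3}^{2\pi/3}\frac{d\psi}{1-R^-(c\sin\psi)^2},\qquad h_2(c)=\int_{R_D}^{R_A}\frac{K(R)\,dR}{R\sqrt{c^2-K(R)^2}},\qquad \Delta\theta_{NA}(c)=\int_{1}^{R_A}\frac{K(R)\,dR}{R\sqrt{c^2-K(R)^2}}.$$ **Networks.**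 A $\Theta$-shaped regular shrinker is an embedded plane network consisting of three curves $\gamma_{\rm up},\gamma_{\rm in},\gamma_{\rm down}$ that join two triple junctions, the starting point and the ending point, and of finitely many (possibly no) half-lines (rays), attached at distinct interior points of the outer curves $\gamma_{\rm up}$, $\gamma_{\rm down}$. The curve $\gamma_{\rm in}$ lies, apart from its endpoints, in the region enclosed by $\gamma_{\rm up}\cup\gamma_{\rm down}$. All smooth pieces (curves between consecutive multi-points, and rays) satisfy $\bar k+x^\perp=0$, and at every multi-point exactly three curves meet, at angles $\frac{2\pi}{3}$. The labels are chosen such that the region enclosed by $\gamma_{\rm up}\cup\gamma_{\rm in}$ does not contain the origin and $\gamma_{\rm up}$ leaves the starting point counterclockwise around the origin. Let $R_{\rm start}$, $R_{\rm end}$ be the distances of the starting and of the ending point to the origin, $c_{\rm up}$ the energy of $\gamma_{\rm up}$ (the same for all its smooth pieces; it is $K(R)/\sin\psi$ at the starting point), and $\theta_{\rm up}$, $\theta_{\rm in}$ the total changes of the polar angle along $\gamma_{\rm up}$, $\gamma_{\rm in}$ from the starting point to the ending point, counted positively counterclockwise, with $\theta_{\rm in}=\pi$ by convention if $\gamma_{\rm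 in}$ passes through the origin (and so is a line segment). **Statement.** For every $c\ge\bar c$, $(h_1+2h_2+2\Delta\theta_{NA})(c)>\pi$. Moreover, for every $\Theta$-shaped regular shrinker with $R_{\rm start}<1$ or $R_{\rm end}<1$, $$\theta_{\rm up}>(h_1+2h_2+2\Delta\theta_{NA})(c_{\rm up}),\qquad c_{\rm up}\in(c_*,\bar c),\qquad \theta_{\rm up}=\theta_{\rm in}\in(0.9947\pi,\pi].$$ -/

import Mathlib

open Set Function

noncomputable section

namespace Shrinker

/-! ### The phase plane of Abresch-Langer curves -/

/-- `K(R) = exp((R² - 1) / 2) / R`, for `R > 0`. -/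
def K (R : ℝ) : ℝ := Real.exp ((R ^ 2 - 1) / 2) / R

/-- The inverse of the decreasing function `K : (0, 1] → [1, ∞)`. -/
def Rminus : ℝ → ℝ := invFunOn K (Ioc 0 1)

/-- The inverse of the increasing function `K : [1, ∞) → [1, ∞)`. -/
def Rplus : ℝ → ℝ := invFunOn K (Ici 1)

/-- The change of the polar angle along the trajectory `K(R) = c sin ψ`, on its branch
`0 < ψ < π / 2` (where `R` increases), between the points with `R = R₁` and `R = R₂`. -/
def deltaTheta (c R₁ R₂ : ℝ) : ℝ :=
  ∫ R in R₁..R₂, K R / (R * Real.sqrt (c ^ 2 - K R ^ 2))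

/-- The `R` coordinate of the point `A(c)` of the trajectory (`R > 1` and `ψ = π / 3`). -/
def RA (c : ℝ) : ℝ := Rplus (Real.sqrt 3 / 2 * c)

/-- The `R` coordinate of the point `D(c)` of the trajectory (`R < 1` and `ψ = π / 3`). -/
def RD (c : ℝ) : ℝ := Rminus (Real.sqrt 3 / 2 * c)

/-- The change of angle from `C(c)` (`R < 1`, `ψ = 2π / 3`) to `D(c)` (`R < 1`, `ψ = π / 3`). -/
def h1 (c : ℝ) : ℝ :=
  ∫ ψ in (Real.pi / 3)..(2 * Real.pi / 3), 1 / (1 - Rminus (c * Real.sin ψ) ^ 2)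

/-- The change of angle from `D(c)` to `A(c)`. -/
def h2 (c : ℝ) : ℝ := deltaTheta c (RD c) (RA c)

/-- The change of angle from `N(c)` (`R = 1`, `ψ = arcsin (1 / c)`) to `A(c)`. -/
def thetaNA (c : ℝ) : ℝ := deltaTheta c 1 (RA c)

/-- The lowest energy of a trajectory that meets the lines `ψ = π / 3`, `ψ = 2π / 3`. -/
def cStar : ℝ := 2 / Real.sqrt 3

/-- The energy `c̄ = exp((1.3065 - 1) / 2)`. -/
def cBar : ℝ := Real.exp ((1.3065 - 1) / 2)

/-! ### Curves in the plane `ℂ` -/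

/-- The determinant of two plane vectors; equal to `‖z‖ ‖w‖ sin ∠(z, w)`. -/
def cross (z w : ℂ) : ℝ := z.re * w.im - z.im * w.re

/-- A simple compact arc (of positive length), parametrized by arc length on `[0, len]`, with unit
tangent `vel`, that satisfies the shrinker equation `k + x^⊥ = 0`, where `k = vel'` is the
curvature vector and `x^⊥ = x - ⟨x, vel⟩ vel`.  Line segments are allowed. -/
structure Arc where
  len : ℝ
  pos : ℝ → ℂ
  vel : ℝ → ℂ
  len_pos : 0 < len
  hasDeriv_pos : ∀ s ∈ Icc 0 len, HasDerivWithinAt pos (vel s) (Icc 0 len) s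
  norm_vel : ∀ s ∈ Icc 0 len, ‖vel s‖ = 1
  shrinker : ∀ s ∈ Icc 0 len,
    HasDerivWithinAt vel (-(pos s - (inner ℝ (pos s) (vel s) : ℝ) • vel s)) (Icc 0 len) s
  simple : InjOn pos (Icc 0 len)

namespace Arc

/-- The initial point. -/
def source (γ : Arc) : ℂ := γ.pos 0

/-- The final point. -/
def target (γ : Arc) : ℂ := γ.pos γ.len

/-- The arc with its endpoints. -/
def carrier (γ : Arc) : Set ℂ := γ.pos '' Icc 0 γ.len

/-- The arc without its endpoints. -/
def openCarrier (γ : Arc) : Set ℂ := γ.pos '' Ioo 0 γ.len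

/-- The total change of the polar angle along an arc, counted positively counterclockwise:
`dθ / ds = sin ψ / R`.  (An arc through the origin is a line segment, and gets the value `0`.) -/
def angle (γ : Arc) : ℝ := ∫ s in (0 : ℝ)..γ.len, cross (γ.pos s) (γ.vel s) / ‖γ.pos s‖ ^ 2

/-- The energy `c = K(R) / sin ψ` of a counterclockwise arc, with `sin ψ = (x × x_s) / R`.  It is
read off at the initial point, and is the same at every other point of the arc, since `K(R) / sin ψ`
is a first integral of the shrinker equation. -/
def energy (γ : Arc) : ℝ := K ‖γ.source‖ / (cross γ.source (γ.vel 0) / ‖γ.source‖)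

end Arc

/-- A half-line that satisfies the shrinker equation: `x^⊥ = 0` along it. -/
structure Ray where
  base : ℂ
  dir : ℂ
  norm_dir : ‖dir‖ = 1
  shrinker : cross base dir = 0

/-- The half-line without its base point. -/
def Ray.openCarrier (r : Ray) : Set ℂ := {z | ∃ t : ℝ, 0 < t ∧ z = r.base + t • r.dir}

/-- A piecewise smooth curve made of `numRays + 1` consecutive shrinking arcs, with a ray attached
at each of the `numRays` points where two consecutive arcs meet.  The three curves at such a point
satisfy the Herring condition: the unit tangents pointing away from it sum up to zero, which is to
say that they make angles `2π / 3`. -/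
structure Chain where
  numRays : ℕ
  arc : Fin (numRays + 1) → Arc
  ray : Fin numRays → Ray
  target_eq : ∀ i, (arc i.castSucc).target = (ray i).base
  source_eq : ∀ i, (arc i.succ).source = (ray i).base
  herring : ∀ i,
    -(arc i.castSucc).vel (arc i.castSucc).len + (arc i.succ).vel 0 + (ray i).dir = 0

namespace Chain

/-- The first arc. -/
def first (Γ : Chain) : Arc := Γ.arc 0

/-- The last arc. -/
def last (Γ : Chain) : Arc := Γ.arc (Fin.last Γ.numRays)

/-- The union of the arcs (the rays are not included). -/
def carrier (Γ : Chain) : Set ℂ := ⋃ i, (Γ.arc i).carrier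

/-- The total change of the polar angle along the arcs. -/
def angle (Γ : Chain) : ℝ := ∑ i, (Γ.arc i).angle

/-- The energy of the arcs.  It is read off on the first one, and all the others have the same,
since two arcs that meet at a ray have the same `sin ψ` there. -/
def energy (Γ : Chain) : ℝ := Γ.first.energy

end Chain

/-- The points of the plane that are enclosed by a closed curve `J`. -/
def inside (J : Set ℂ) : Set ℂ := {z | z ∉ J ∧ Bornology.IsBounded (connectedComponentIn Jᶜ z)}

/-- The labels of the vertices (first four) and of the edges of a `Θ`-shaped network with
`m` and `n` rays attached to its outer curves. -/
inductive Cell (m n : ℕ) : Type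
  | startPt
  | endPt
  | upPt (i : Fin m)
  | downPt (i : Fin n)
  | inArc
  | upArc (i : Fin (m + 1))
  | downArc (i : Fin (n + 1))
  | upRay (i : Fin m)
  | downRay (i : Fin n)

/-- The vertices, and the edges without their endpoints. -/
def cellSet (up down : Chain) (mid : Arc) : Cell up.numRays down.numRays → Set ℂ
  | .startPt => {mid.source}
  | .endPt => {mid.target}
  | .upPt i => {(up.ray i).base}
  | .downPt i => {(down.ray i).base}
  | .inArc => mid.openCarrier
  | .upArc i => (up.arc i).openCarrier
  | .downArc i => (down.arc i).openCarrier
  | .upRay i => (up.ray i).openCarrier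
  | .downRay i => (down.ray i).openCarrier

/-- A `Θ`-shaped regular shrinker: an embedded network that consists of three curves
`γ_up`, `γ_in`, `γ_down` joining two triple junctions, the starting point and the ending point, and
of any numbers of rays attached to the two outer curves `γ_up` and `γ_down`.  All pieces satisfy
`k + x^⊥ = 0`, and at all multi-points three curves meet at angles `2π / 3`. -/
structure ThetaShrinker where
  up : Chain
  mid : Arc
  down : Chain
  up_source : up.first.source = mid.source
  down_source : down.first.source = mid.source
  up_target : up.last.target = mid.target
  down_target : down.last.target = mid.target
  /-- the Herring condition at the starting point -/
  herring_start : up.first.vel 0 + mid.vel 0 + down.first.vel 0 = 0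
  /-- the Herring condition at the ending point -/
  herring_end : up.last.vel up.last.len + mid.vel mid.len + down.last.vel down.last.len = 0
  /-- the vertices are distinct, and the curves meet only at their common endpoints -/
  embedded : Pairwise (Disjoint on cellSet up down mid)
  /-- `γ_up` and `γ_down` are the outer curves, `γ_in` is the inner one -/
  mid_inside : mid.openCarrier ⊆ inside (up.carrier ∪ down.carrier)

namespace ThetaShrinker

/-- The upper closed region, bounded by `γ_up` and `γ_in`. -/
def upperRegion (N : ThetaShrinker) : Set ℂ := inside (N.up.carrier ∪ N.mid.carrier)

/-- The distance of the starting point to the origin. -/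
def RStart (N : ThetaShrinker) : ℝ := ‖N.mid.source‖

/-- The distance of the ending point to the origin. -/
def REnd (N : ThetaShrinker) : ℝ := ‖N.mid.target‖

/-- The energy of `γ_up`. -/
def cUp (N : ThetaShrinker) : ℝ := N.up.energy

/-- The total change of angle of `γ_up`. -/
def thetaUp (N : ThetaShrinker) : ℝ := N.up.angle

open Classical in
/-- The total change of angle of `γ_in`, which is `π` by convention if `γ_in` is a line segment
through the origin. -/
def thetaIn (N : ThetaShrinker) : ℝ :=
  if (0 : ℂ) ∈ N.mid.carrier then Real.pi else N.mid.angle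

end ThetaShrinker

end Shrinker

end

/-!
# Theta-shaped shrinkers: energies and polar angles

Along a counterclockwise arc of a shrinker the tangential part `σ = ⟨x, x_s⟩` and the normal part
`κ = x × x_s` of the position satisfy `σ' = 1 - κ²`, `κ' = σ κ` (`Flow`, `Arc.flow`).  Hence
`K(R) = c sin ψ`, and the polar angle changes by `κ / R² ds`.  Put `n = shape (R² - 1)`, so that
`n² / 2 = 1 - 1 / K(R)²`, and let `χ` be the comparison angle with `cos χ = cos ψ / cos ω`, where
`sin ω = 1 / c`.  Then `dχ / dψ = √2 / n` and `dψ / dθ = R² - 1`, while `n / |R² - 1|` is a concave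
function of `n` on both sides of `R = 1`.  Its chords and (near-)tangents (`shape_ge_of_neg`,
`shape_ge_of_pos`, `shape_le_of_neg`, `shape_le_of_pos`, `shape_le_self`) therefore bound the polar
angle by linear combinations of `χ` and `ψ` (`Flow.ang_le`, `Flow.le_ang`), which are explicit.

For the sum `h1 + 2 h2 + 2 Δθ_NA` the chords give the lower bound `π` plus a positive multiple of
`excess ω`.  The function `excess` is concave, vanishes at `0`, and is positive at the angle `ω`
that belongs to `c = cBar`; larger energies have smaller `ω`, so the sum exceeds `π` for all
`c ≥ cBar` (`pi_lt_of_cBar_le`).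

For a network, the argument principle for the closed curve `γ_up ∪ γ_in`, which does not enclose
the origin, shows that both curves turn by the same angle (`ThetaShrinker.thetaUp_eq_angle_mid`),
unless `γ_in` passes through the origin.  The closed curve formed by `γ_up` and the reversed
`γ_down` is simple and counterclockwise, hence winds once and is a graph in polar coordinates
(`CcwLoop.cumAngle_eq_two_pi`, `CcwLoop.eq_of_dir_eq`).  Since `γ_in` is enclosed by it, `γ_in` lies
below `γ_up` (`ThetaShrinker.norm_lt_of_dir_eq`).  Consequently the rays at `γ_up` point outwards
(`ThetaShrinker.outward`), and the angle `ψ` of `γ_up` is some `α ≤ π / 3` at the start and `π - α`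
at the end (`ThetaShrinker.slope_of_notMem`, `ThetaShrinker.slope_of_mem`).  So `γ_up` is a chain of
trajectories of the same energy which jump from `ψ = π / 3` to `ψ = 2π / 3` at the rays
(`FlowChain`).

If `γ_up` had no point of least radius, it would turn by less than `π / 3 + 2 α`
(`FlowChain.sum_lt_of_no_bottom`).  But `γ_in` goes from `ψ = 2π / 3 + α` to `ψ = π / 3 - α`,
passing a point of least radius, and turns by at least the difference `π / 3 + 2 α` of these angles
(`Flow.psi_sub_psi_le_ang`); if `γ_in` is a segment through the origin, then `α = π / 3` and
`γ_up` turns by `π = π / 3 + 2 α`.  So `γ_up` has a point of least radius.  Cutting it there gives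
two pieces, each of which contains half of the arc measured by `h1`, an arc measured by `h2`, and the
arc between the circle of radius `R_A` and an endpoint.  As one endpoint lies in the unit disk, the
latter two exceed `2 Δθ_NA` together (`FlowChain.lt_sum_of_bottom`, `two_mul_thetaNA_lt`).

At the polar angle of that point `γ_in` is closer to the origin, so that it has a higher energy than
`γ_up` (`ThetaShrinker.cUp_lt_energy_mid`); then it cannot have a point of largest radius, where
`γ_up` would be even farther out (`ThetaShrinker.kap_mid_lt_one`), and turns by at most `π`
(`Flow.ang_le_pi`).  With the bound for large energies this yields `c_up < cBar`.  Since
`1 < K(R) = c_up sin α` at the endpoint in the unit disk, `α` is close to `π / 3`, and the lower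
bounds for `γ_in` give `θ_in > 0.9947 π` (`Flow.lt_ang_of_psi`).
-/

noncomputable section

namespace Shrinker

/-! ### Rational bounds for the shape function of the phase plane -/

theorem le_of_hasDerivAt_nonneg {F F' : ℝ → ℝ} {a b : ℝ} (hab : a ≤ b)
    (hF : ∀ t ∈ Icc a b, HasDerivAt F (F' t) t) (h0 : ∀ t ∈ Ioo a b, 0 ≤ F' t) : F a ≤ F b := by
  have hm : MonotoneOn F (Icc a b) := by
    apply monotoneOn_of_deriv_nonneg (convex_Icc a b)
    · exact fun t ht => (hF t ht).continuousAt.continuousWithinAt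
    · intro t ht
      rw [interior_Icc] at ht
      exact (hF t (Ioo_subset_Icc_self ht)).differentiableAt.differentiableWithinAt
    · intro t ht
      rw [interior_Icc] at ht
      rw [(hF t (Ioo_subset_Icc_self ht)).deriv]
      exact h0 t ht
  exact hm (left_mem_Icc.2 hab) (right_mem_Icc.2 hab) hab

theorem le_of_hasDerivAt_nonpos {F F' : ℝ → ℝ} {a b : ℝ} (hab : a ≤ b)
    (hF : ∀ t ∈ Icc a b, HasDerivAt F (F' t) t) (h0 : ∀ t ∈ Ioo a b, F' t ≤ 0) : F b ≤ F a := by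
  have := le_of_hasDerivAt_nonneg (F := fun t => -F t) (F' := fun t => -F' t) hab
    (fun t ht => (hF t ht).neg) (fun t ht => by linarith [h0 t ht])
  linarith

/-- The defect of the rational approximation `y ≈ n / (p - r n)` to the solution `y` of
`(1 + y) exp (-y) = 1 - n² / 2`. -/
def defect (p r n : ℝ) : ℝ :=
  Real.log (1 + n / (p - r * n)) - n / (p - r * n) - Real.log (1 - n ^ 2 / 2)

theorem hasDerivAt_defect {p r n : ℝ} (hP : 0 < p - r * n) (hn : 0 < 1 - n ^ 2 / 2)
    (hPn : 0 < p - r * n + n) :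
    HasDerivAt (defect p r)
      (n * ((p - r * n) ^ 2 * (p - r * n + n) - p * (1 - n ^ 2 / 2)) /
        ((1 - n ^ 2 / 2) * ((p - r * n) ^ 2 * (p - r * n + n)))) n := by
  have h1 : HasDerivAt (fun n : ℝ => p - r * n) (-r) n := by
    simpa using ((hasDerivAt_id n).const_mul r).const_sub p
  have h2 : HasDerivAt (fun n : ℝ => n / (p - r * n)) (p / (p - r * n) ^ 2) n := by
    have := (hasDerivAt_id n).div h1 hP.ne'
    refine this.congr_deriv ?_
    simp only [id]; congr 1; ring
  have e1 : 1 + n / (p - r * n) = (p - r * n + n) / (p - r * n) := by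
    rw [add_div, div_self hP.ne']
  have hY : 0 < 1 + n / (p - r * n) := by
    rw [e1]; positivity
  have h3 := (h2.const_add 1).log hY.ne'
  have h4 : HasDerivAt (fun n : ℝ => 1 - n ^ 2 / 2) (-n) n := by
    have := ((hasDerivAt_pow 2 n).div_const 2).const_sub 1
    refine this.congr_deriv ?_
    simp
  have h5 := h4.log hn.ne'
  refine ((h3.sub h2).sub h5).congr_deriv ?_
  rw [e1]
  obtain ⟨P, hPd⟩ : ∃ P, P = p - r * n := ⟨_, rfl⟩
  obtain ⟨M, hM⟩ : ∃ M, M = 1 - n ^ 2 / 2 := ⟨_, rfl⟩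
  rw [← hPd] at hP hPn ⊢
  rw [← hM] at hn ⊢
  field_simp
  ring

theorem defect_zero {p r : ℝ} : defect p r 0 = 0 := by simp [defect]

theorem strictAntiOn_log_sub : StrictAntiOn (fun y : ℝ => Real.log (1 + y) - y) (Ici 0) := by
  apply strictAntiOn_of_deriv_neg (convex_Ici 0)
  · intro y hy
    have : (1 + y) ≠ 0 := by have : (0:ℝ) ≤ y := hy; linarith
    fun_prop (disch := assumption)
  · intro y hy
    rw [interior_Ici] at hy
    have hy : 0 < y := hy
    have : HasDerivAt (fun y : ℝ => Real.log (1 + y) - y) (1 / (1 + y) - 1) y :=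
      (((hasDerivAt_id y).const_add 1).log (by simp; linarith)).sub (hasDerivAt_id y)
    rw [this.deriv, sub_neg, div_lt_one (by linarith)]
    linarith

theorem strictMonoOn_log_sub : StrictMonoOn (fun y : ℝ => Real.log (1 + y) - y) (Ioc (-1) 0) := by
  apply strictMonoOn_of_deriv_pos (convex_Ioc _ _)
  · intro y hy
    have : (1 + y) ≠ 0 := by have := hy.1; linarith
    fun_prop (disch := assumption)
  · intro y hy
    rw [interior_Ioc] at hy
    obtain ⟨hy, hy'⟩ := hy
    have : HasDerivAt (fun y : ℝ => Real.log (1 + y) - y) (1 / (1 + y) - 1) y :=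
      (((hasDerivAt_id y).const_add 1).log (by simp; linarith)).sub (hasDerivAt_id y)
    rw [this.deriv, sub_pos, lt_div_iff₀ (by linarith)]
    linarith

/-- The shape function of the phase plane: the nonnegative `n` with
`(1 + y) exp (-y) = 1 - n² / 2`. -/
def shape (y : ℝ) : ℝ := Real.sqrt (2 * (1 - (1 + y) * Real.exp (-y)))

theorem shape_arg_pos {y : ℝ} (hy : y ≠ 0) : 0 < 1 - (1 + y) * Real.exp (-y) := by
  have h := Real.add_one_lt_exp hy
  have : (1 + y) * Real.exp (-y) < Real.exp y * Real.exp (-y) := by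
    have := Real.exp_pos (-y)
    gcongr; linarith
  rw [← Real.exp_add] at this
  simp at this
  linarith

theorem shape_pos {y : ℝ} (hy : y ≠ 0) : 0 < shape y :=
  Real.sqrt_pos.2 (by linarith [shape_arg_pos hy])

theorem shape_sq (y : ℝ) : shape y ^ 2 = 2 * (1 - (1 + y) * Real.exp (-y)) := by
  rcases eq_or_ne y 0 with rfl | hy
  · simp [shape]
  · exact Real.sq_sqrt (by linarith [shape_arg_pos hy])

theorem one_sub_shape_sq (y : ℝ) : 1 - shape y ^ 2 / 2 = (1 + y) * Real.exp (-y) := by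
  rw [shape_sq]; ring

theorem shape_lt {y : ℝ} (hy : -1 < y) : shape y < Real.sqrt 2 := by
  apply Real.sqrt_lt_sqrt_iff_of_pos (by norm_num) |>.2
  have := Real.exp_pos (-y)
  have : 0 < (1 + y) * Real.exp (-y) := by apply mul_pos <;> linarith
  linarith

theorem log_one_sub_shape_sq {y : ℝ} (hy : -1 < y) :
    Real.log (1 - shape y ^ 2 / 2) = Real.log (1 + y) - y := by
  rw [one_sub_shape_sq, Real.log_mul (by linarith) (Real.exp_pos _).ne', Real.log_exp]
  ring

theorem le_shape_of_defect_nonpos {p r y : ℝ} (hy : 0 < y) (hP : 0 < p - r * shape y)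
    (h : defect p r (shape y) ≤ 0) : y * (p - r * shape y) ≤ shape y := by
  rw [← le_div_iff₀ hP]
  by_contra! hlt
  have hn := shape_pos hy.ne'
  have := strictAntiOn_log_sub (mem_Ici.2 (div_pos hn hP).le) (mem_Ici.2 hy.le) hlt
  rw [defect, log_one_sub_shape_sq (by linarith)] at h
  simp only at this
  linarith

theorem shape_le_of_defect_nonneg {p r y : ℝ} (hy : 0 < y) (hP : 0 < p - r * shape y)
    (h : 0 ≤ defect p r (shape y)) : shape y ≤ y * (p - r * shape y) := by
  rw [← div_le_iff₀ hP]
  by_contra! hlt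
  have hn := shape_pos hy.ne'
  have := strictAntiOn_log_sub (mem_Ici.2 hy.le) (mem_Ici.2 (div_pos hn hP).le) hlt
  rw [defect, log_one_sub_shape_sq (by linarith)] at h
  simp only at this
  linarith

theorem le_shape_of_defect_neg_nonpos {p r y : ℝ} (hy : y ∈ Ioo (-1) (0 : ℝ))
    (hP : 0 < p + r * shape y) (hPn : 0 < p + r * shape y - shape y)
    (h : defect p r (-shape y) ≤ 0) : -y * (p + r * shape y) ≤ shape y := by
  rw [← le_div_iff₀ hP]
  by_contra! hlt
  have hn := shape_pos hy.2.ne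
  have e : -shape y / (p - r * -shape y) = -(shape y / (p + r * shape y)) := by
    rw [neg_div]; congr 2; ring
  have := strictMonoOn_log_sub (a := y) (b := -(shape y / (p + r * shape y))) ⟨hy.1, hy.2.le⟩
    ⟨by rw [neg_lt_neg_iff, div_lt_one hP]; linarith, by
      rw [neg_nonpos]; exact (div_pos hn hP).le⟩ (by linarith)
  rw [defect, e, neg_sq, log_one_sub_shape_sq (by linarith [hy.1])] at h
  simp only at this
  linarith

theorem shape_le_of_defect_neg_nonneg {p r y : ℝ} (hy : y ∈ Ioo (-1) (0 : ℝ))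
    (hP : 0 < p + r * shape y) (hPn : 0 < p + r * shape y - shape y)
    (h : 0 ≤ defect p r (-shape y)) : shape y ≤ -y * (p + r * shape y) := by
  rw [← div_le_iff₀ hP]
  by_contra! hlt
  have hn := shape_pos hy.2.ne
  have e : -shape y / (p - r * -shape y) = -(shape y / (p + r * shape y)) := by
    rw [neg_div]; congr 2; ring
  have := strictMonoOn_log_sub (a := -(shape y / (p + r * shape y))) (b := y)
    ⟨by rw [neg_lt_neg_iff, div_lt_one hP]; linarith, by
      rw [neg_nonpos]; exact (div_pos hn hP).le⟩ ⟨hy.1, hy.2.le⟩ (by linarith)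
  rw [defect, e, neg_sq, log_one_sub_shape_sq (by linarith [hy.1])] at h
  simp only at this
  linarith

theorem sqrt_two_bounds : 1.4142 < Real.sqrt 2 ∧ Real.sqrt 2 < 1.4143 := by
  constructor
  · apply Real.lt_sqrt_of_sq_lt; norm_num
  · rw [Real.sqrt_lt' (by norm_num)]; norm_num

/-- For `R < 1`: the chord of the concave function `n ↦ n / |y|` over `[0, √2]`. -/
theorem shape_ge_of_neg {y : ℝ} (hy : y ∈ Ioo (-1) (0 : ℝ)) :
    -y * (1 + (1 - 1 / Real.sqrt 2) * shape y) ≤ shape y := by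
  have hs := Real.sq_sqrt (show (0:ℝ) ≤ 2 by norm_num)
  obtain ⟨h1, h2⟩ := sqrt_two_bounds
  set w := Real.sqrt 2 with hw
  have e : 1 / w = w / 2 := by field_simp; linarith
  have hn := shape_pos hy.2.ne
  have hn2 := shape_lt hy.1
  rw [← hw] at hn2
  rw [e]
  have hk : ∀ t ∈ Icc (-shape y) 0, 0 < 1 - (1 - w / 2) * t ∧ 0 < 1 - t ^ 2 / 2 ∧
      0 < 1 - (1 - w / 2) * t + t := by
    rintro t ⟨ht, ht'⟩
    refine ⟨by nlinarith, by nlinarith, by nlinarith⟩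
  apply le_shape_of_defect_neg_nonpos hy
  · nlinarith
  · nlinarith
  rw [← defect_zero (p := 1) (r := 1 - w / 2)]
  refine le_of_hasDerivAt_nonneg (by linarith)
    (fun t ht => hasDerivAt_defect (hk t ht).1 (hk t ht).2.1 (hk t ht).2.2) ?_
  intro t ht
  obtain ⟨k1, k2, k3⟩ := hk t (Ioo_subset_Icc_self ht)
  apply div_nonneg _ (by positivity)
  apply mul_nonneg_of_nonpos_of_nonpos ht.2.le
  have ht1 : -w < t := by linarith [ht.1]
  have e2 : (1 - (1 - w / 2) * t) ^ 2 * (1 - (1 - w / 2) * t + t) - 1 * (1 - t ^ 2 / 2)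
      = (1 + w * t / 2) * ((1 - w / 2) ^ 2 * (t * (t + w))) := by
    have : w ^ 3 = 2 * w := by rw [pow_succ, hs]
    have w4 : w ^ 4 = 4 := by rw [show w ^ 4 = (w^2)^2 by ring, hs]; norm_num
    ring_nf
    rw [w4, this, hs]
    ring
  rw [e2]
  apply mul_nonpos_of_nonneg_of_nonpos (by nlinarith)
  apply mul_nonpos_of_nonneg_of_nonpos (by positivity)
  apply mul_nonpos_of_nonpos_of_nonneg ht.2.le (by linarith)

/-- For `R > 1`: the chord of the concave function `n ↦ n / y` over `[0, √2]`. -/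
theorem shape_ge_of_pos {y : ℝ} (hy : 0 < y) :
    y * (1 - 1 / Real.sqrt 2 * shape y) ≤ shape y := by
  have hs := Real.sq_sqrt (show (0:ℝ) ≤ 2 by norm_num)
  obtain ⟨h1, h2⟩ := sqrt_two_bounds
  set w := Real.sqrt 2 with hw
  have e : 1 / w = w / 2 := by field_simp; linarith
  have hn := shape_pos hy.ne'
  have hn2 := shape_lt (show -1 < y by linarith)
  rw [← hw] at hn2
  rw [e]
  have hk : ∀ t ∈ Icc 0 (shape y), 0 < 1 - (w / 2) * t ∧ 0 < 1 - t ^ 2 / 2 ∧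
      0 < 1 - (w / 2) * t + t := by
    rintro t ⟨ht, ht'⟩
    refine ⟨by nlinarith, by nlinarith, by nlinarith⟩
  apply le_shape_of_defect_nonpos hy
  · nlinarith
  rw [← defect_zero (p := 1) (r := w / 2)]
  refine le_of_hasDerivAt_nonpos (by linarith)
    (fun t ht => hasDerivAt_defect (hk t ht).1 (hk t ht).2.1 (hk t ht).2.2) ?_
  intro t ht
  obtain ⟨k1, k2, k3⟩ := hk t (Ioo_subset_Icc_self ht)
  apply div_nonpos_of_nonpos_of_nonneg _ (by positivity)
  apply mul_nonpos_of_nonneg_of_nonpos ht.1.le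
  have e2 : (1 - w / 2 * t) ^ 2 * (1 - w / 2 * t + t) - 1 * (1 - t ^ 2 / 2)
      = -(1 - w * t / 2) * (t * ((3 * w / 2 - 1) + (w / 2 - 1 / 2) * t)) := by
    have : w ^ 3 = 2 * w := by rw [pow_succ, hs]
    ring_nf
    simp only [this, hs]
    ring
  rw [e2]
  have := ht.1
  have a1 : 0 < 1 - w * t / 2 := by linarith
  have a2 : 0 ≤ t * ((3 * w / 2 - 1) + (w / 2 - 1 / 2) * t) := by
    apply mul_nonneg this.le; nlinarith
  nlinarith

/-- For `R > 1`: the concave function `n ↦ n / y` decreases from its limit `1` at `n = 0`. -/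
theorem shape_le_self {y : ℝ} (hy : 0 < y) : shape y ≤ y := by
  have hn := shape_pos hy.ne'
  have hn2 := shape_lt (show -1 < y by linarith)
  have hs := Real.sq_sqrt (show (0:ℝ) ≤ 2 by norm_num)
  have h := shape_le_of_defect_nonneg (p := 1) (r := 0) hy (by simp) ?_
  · simpa using h
  have hz := defect_zero (p := 1) (r := 0)
  have hk : ∀ t ∈ Icc 0 (shape y), 0 < 1 - 0 * t ∧ 0 < 1 - t ^ 2 / 2 ∧ 0 < 1 - 0 * t + t := by
    rintro t ⟨ht, ht'⟩
    refine ⟨by simp, by nlinarith, by linarith⟩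
  refine hz.ge.trans (le_of_hasDerivAt_nonneg hn.le
    (fun t ht => hasDerivAt_defect (hk t ht).1 (hk t ht).2.1 (hk t ht).2.2) ?_)
  intro t ht
  obtain ⟨k1, k2, k3⟩ := hk t (Ioo_subset_Icc_self ht)
  have := ht.1
  apply div_nonneg _ (by positivity)
  apply mul_nonneg this.le
  nlinarith

/-- For `R > 1`: nearly the tangent at `n = 1` of the concave function `n ↦ n / y`.  The
coefficients are chosen so that the defect has a critical point at `n = 1`. -/
theorem shape_le_of_pos {y : ℝ} (hy : 0 < y) : shape y ≤ y * (1.152 - 0.552 * shape y) := by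
  have hn := shape_pos hy.ne'
  have hn2 := shape_lt (show -1 < y by linarith)
  obtain ⟨h1, h2⟩ := sqrt_two_bounds
  have hs := Real.sq_sqrt (show (0:ℝ) ≤ 2 by norm_num)
  set n := shape y with hnd
  have hk : ∀ t : ℝ, 0 ≤ t → t < Real.sqrt 2 → 0 < 1.152 - 0.552 * t ∧ 0 < 1 - t ^ 2 / 2 ∧
      0 < 1.152 - 0.552 * t + t := by
    intro t ht ht'
    refine ⟨by linarith, by nlinarith, by linarith⟩
  have hone : 0 ≤ defect 1.152 0.552 1 := by
    have e : defect 1.152 0.552 1 = Real.log (16 / 3) - 5 / 3 := by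
      rw [defect, show (1 - (1:ℝ) ^ 2 / 2) = 2⁻¹ by norm_num,
        show (1 + (1:ℝ) / (1.152 - 0.552 * 1)) = 8 / 3 by norm_num, Real.log_inv,
        show (16 / 3 : ℝ) = 8 / 3 * 2 by norm_num, Real.log_mul (by norm_num) (by norm_num)]
      norm_num
      ring
    rw [e, sub_nonneg, Real.le_log_iff_exp_le (by norm_num)]
    have h3 : Real.exp (5 / 3) ^ 3 ≤ (16 / 3 : ℝ) ^ 3 := by
      rw [← Real.exp_nat_mul]
      have : ((3 : ℕ) : ℝ) * (5 / 3) = (5 : ℕ) * 1 := by norm_num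
      rw [this, Real.exp_nat_mul]
      calc Real.exp 1 ^ 5 ≤ (2.7182818286 : ℝ) ^ 5 := by
            gcongr; exact Real.exp_one_lt_d9.le
        _ ≤ _ := by norm_num
    exact le_of_pow_le_pow_left₀ (by norm_num) (by norm_num) h3
  have hfac : ∀ t : ℝ, (1.152 - 0.552 * t) ^ 2 * (1.152 - 0.552 * t + t) -
      1.152 * (1 - t ^ 2 / 2) =
        (t - 1) * (0.136507392 * t ^ 2 + 0.493756416 * t - 0.376823808) := by
    intro t; ring
  have hroot : ∀ t u : ℝ, 0 ≤ t → t ≤ u → 0.136507392 * t ^ 2 + 0.493756416 * t - 0.376823808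
      ≤ 0.136507392 * u ^ 2 + 0.493756416 * u - 0.376823808 := by
    intro t u ht htu; nlinarith
  apply shape_le_of_defect_nonneg hy (hk n hn.le hn2).1
  rcases le_or_gt n 1 with hle | hgt
  · rcases le_or_gt (0.136507392 * n ^ 2 + 0.493756416 * n - 0.376823808) 0 with hr | hr
    · rw [← defect_zero (p := 1.152) (r := 0.552)]
      refine le_of_hasDerivAt_nonneg hn.le (fun t ht => hasDerivAt_defect
        (hk t ht.1 (by linarith [ht.2])).1 (hk t ht.1 (by linarith [ht.2])).2.1
        (hk t ht.1 (by linarith [ht.2])).2.2) ?_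
      intro t ht
      obtain ⟨k1, k2, k3⟩ := hk t ht.1.le (by linarith [ht.2])
      rw [hfac]
      apply div_nonneg _ (by positivity)
      apply mul_nonneg ht.1.le
      apply mul_nonneg_of_nonpos_of_nonpos (by linarith [ht.2])
      linarith [hroot t n ht.1.le ht.2.le]
    · refine hone.trans (le_of_hasDerivAt_nonpos hle (fun t ht => hasDerivAt_defect
        (hk t (by linarith [ht.1]) (by linarith [ht.2])).1
        (hk t (by linarith [ht.1]) (by linarith [ht.2])).2.1
        (hk t (by linarith [ht.1]) (by linarith [ht.2])).2.2) ?_)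
      intro t ht
      have ht0 : 0 < t := hn.trans ht.1
      obtain ⟨k1, k2, k3⟩ := hk t ht0.le (by linarith [ht.2])
      rw [hfac]
      apply div_nonpos_of_nonpos_of_nonneg _ (by positivity)
      apply mul_nonpos_of_nonneg_of_nonpos ht0.le
      apply mul_nonpos_of_nonpos_of_nonneg (by linarith [ht.2])
      linarith [hroot n t hn.le ht.1.le]
  · refine hone.trans (le_of_hasDerivAt_nonneg hgt.le (fun t ht => hasDerivAt_defect
        (hk t (by linarith [ht.1]) (by linarith [ht.2])).1
        (hk t (by linarith [ht.1]) (by linarith [ht.2])).2.1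
        (hk t (by linarith [ht.1]) (by linarith [ht.2])).2.2) ?_)
    intro t ht
    have ht1 : 1 < t := ht.1
    have ht0 : 0 < t := by linarith
    obtain ⟨k1, k2, k3⟩ := hk t ht0.le (by linarith [ht.2])
    rw [hfac]
    apply div_nonneg _ (by positivity)
    apply mul_nonneg ht0.le
    apply mul_nonneg (by linarith)
    nlinarith

/-- For `R < 1`: the tangent at `n = √2` of the concave function `n ↦ n / |y|`. -/
theorem shape_le_of_neg {y : ℝ} (hy : y ∈ Ioo (-1) (0 : ℝ)) :
    shape y ≤ -y * (2 * Real.sqrt 2 / Real.exp 1 + (1 - 2 / Real.exp 1) * shape y) := by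
  have hs := Real.sq_sqrt (show (0:ℝ) ≤ 2 by norm_num)
  obtain ⟨h1, h2⟩ := sqrt_two_bounds
  set w := Real.sqrt 2 with hw
  have he := Real.exp_one_gt_d9
  have hn := shape_pos hy.2.ne
  have hn2 := shape_lt hy.1
  rw [← hw] at hn2
  set n := shape y with hnd
  set f := 2 / Real.exp 1 with hf
  have hf0 : 0 < f := by positivity
  have hf1 : f < 1 := by rw [hf, div_lt_one (by positivity)]; linarith
  have e1 : 2 * w / Real.exp 1 = w * f := by rw [hf]; ring
  rw [e1]
  -- the defect, in a form that is regular at `n = -√2`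
  set G : ℝ → ℝ := fun t => Real.log (2 * f) - Real.log (w - t) -
    Real.log (w * f - (1 - f) * t) - t / (w * f - (1 - f) * t) with hG
  have hk : ∀ t ∈ Icc (-w) 0, 0 < w * f - (1 - f) * t ∧ 0 < w - t := by
    rintro t ⟨ht, ht'⟩
    refine ⟨by nlinarith, by linarith⟩
  have hGd : ∀ t ∈ Icc (-w) 0, HasDerivAt G
      (t * (2 * (1 - f) ^ 2 * t + (w * f - 3 * (w * f) * (1 - f) - w * (1 - f) ^ 2)) /
        ((w - t) * (w * f - (1 - f) * t) ^ 2)) t := by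
    intro t ht
    obtain ⟨k1, k2⟩ := hk t ht
    have d1 : HasDerivAt (fun t : ℝ => w - t) (-1) t := by
      simpa using (hasDerivAt_id t).const_sub w
    have d2 : HasDerivAt (fun t : ℝ => w * f - (1 - f) * t) (-(1 - f)) t := by
      simpa using ((hasDerivAt_id t).const_mul (1 - f)).const_sub (w * f)
    have d3 := (((d1.log k2.ne').const_sub (Real.log (2 * f))).sub (d2.log k1.ne')).sub
      ((hasDerivAt_id t).div d2 k1.ne')
    refine d3.congr_deriv ?_
    simp only [id]
    have key : (w * f - (1 - f) * t) ^ 2 + (1 - f) * (w * f - (1 - f) * t) * (w - t) -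
        (w * f - (1 - f) * t + t * (1 - f)) * (w - t) =
        t * (2 * (1 - f) ^ 2 * t + (w * f - 3 * (w * f) * (1 - f) - w * (1 - f) ^ 2)) := by ring
    rw [← key]
    obtain ⟨P, hP⟩ : ∃ P, P = w * f - (1 - f) * t := ⟨_, rfl⟩
    obtain ⟨D, hD⟩ : ∃ D, D = w - t := ⟨_, rfl⟩
    rw [← hP] at k1 ⊢
    rw [← hD] at k2 ⊢
    field_simp
    ring
  have hG0 : G 0 = 0 := by
    simp only [hG]
    rw [mul_zero, sub_zero, sub_zero, zero_div, sub_zero, sub_sub, ← Real.log_mul (by linarith)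
      (by nlinarith), ← mul_assoc, ← sq, hs, sub_self]
  have hGw : G (-w) = 0 := by
    have a : w * f - (1 - f) * -w = w := by ring
    simp only [hG]
    rw [a, neg_div, div_self (by linarith), sub_sub (Real.log (2 * f)), ← Real.log_mul (by linarith)
      (by linarith), show (w - -w) * w = 4 by nlinarith, ← Real.log_div (by linarith) (by norm_num),
      hf, show 2 * (2 / Real.exp 1) / 4 = (Real.exp 1)⁻¹ by field_simp; norm_num, Real.log_inv,
      Real.log_exp]
    ring
  have hmem : -n ∈ Icc (-w) 0 := ⟨by linarith, by linarith⟩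
  obtain ⟨k1, k2⟩ := hk _ hmem
  have hGn : G (-n) = defect (w * f) (1 - f) (-n) := by
    have hwn : 0 < w - n := by linarith
    simp only [hG, defect]
    have a1 : 1 + -n / (w * f - (1 - f) * -n) = f * (w - n) / (w * f - (1 - f) * -n) := by
      rw [eq_div_iff k1.ne', add_mul, div_mul_cancel₀ _ k1.ne']; ring
    have a2 : 1 - (-n) ^ 2 / 2 = (w - -n) * (w - n) / 2 := by nlinarith
    rw [a1, a2, Real.log_div (by positivity) k1.ne', Real.log_div (by positivity) (by norm_num),
      Real.log_mul hf0.ne' hwn.ne', Real.log_mul k2.ne' hwn.ne', Real.log_mul (by norm_num) hf0.ne']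
    ring
  have key : 0 ≤ G (-n) := by
    rcases le_or_gt 0 (2 * (1 - f) ^ 2 * (-n) +
        (w * f - 3 * (w * f) * (1 - f) - w * (1 - f) ^ 2)) with hc | hc
    · rw [← hG0]
      refine le_of_hasDerivAt_nonpos hmem.2 (fun t ht => hGd t ⟨by linarith [ht.1], ht.2⟩) ?_
      intro t ht
      obtain ⟨k1, k2⟩ := hk t ⟨by linarith [ht.1], ht.2.le⟩
      apply div_nonpos_of_nonpos_of_nonneg _ (by positivity)
      apply mul_nonpos_of_nonpos_of_nonneg ht.2.le
      have := ht.1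
      have : 2 * (1 - f) ^ 2 * (-n) ≤ 2 * (1 - f) ^ 2 * t := by gcongr
      linarith
    · rw [← hGw]
      refine le_of_hasDerivAt_nonneg hmem.1 (fun t ht => hGd t ⟨ht.1, by linarith [ht.2]⟩) ?_
      intro t ht
      obtain ⟨k1, k2⟩ := hk t ⟨ht.1.le, by linarith [ht.2]⟩
      apply div_nonneg _ (by positivity)
      have := ht.2
      apply mul_nonneg_of_nonpos_of_nonpos (by linarith)
      have : 2 * (1 - f) ^ 2 * t ≤ 2 * (1 - f) ^ 2 * (-n) := by gcongr
      linarith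
  apply shape_le_of_defect_neg_nonneg hy
  · nlinarith
  · have : 0 < f * (w - n) := by apply mul_pos hf0; linarith
    linarith
  · rw [← hGn]; exact key

/-! ### The function `K` and its inverses -/

theorem continuousOn_leftInv_of_isCompact {f g : ℝ → ℝ} {s : Set ℝ} (hs : IsCompact s)
    (hf : ContinuousOn f s) (hg : ∀ x ∈ s, g (f x) = x) : ContinuousOn g (f '' s) := by
  rw [continuousOn_iff_isClosed]
  intro t ht
  refine ⟨f '' (s ∩ t), ((hs.inter_right ht).image_of_continuousOn
    (hf.mono inter_subset_left)).isClosed, ?_⟩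
  ext y
  constructor
  · rintro ⟨hy, x, hx, rfl⟩
    refine ⟨⟨x, ⟨hx, ?_⟩, rfl⟩, x, hx, rfl⟩
    rwa [mem_preimage, hg x hx] at hy
  · rintro ⟨⟨x, ⟨hx, hxt⟩, rfl⟩, hy⟩
    refine ⟨?_, hy⟩
    rwa [mem_preimage, hg x hx]

theorem K_pos {R : ℝ} (hR : 0 < R) : 0 < K R := div_pos (Real.exp_pos _) hR

theorem K_one : K 1 = 1 := by simp [K]

theorem hasDerivAt_K {R : ℝ} (hR : 0 < R) : HasDerivAt K (K R * (R - 1 / R)) R := by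
  have h1 : HasDerivAt (fun R : ℝ => (R ^ 2 - 1) / 2) R R := by
    have := ((hasDerivAt_pow 2 R).sub_const 1).div_const 2
    refine this.congr_deriv ?_
    simp
  refine (h1.exp.div (hasDerivAt_id R) hR.ne').congr_deriv ?_
  simp only [id, K]
  field_simp

theorem continuousOn_K : ContinuousOn K (Ioi 0) :=
  fun _ hR => (hasDerivAt_K hR).continuousAt.continuousWithinAt

theorem strictAntiOn_K : StrictAntiOn K (Ioc 0 1) := by
  apply strictAntiOn_of_deriv_neg (convex_Ioc 0 1)
  · exact continuousOn_K.mono fun x hx => hx.1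
  · intro R hR
    rw [interior_Ioc] at hR
    rw [(hasDerivAt_K hR.1).deriv]
    apply mul_neg_of_pos_of_neg (K_pos hR.1)
    have : 1 < 1 / R := by rw [lt_div_iff₀ hR.1]; linarith [hR.2]
    linarith [hR.2]

theorem strictMonoOn_K : StrictMonoOn K (Ici 1) := by
  apply strictMonoOn_of_deriv_pos (convex_Ici 1)
  · exact continuousOn_K.mono fun x hx => mem_Ioi.2 (lt_of_lt_of_le one_pos hx)
  · intro R hR
    rw [interior_Ici] at hR
    have hR : 1 < R := hR
    rw [(hasDerivAt_K (by linarith)).deriv]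
    apply mul_pos (K_pos (by linarith))
    have : 1 / R < 1 := by rw [div_lt_iff₀ (by linarith)]; linarith
    linarith

theorem one_le_K {R : ℝ} (hR : 0 < R) : 1 ≤ K R := by
  rw [← K_one]
  rcases le_total R 1 with h | h
  · exact strictAntiOn_K.antitoneOn ⟨hR, h⟩ ⟨one_pos, le_rfl⟩ h
  · exact strictMonoOn_K.monotoneOn self_mem_Ici (mem_Ici.2 h) h

theorem one_lt_K {R : ℝ} (hR : 0 < R) (h1 : R ≠ 1) : 1 < K R := by
  rw [← K_one]
  rcases lt_or_gt_of_ne h1 with h | h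
  · exact strictAntiOn_K ⟨hR, h.le⟩ ⟨one_pos, le_rfl⟩ h
  · exact strictMonoOn_K self_mem_Ici (mem_Ici.2 h.le) h

theorem exists_K_eq_of_le_one {k : ℝ} (hk : 1 ≤ k) : ∃ R ∈ Ioc (0 : ℝ) 1, K R = k := by
  have he := Real.exp_one_gt_d9
  have h0 : 0 < 1 / (2 * k) := by positivity
  have h1 : 1 / (2 * k) ≤ 1 := by rw [div_le_one (by positivity)]; linarith
  have hc : ContinuousOn K (Icc (1 / (2 * k)) 1) := continuousOn_K.mono fun x hx => h0.trans_le hx.1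
  have hbig : k ≤ K (1 / (2 * k)) := by
    rw [K, le_div_iff₀ h0]
    have : Real.exp (-1 / 2) ≤ Real.exp (((1 / (2 * k)) ^ 2 - 1) / 2) := by
      apply Real.exp_le_exp.2
      have := sq_nonneg (1 / (2 * k))
      linarith
    have h3 : (-1 / 2 : ℝ) + 1 ≤ Real.exp (-1 / 2) := Real.add_one_le_exp _
    have : k * (1 / (2 * k)) = 1 / 2 := by field_simp
    linarith
  obtain ⟨R, hR, h⟩ := intermediate_value_Icc' h1 hc ⟨by rw [K_one]; exact hk, hbig⟩
  exact ⟨R, ⟨h0.trans_le hR.1, hR.2⟩, h⟩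

theorem exists_K_eq_of_one_le {k : ℝ} (hk : 1 ≤ k) : ∃ R ∈ Ici (1 : ℝ), K R = k := by
  have h1 : (1 : ℝ) ≤ 2 * k := by linarith
  have hc : ContinuousOn K (Icc 1 (2 * k)) := continuousOn_K.mono fun x hx => by
    have := hx.1
    exact mem_Ioi.2 (by linarith)
  have hbig : k ≤ K (2 * k) := by
    rw [K, le_div_iff₀ (by linarith)]
    have := Real.add_one_le_exp (((2 * k) ^ 2 - 1) / 2)
    have h2 := Real.add_one_lt_exp (x := ((2 * k) ^ 2 - 1) / 2) (by nlinarith)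
    have h3 : Real.exp (((2 * k) ^ 2 - 1) / 2) = Real.exp (((2 * k) ^ 2 - 1) / 4) ^ 2 := by
      rw [← Real.exp_nat_mul]; congr 1; push_cast; ring
    have h4 := Real.add_one_le_exp (((2 * k) ^ 2 - 1) / 4)
    rw [h3]
    nlinarith [sq_nonneg (k - 1), mul_self_nonneg (k ^ 2 - 1)]
  obtain ⟨R, hR, h⟩ := intermediate_value_Icc h1 hc ⟨by rw [K_one]; exact hk, hbig⟩
  exact ⟨R, hR.1, h⟩

theorem Rminus_mem {k : ℝ} (hk : 1 ≤ k) : Rminus k ∈ Ioc (0 : ℝ) 1 :=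
  invFunOn_mem (exists_K_eq_of_le_one hk)

theorem K_Rminus {k : ℝ} (hk : 1 ≤ k) : K (Rminus k) = k :=
  invFunOn_eq (exists_K_eq_of_le_one hk)

theorem Rplus_mem {k : ℝ} (hk : 1 ≤ k) : 1 ≤ Rplus k :=
  invFunOn_mem (exists_K_eq_of_one_le hk)

theorem K_Rplus {k : ℝ} (hk : 1 ≤ k) : K (Rplus k) = k :=
  invFunOn_eq (exists_K_eq_of_one_le hk)

theorem Rminus_K {R : ℝ} (hR : R ∈ Ioc (0 : ℝ) 1) : Rminus (K R) = R :=
  strictAntiOn_K.injOn (Rminus_mem (one_le_K hR.1)) hR (K_Rminus (one_le_K hR.1))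

theorem Rminus_lt_one {k : ℝ} (hk : 1 < k) : Rminus k < 1 := by
  refine lt_of_le_of_ne (Rminus_mem hk.le).2 fun h => ?_
  have := K_Rminus hk.le
  rw [h, K_one] at this
  exact hk.ne this

theorem one_lt_Rplus {k : ℝ} (hk : 1 < k) : 1 < Rplus k := by
  refine lt_of_le_of_ne (Rplus_mem hk.le) fun h => ?_
  have := K_Rplus hk.le
  rw [← h, K_one] at this
  exact hk.ne this

theorem continuousOn_Rminus : ContinuousOn Rminus (Ici 1) := by
  intro k hk
  have hk : 1 ≤ k := hk
  have hr := Rminus_mem (show 1 ≤ k + 1 by linarith)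
  have h1 : ContinuousOn Rminus (K '' Icc (Rminus (k + 1)) 1) :=
    continuousOn_leftInv_of_isCompact isCompact_Icc
      (continuousOn_K.mono fun x hx => hr.1.trans_le hx.1)
      fun x hx => Rminus_K ⟨hr.1.trans_le hx.1, hx.2⟩
  have h2 : Icc 1 (k + 1) ⊆ K '' Icc (Rminus (k + 1)) 1 := by
    rintro j ⟨hj1, hj2⟩
    refine ⟨Rminus j, ⟨?_, (Rminus_mem hj1).2⟩, K_Rminus hj1⟩
    by_contra! h
    have := strictAntiOn_K (Rminus_mem hj1) hr h
    rw [K_Rminus hj1, K_Rminus (by linarith)] at this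
    linarith
  have h3 := (h1.mono h2) k ⟨hk, by linarith⟩
  refine h3.mono_of_mem_nhdsWithin ?_
  rw [mem_nhdsWithin_iff_exists_mem_nhds_inter]
  exact ⟨Iic (k + 1), Iic_mem_nhds (by linarith), fun x hx => ⟨hx.2, hx.1⟩⟩

theorem K_sq_mul {R : ℝ} (hR : 0 < R) :
    K R ^ 2 * ((1 + (R ^ 2 - 1)) * Real.exp (-(R ^ 2 - 1))) = 1 := by
  have : K R ^ 2 = Real.exp (R ^ 2 - 1) / R ^ 2 := by
    rw [K, div_pow, ← Real.exp_nat_mul]; congr 2; push_cast; ring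
  rw [this, Real.exp_neg]
  have := Real.exp_pos (R ^ 2 - 1)
  field_simp
  ring

/-- The shape function in terms of `K`: `n² / 2 = 1 - 1 / K²` for `n = shape (R² - 1)`. -/
theorem shape_sq_mul_K_sq {R : ℝ} (hR : 0 < R) :
    K R ^ 2 * (shape (R ^ 2 - 1) ^ 2 / 2) = K R ^ 2 - 1 := by
  have h := K_sq_mul hR
  have h2 := one_sub_shape_sq (R ^ 2 - 1)
  have : shape (R ^ 2 - 1) ^ 2 / 2 = 1 - (1 + (R ^ 2 - 1)) * Real.exp (-(R ^ 2 - 1)) := by linarith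
  rw [this]; linarith

theorem K_mul_shape {R : ℝ} (hR : 0 < R) :
    K R * shape (R ^ 2 - 1) = Real.sqrt 2 * Real.sqrt (K R ^ 2 - 1) := by
  have h := shape_sq_mul_K_sq hR
  have hK := K_pos hR
  have hn : 0 ≤ shape (R ^ 2 - 1) := Real.sqrt_nonneg _
  rw [← Real.sqrt_mul (by norm_num)]
  symm
  rw [Real.sqrt_eq_iff_mul_self_eq (by nlinarith [one_le_K hR]) (by positivity)]
  linarith

/-! ### Comparison functions for the polar angle -/

/-- The least value of the angle `ψ` on the trajectory of energy `c`. -/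
def omega (c : ℝ) : ℝ := Real.arcsin (1 / c)

/-- The comparison angle `χ`, given by `cos χ = cos ψ / cos ω`.  With `n = shape (R² - 1)` one has
`dχ / dψ = √2 / n` along the trajectory. -/
def chi (c ψ : ℝ) : ℝ := Real.arccos (Real.cos ψ / Real.cos (omega c))

theorem sin_omega {c : ℝ} (hc : 1 < c) : Real.sin (omega c) = 1 / c := by
  have : 0 < 1 / c := by positivity
  rw [omega, Real.sin_arcsin (by linarith)]
  rw [div_le_one (by linarith)]; exact hc.le

theorem omega_mem {c : ℝ} (hc : 1 < c) : omega c ∈ Ioo 0 (Real.pi / 2) := by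
  constructor
  · rw [omega, Real.arcsin_pos]; positivity
  · rw [omega, Real.arcsin_lt_pi_div_two, div_lt_one (by linarith)]; exact hc

theorem cos_omega_pos {c : ℝ} (hc : 1 < c) : 0 < Real.cos (omega c) := by
  obtain ⟨h1, h2⟩ := omega_mem hc
  exact Real.cos_pos_of_mem_Ioo ⟨by linarith, h2⟩

theorem cos_omega_sq {c : ℝ} (hc : 1 < c) : Real.cos (omega c) ^ 2 = 1 - 1 / c ^ 2 := by
  rw [Real.cos_sq', sin_omega hc, div_pow, one_pow]

theorem chi_omega {c : ℝ} (hc : 1 < c) : chi c (omega c) = 0 := by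
  rw [chi, div_self (cos_omega_pos hc).ne', Real.arccos_one]

theorem chi_pi_div_two (c : ℝ) : chi c (Real.pi / 2) = Real.pi / 2 := by
  rw [chi, Real.cos_pi_div_two, zero_div, Real.arccos_zero]

theorem chi_pi_sub (c ψ : ℝ) : chi c (Real.pi - ψ) = Real.pi - chi c ψ := by
  rw [chi, Real.cos_pi_sub, neg_div, Real.arccos_neg, chi]

theorem continuous_chi (c : ℝ) : Continuous (chi c) :=
  Real.continuous_arccos.comp (Real.continuous_cos.div_const _)

theorem hasDerivAt_chi {c ψ R : ℝ} (hc : 1 < c) (hR : 0 < R) (hR1 : R ≠ 1)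
    (hK : K R = c * Real.sin ψ) : HasDerivAt (chi c) (Real.sqrt 2 / shape (R ^ 2 - 1)) ψ := by
  have hC := cos_omega_pos hc
  have hC2 := cos_omega_sq hc
  have hK1 := one_lt_K hR hR1
  have hKn := K_mul_shape hR
  have hn : 0 < shape (R ^ 2 - 1) := shape_pos (by
    intro h
    have : (R - 1) * (R + 1) = 0 := by linarith
    rcases mul_eq_zero.1 this with h | h
    · exact hR1 (by linarith)
    · linarith)
  have hS : 0 < Real.sqrt (K R ^ 2 - 1) := Real.sqrt_pos.2 (by nlinarith)
  have hs : Real.sin ψ = K R / c := by rw [hK]; field_simp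
  -- `C² - cos² ψ = (K² - 1) / c²`
  have hdiff : 1 - (Real.cos ψ / Real.cos (omega c)) ^ 2 =
      (Real.sqrt (K R ^ 2 - 1) / (c * Real.cos (omega c))) ^ 2 := by
    rw [div_pow, div_pow, Real.sq_sqrt (by nlinarith), mul_pow, hC2, Real.cos_sq', hs]
    have : 1 - 1 / c ^ 2 ≠ 0 := by rw [← hC2]; positivity
    have h2 : c ^ 2 - 1 ≠ 0 := by nlinarith
    field_simp
    ring
  have hlt : (Real.cos ψ / Real.cos (omega c)) ^ 2 < 1 := by
    have : 0 < (Real.sqrt (K R ^ 2 - 1) / (c * Real.cos (omega c))) ^ 2 := by positivity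
    linarith
  have h1 : Real.cos ψ / Real.cos (omega c) ≠ 1 := by intro h; rw [h] at hlt; norm_num at hlt
  have h2 : Real.cos ψ / Real.cos (omega c) ≠ -1 := by intro h; rw [h] at hlt; norm_num at hlt
  have := (Real.hasDerivAt_arccos h2 h1).comp ψ
    ((Real.hasDerivAt_cos ψ).div_const (Real.cos (omega c)))
  refine this.congr_deriv ?_
  rw [hdiff, Real.sqrt_sq (by positivity), hs]
  have e : shape (R ^ 2 - 1) = Real.sqrt 2 * Real.sqrt (K R ^ 2 - 1) / K R := by
    rw [← hKn]; field_simp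
  rw [e]
  have : 0 < Real.sqrt 2 := by positivity
  field_simp

/-- The integrand of `deltaTheta`. -/
def dTheta (c R : ℝ) : ℝ := K R / (R * Real.sqrt (c ^ 2 - K R ^ 2))

/-- The angle `ψ < π / 2` at the point of the trajectory with coordinate `R`. -/
def psiOf (c R : ℝ) : ℝ := Real.arcsin (K R / c)

theorem dTheta_pos {c R : ℝ} (hR : 0 < R) (h : K R < c) : 0 < dTheta c R := by
  have hK := K_pos hR
  have : 0 < Real.sqrt (c ^ 2 - K R ^ 2) := Real.sqrt_pos.2 (by nlinarith)
  unfold dTheta; positivity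

theorem hasDerivAt_psiOf {c R : ℝ} (hc : 1 < c) (hR : 0 < R) (h : K R < c) :
    HasDerivAt (psiOf c) ((R ^ 2 - 1) * dTheta c R) R := by
  have hK := K_pos hR
  have h1 : K R / c < 1 := by rw [div_lt_one (by linarith)]; exact h
  have h0 : 0 < K R / c := by positivity
  have := (Real.hasDerivAt_arcsin (x := K R / c) (by linarith) h1.ne).comp R
    ((hasDerivAt_K hR).div_const c)
  refine this.congr_deriv ?_
  have e : 1 - (K R / c) ^ 2 = (c ^ 2 - K R ^ 2) / c ^ 2 := by field_simp
  have hp : 0 < Real.sqrt (c ^ 2 - K R ^ 2) := Real.sqrt_pos.2 (by nlinarith)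
  rw [e, Real.sqrt_div' _ (by positivity), Real.sqrt_sq (by linarith), dTheta]
  field_simp

theorem sin_psiOf {c R : ℝ} (hc : 1 < c) (hR : 0 < R) (h : K R ≤ c) :
    Real.sin (psiOf c R) = K R / c := by
  have hK := K_pos hR
  have : 0 ≤ K R / c := by positivity
  rw [psiOf, Real.sin_arcsin (by linarith)]
  rw [div_le_one (by linarith)]; exact h

theorem hasDerivAt_chi_psiOf {c R : ℝ} (hc : 1 < c) (hR : 0 < R) (hR1 : R ≠ 1) (h : K R < c) :
    HasDerivAt (fun R => chi c (psiOf c R))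
      (Real.sqrt 2 / shape (R ^ 2 - 1) * ((R ^ 2 - 1) * dTheta c R)) R := by
  refine (hasDerivAt_chi hc hR hR1 ?_).comp R (hasDerivAt_psiOf hc hR h)
  rw [sin_psiOf hc hR h.le]; field_simp

theorem continuousOn_psiOf (c : ℝ) : ContinuousOn (psiOf c) (Ioi 0) :=
  Real.continuous_arcsin.comp_continuousOn (continuousOn_K.div_const c)

theorem continuousOn_chi_psiOf (c : ℝ) : ContinuousOn (fun R => chi c (psiOf c R)) (Ioi 0) :=
  (continuous_chi c).comp_continuousOn (continuousOn_psiOf c)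

theorem continuousOn_dTheta (c : ℝ) : ContinuousOn (dTheta c) {R | 0 < R ∧ K R < c} := by
  have hK : ContinuousOn K {R | 0 < R ∧ K R < c} := continuousOn_K.mono fun R hR => hR.1
  unfold dTheta
  refine hK.div (continuousOn_id.mul (continuousOn_const.sub (hK.pow 2)).sqrt) ?_
  rintro R ⟨h0, h1⟩
  have := K_pos h0
  have : 0 < Real.sqrt (c ^ 2 - K R ^ 2) := Real.sqrt_pos.2 (by nlinarith)
  exact (mul_pos h0 this).ne'

theorem psiOf_one (c : ℝ) : psiOf c 1 = omega c := by rw [psiOf, K_one, omega]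

/-- On `[R₁, R₂] ⊆ (0, 1]` the polar angle is bounded below by the chord of the shape function. -/
theorem le_deltaTheta_of_le_one {c R₁ R₂ : ℝ} (hc : 1 < c) (h0 : 0 < R₁) (h12 : R₁ ≤ R₂)
    (h1 : R₂ ≤ 1) (hK : K R₁ < c) :
    (chi c (psiOf c R₁) - chi c (psiOf c R₂)) / Real.sqrt 2 +
      (1 - 1 / Real.sqrt 2) * (psiOf c R₁ - psiOf c R₂) ≤ deltaTheta c R₁ R₂ := by
  have hsub : Icc R₁ R₂ ⊆ {R | 0 < R ∧ K R < c} := fun R hR =>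
    ⟨h0.trans_le hR.1, (strictAntiOn_K.antitoneOn ⟨h0, h12.trans h1⟩
      ⟨h0.trans_le hR.1, hR.2.trans h1⟩ hR.1).trans_lt hK⟩
  have := intervalIntegral.sub_le_integral_of_hasDeriv_right_of_le h12
    (g := fun R => -(chi c (psiOf c R) / Real.sqrt 2 + (1 - 1 / Real.sqrt 2) * psiOf c R))
    (g' := fun R => -(Real.sqrt 2 / shape (R ^ 2 - 1) * ((R ^ 2 - 1) * dTheta c R) / Real.sqrt 2 +
      (1 - 1 / Real.sqrt 2) * ((R ^ 2 - 1) * dTheta c R))) (φ := dTheta c)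
    (((((continuousOn_chi_psiOf c).mono fun R hR => (hsub hR).1).div_const _).add
      (((continuousOn_psiOf c).mono fun R hR => (hsub hR).1).const_mul _)).neg)
    (fun R hR => by
      obtain ⟨hp, hk⟩ := hsub (Ioo_subset_Icc_self hR)
      exact (((hasDerivAt_chi_psiOf hc hp (by linarith [hR.2] : R < 1).ne hk).div_const _).add
        ((hasDerivAt_psiOf hc hp hk).const_mul _)).neg.hasDerivWithinAt)
    ((continuousOn_dTheta c).mono hsub).integrableOn_Icc ?_
  · rw [deltaTheta]
    unfold dTheta at this
    refine le_trans (le_of_eq ?_) this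
    ring
  · intro R hR
    obtain ⟨hp, hk⟩ := hsub (Ioo_subset_Icc_self hR)
    have hR1 : R < 1 := by linarith [hR.2]
    have hd := dTheta_pos hp hk
    have hy : R ^ 2 - 1 ∈ Ioo (-1) (0 : ℝ) := ⟨by nlinarith, by nlinarith⟩
    have hs := shape_ge_of_neg hy
    have hn := shape_pos hy.2.ne
    set n := shape (R ^ 2 - 1)
    set q := 1 - 1 / Real.sqrt 2
    have e : -(Real.sqrt 2 / n * ((R ^ 2 - 1) * dTheta c R) / Real.sqrt 2 +
        q * ((R ^ 2 - 1) * dTheta c R)) = (-(R ^ 2 - 1) * (1 + q * n)) / n * dTheta c R := by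
      have : 0 < Real.sqrt 2 := by positivity
      field_simp
    simp only [e]
    have : (-(R ^ 2 - 1) * (1 + q * n)) / n ≤ 1 := by rw [div_le_one hn]; exact hs
    nlinarith

/-- On `[R₁, R₂] ⊆ [1, ∞)` the polar angle is bounded below by the chord of the shape function. -/
theorem le_deltaTheta_of_one_le {c R₁ R₂ : ℝ} (hc : 1 < c) (h1 : 1 ≤ R₁) (h12 : R₁ ≤ R₂)
    (hK : K R₂ < c) :
    (chi c (psiOf c R₂) - chi c (psiOf c R₁)) / Real.sqrt 2 -
      (psiOf c R₂ - psiOf c R₁) / Real.sqrt 2 ≤ deltaTheta c R₁ R₂ := by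
  have hsub : Icc R₁ R₂ ⊆ {R | 0 < R ∧ K R < c} := fun R hR =>
    ⟨by linarith [hR.1], (strictMonoOn_K.monotoneOn (mem_Ici.2 (h1.trans hR.1))
      (mem_Ici.2 (h1.trans h12)) hR.2).trans_lt hK⟩
  have := intervalIntegral.sub_le_integral_of_hasDeriv_right_of_le h12
    (g := fun R => chi c (psiOf c R) / Real.sqrt 2 - psiOf c R / Real.sqrt 2)
    (g' := fun R => Real.sqrt 2 / shape (R ^ 2 - 1) * ((R ^ 2 - 1) * dTheta c R) / Real.sqrt 2 -
      (R ^ 2 - 1) * dTheta c R / Real.sqrt 2) (φ := dTheta c)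
    ((((continuousOn_chi_psiOf c).mono fun R hR => (hsub hR).1).div_const _).sub
      (((continuousOn_psiOf c).mono fun R hR => (hsub hR).1).div_const _))
    (fun R hR => by
      obtain ⟨hp, hk⟩ := hsub (Ioo_subset_Icc_self hR)
      exact (((hasDerivAt_chi_psiOf hc hp (by linarith [hR.1] : 1 < R).ne' hk).div_const _).sub
        ((hasDerivAt_psiOf hc hp hk).div_const _)).hasDerivWithinAt)
    ((continuousOn_dTheta c).mono hsub).integrableOn_Icc ?_
  · rw [deltaTheta]
    unfold dTheta at this
    refine le_trans (le_of_eq ?_) this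
    ring
  · intro R hR
    obtain ⟨hp, hk⟩ := hsub (Ioo_subset_Icc_self hR)
    have hR1 : 1 < R := by linarith [hR.1]
    have hd := dTheta_pos hp hk
    have hy : 0 < R ^ 2 - 1 := by nlinarith
    have hs := shape_ge_of_pos hy
    have hn := shape_pos hy.ne'
    set n := shape (R ^ 2 - 1)
    have e : Real.sqrt 2 / n * ((R ^ 2 - 1) * dTheta c R) / Real.sqrt 2 -
        (R ^ 2 - 1) * dTheta c R / Real.sqrt 2 =
        ((R ^ 2 - 1) * (1 - 1 / Real.sqrt 2 * n)) / n * dTheta c R := by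
      have : 0 < Real.sqrt 2 := by positivity
      field_simp
    simp only [e]
    have : ((R ^ 2 - 1) * (1 - 1 / Real.sqrt 2 * n)) / n ≤ 1 := by rw [div_le_one hn]; exact hs
    nlinarith

/-- On `[R₁, R₂] ⊆ [1, ∞)` the polar angle is bounded above by `n ≤ y`. -/
theorem deltaTheta_le_of_one_le {c R₁ R₂ : ℝ} (hc : 1 < c) (h1 : 1 ≤ R₁) (h12 : R₁ ≤ R₂)
    (hK : K R₂ < c) :
    deltaTheta c R₁ R₂ ≤ (chi c (psiOf c R₂) - chi c (psiOf c R₁)) / Real.sqrt 2 := by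
  have hsub : Icc R₁ R₂ ⊆ {R | 0 < R ∧ K R < c} := fun R hR =>
    ⟨by linarith [hR.1], (strictMonoOn_K.monotoneOn (mem_Ici.2 (h1.trans hR.1))
      (mem_Ici.2 (h1.trans h12)) hR.2).trans_lt hK⟩
  have := intervalIntegral.integral_le_sub_of_hasDeriv_right_of_le h12
    (g := fun R => chi c (psiOf c R) / Real.sqrt 2)
    (g' := fun R => Real.sqrt 2 / shape (R ^ 2 - 1) * ((R ^ 2 - 1) * dTheta c R) / Real.sqrt 2)
    (φ := dTheta c)
    (((continuousOn_chi_psiOf c).mono fun R hR => (hsub hR).1).div_const _)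
    (fun R hR => by
      obtain ⟨hp, hk⟩ := hsub (Ioo_subset_Icc_self hR)
      exact ((hasDerivAt_chi_psiOf hc hp
        (by linarith [hR.1] : 1 < R).ne' hk).div_const _).hasDerivWithinAt)
    ((continuousOn_dTheta c).mono hsub).integrableOn_Icc ?_
  · rw [deltaTheta]
    unfold dTheta at this
    refine this.trans (le_of_eq ?_)
    ring
  · intro R hR
    obtain ⟨hp, hk⟩ := hsub (Ioo_subset_Icc_self hR)
    have hR1 : 1 < R := by linarith [hR.1]
    have hd := dTheta_pos hp hk
    have hy : 0 < R ^ 2 - 1 := by nlinarith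
    have hs := shape_le_self hy
    have hn := shape_pos hy.ne'
    set n := shape (R ^ 2 - 1)
    have e : Real.sqrt 2 / n * ((R ^ 2 - 1) * dTheta c R) / Real.sqrt 2 =
        (R ^ 2 - 1) / n * dTheta c R := by
      have : 0 < Real.sqrt 2 := by positivity
      field_simp
    simp only [e]
    have : 1 ≤ (R ^ 2 - 1) / n := by rw [one_le_div hn]; exact hs
    nlinarith

/-! ### The points `A` and `D` -/

theorem sqrt_three_bounds : 1.732 < Real.sqrt 3 ∧ Real.sqrt 3 < 1.7321 := by
  constructor
  · apply Real.lt_sqrt_of_sq_lt; norm_num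
  · rw [Real.sqrt_lt' (by norm_num)]; norm_num

theorem cStar_lt_iff {c : ℝ} : cStar < c ↔ 1 < Real.sqrt 3 / 2 * c := by
  have := sqrt_three_bounds.1
  rw [cStar, div_lt_iff₀ (by linarith)]
  constructor <;> intro h <;> linarith

theorem one_lt_of_cStar_lt {c : ℝ} (hc : cStar < c) : 1 < c := by
  rw [cStar_lt_iff] at hc
  by_contra! h
  nlinarith [sqrt_three_bounds.1, sqrt_three_bounds.2]

theorem RA_spec {c : ℝ} (hc : cStar < c) : 1 < RA c ∧ K (RA c) = Real.sqrt 3 / 2 * c :=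
  ⟨one_lt_Rplus (cStar_lt_iff.1 hc), K_Rplus (cStar_lt_iff.1 hc).le⟩

theorem RD_spec {c : ℝ} (hc : cStar < c) :
    0 < RD c ∧ RD c < 1 ∧ K (RD c) = Real.sqrt 3 / 2 * c :=
  ⟨(Rminus_mem (cStar_lt_iff.1 hc).le).1, Rminus_lt_one (cStar_lt_iff.1 hc),
    K_Rminus (cStar_lt_iff.1 hc).le⟩

theorem psiOf_of_K_eq {c R : ℝ} (hc : 1 < c) (h : K R = Real.sqrt 3 / 2 * c) :
    psiOf c R = Real.pi / 3 := by
  have : K R / c = Real.sin (Real.pi / 3) := by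
    rw [h, Real.sin_pi_div_three]; field_simp
  rw [psiOf, this, Real.arcsin_sin (by linarith [Real.pi_pos]) (by linarith [Real.pi_pos])]

theorem mul_c_lt_c {c : ℝ} (hc : 1 < c) : Real.sqrt 3 / 2 * c < c := by
  nlinarith [sqrt_three_bounds.2]

theorem Icc_RD_RA_subset {c : ℝ} (hc : cStar < c) : Icc (RD c) (RA c) ⊆ {R | 0 < R ∧ K R < c} := by
  obtain ⟨a1, a2⟩ := RA_spec hc
  obtain ⟨d0, d1, d2⟩ := RD_spec hc
  have hm := mul_c_lt_c (one_lt_of_cStar_lt hc)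
  intro R hR
  have hR0 : 0 < R := d0.trans_le hR.1
  refine ⟨hR0, ?_⟩
  rcases le_total R 1 with h | h
  · exact (strictAntiOn_K.antitoneOn ⟨d0, d1.le⟩ ⟨hR0, h⟩ hR.1).trans_lt (by rw [d2]; exact hm)
  · exact (strictMonoOn_K.monotoneOn (mem_Ici.2 h) (mem_Ici.2 a1.le) hR.2).trans_lt
      (by rw [a2]; exact hm)

theorem intervalIntegrable_dTheta {c a b : ℝ} (h : uIcc a b ⊆ {R | 0 < R ∧ K R < c}) :
    IntervalIntegrable (dTheta c) MeasureTheory.volume a b :=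
  ((continuousOn_dTheta c).mono h).intervalIntegrable

theorem deltaTheta_add {c a b d : ℝ} (h1 : uIcc a b ⊆ {R | 0 < R ∧ K R < c})
    (h2 : uIcc b d ⊆ {R | 0 < R ∧ K R < c}) :
    deltaTheta c a b + deltaTheta c b d = deltaTheta c a d :=
  intervalIntegral.integral_add_adjacent_intervals (intervalIntegrable_dTheta h1)
    (intervalIntegrable_dTheta h2)

theorem h2_eq {c : ℝ} (hc : cStar < c) : h2 c = deltaTheta c (RD c) 1 + thetaNA c := by
  obtain ⟨a1, a2⟩ := RA_spec hc
  obtain ⟨d0, d1, d2⟩ := RD_spec hc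
  have hs := Icc_RD_RA_subset hc
  rw [thetaNA, deltaTheta_add, h2]
  · rw [uIcc_of_le d1.le]; exact (Icc_subset_Icc_right a1.le).trans hs
  · rw [uIcc_of_le a1.le]; exact (Icc_subset_Icc_left d1.le).trans hs

/-- The chord of the shape function on `R > 1`, integrated from `R = 1` to the point `A`. -/
theorem le_thetaNA {c : ℝ} (hc : cStar < c) :
    (chi c (Real.pi / 3) - (Real.pi / 3 - omega c)) / Real.sqrt 2 ≤ thetaNA c := by
  obtain ⟨a1, a2⟩ := RA_spec hc
  have hc1 := one_lt_of_cStar_lt hc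
  have := le_deltaTheta_of_one_le hc1 le_rfl a1.le (by rw [a2]; exact mul_c_lt_c hc1)
  rw [psiOf_of_K_eq hc1 a2, psiOf_one, chi_omega hc1] at this
  refine le_trans (le_of_eq ?_) this
  ring

theorem le_h1_integrand {c : ℝ} (hc : cStar < c) {ψ : ℝ}
    (hψ : ψ ∈ Icc (Real.pi / 3) (2 * Real.pi / 3)) : Real.sqrt 3 / 2 * c ≤ c * Real.sin ψ := by
  have hc1 := one_lt_of_cStar_lt hc
  have hpi := Real.pi_pos
  have : Real.sqrt 3 / 2 ≤ Real.sin ψ := by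
    rw [← Real.sin_pi_div_three]
    rcases le_total ψ (Real.pi / 2) with h | h
    · exact Real.sin_le_sin_of_le_of_le_pi_div_two (by linarith) h hψ.1
    · rw [← Real.sin_pi_sub ψ]
      apply Real.sin_le_sin_of_le_of_le_pi_div_two <;> linarith [hψ.2]
  nlinarith

theorem continuousOn_h1_integrand {c : ℝ} (hc : cStar < c) :
    ContinuousOn (fun ψ => 1 / (1 - Rminus (c * Real.sin ψ) ^ 2))
      (Icc (Real.pi / 3) (2 * Real.pi / 3)) := by
  have h1 := cStar_lt_iff.1 hc
  have hR : ContinuousOn (fun ψ => Rminus (c * Real.sin ψ)) (Icc (Real.pi / 3) (2 * Real.pi / 3)) :=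
    continuousOn_Rminus.comp (by fun_prop) fun ψ hψ => (h1.le.trans (le_h1_integrand hc hψ))
  refine continuousOn_const.div (continuousOn_const.sub (hR.pow 2)) fun ψ hψ => ?_
  have h2 := Rminus_lt_one (h1.trans_le (le_h1_integrand hc hψ))
  have h3 := (Rminus_mem (h1.le.trans (le_h1_integrand hc hψ))).1
  nlinarith

/-- The chord of the shape function on `R < 1`, integrated over `[π / 3, 2π / 3]`. -/
theorem le_h1 {c : ℝ} (hc : cStar < c) :
    (Real.pi - 2 * chi c (Real.pi / 3)) / Real.sqrt 2 +
      (1 - 1 / Real.sqrt 2) * (Real.pi / 3) ≤ h1 c := by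
  have hc1 := one_lt_of_cStar_lt hc
  have hpi := Real.pi_pos
  have := intervalIntegral.sub_le_integral_of_hasDeriv_right_of_le
    (a := Real.pi / 3) (b := 2 * Real.pi / 3) (by linarith)
    (g := fun ψ => chi c ψ / Real.sqrt 2 + (1 - 1 / Real.sqrt 2) * ψ)
    (g' := fun ψ => Real.sqrt 2 / shape (Rminus (c * Real.sin ψ) ^ 2 - 1) / Real.sqrt 2 +
      (1 - 1 / Real.sqrt 2) * 1) (φ := fun ψ => 1 / (1 - Rminus (c * Real.sin ψ) ^ 2))
    ((((continuous_chi c).div_const _).add (continuous_id.const_mul _)).continuousOn)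
    (fun ψ hψ => by
      have hk := (cStar_lt_iff.1 hc).trans_le (le_h1_integrand hc (Ioo_subset_Icc_self hψ))
      exact (((hasDerivAt_chi hc1 (Rminus_mem hk.le).1 (Rminus_lt_one hk).ne
        (K_Rminus hk.le)).div_const _).add ((hasDerivAt_id ψ).const_mul _)).hasDerivWithinAt)
    (continuousOn_h1_integrand hc).integrableOn_Icc ?_
  · rw [h1]
    refine le_trans (le_of_eq ?_) this
    rw [show 2 * Real.pi / 3 = Real.pi - Real.pi / 3 by ring, chi_pi_sub]
    ring
  · intro ψ hψ
    have hk := (cStar_lt_iff.1 hc).trans_le (le_h1_integrand hc (Ioo_subset_Icc_self hψ))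
    have hr0 := (Rminus_mem hk.le).1
    have hr1 := Rminus_lt_one hk
    set R := Rminus (c * Real.sin ψ)
    have hy : R ^ 2 - 1 ∈ Ioo (-1) (0 : ℝ) := ⟨by nlinarith, by nlinarith⟩
    have hs := shape_ge_of_neg hy
    have hn := shape_pos hy.2.ne
    have hx : 0 < 1 - R ^ 2 := by linarith [hy.2]
    set n := shape (R ^ 2 - 1)
    set q := 1 - 1 / Real.sqrt 2
    have h2 : 0 < Real.sqrt 2 := by positivity
    have e : Real.sqrt 2 / n / Real.sqrt 2 + q * 1 = (1 + q * n) / n := by field_simp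
    rw [e, div_le_div_iff₀ hn hx]
    linarith

/-! ### The lower bound for the sum of the angles -/

theorem half_lt_cos {w : ℝ} (h0 : 0 ≤ w) (h1 : w < Real.pi / 3) :
    1 / 2 < Real.cos w := by
  rw [← Real.cos_pi_div_three]
  exact Real.cos_lt_cos_of_nonneg_of_le_pi h0 (by linarith [Real.pi_pos]) h1

theorem hasDerivAt_arccos_inv_cos {w : ℝ} (h0 : 0 ≤ w) (h1 : w < Real.pi / 3) :
    HasDerivAt (fun w => Real.arccos (1 / 2 / Real.cos w))
      (-(Real.sin w / (Real.cos w * Real.sqrt (4 * Real.cos w ^ 2 - 1)))) w := by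
  have hc := half_lt_cos h0 h1
  have hlt : 1 / 2 / Real.cos w < 1 := by rw [div_lt_one (by linarith)]; exact hc
  have hgt : 0 < 1 / 2 / Real.cos w := by have : 0 < Real.cos w := by linarith
                                          positivity
  have hS : 0 < Real.sqrt (4 * Real.cos w ^ 2 - 1) := Real.sqrt_pos.2 (by nlinarith)
  have := (Real.hasDerivAt_arccos (x := 1 / 2 / Real.cos w) (by linarith) hlt.ne).comp w
    ((hasDerivAt_const w (1 / 2 : ℝ)).div (Real.hasDerivAt_cos w) (by linarith))
  refine this.congr_deriv ?_
  have e : 1 - (1 / 2 / Real.cos w) ^ 2 =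
      (Real.sqrt (4 * Real.cos w ^ 2 - 1) / (2 * Real.cos w)) ^ 2 := by
    have : 0 < Real.cos w := by linarith
    rw [div_pow (Real.sqrt _), Real.sq_sqrt (by nlinarith)]
    field_simp
    ring
  have : 0 < Real.cos w := by linarith
  rw [e, Real.sqrt_sq (by positivity)]
  field_simp
  ring

/-- The function whose positivity is the lower bound `π` for the sum of the angles, in terms of
the angle `ω = arcsin (1 / c)`.  It is concave and vanishes at `ω = 0`. -/
def excess (w : ℝ) : ℝ :=
  Real.arccos (1 / 2 / Real.cos w) - Real.pi / 3 + (3 / 2 - 1 / Real.sqrt 2) * w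

theorem excess_zero : excess 0 = 0 := by
  have : Real.arccos (1 / 2) = Real.pi / 3 := by
    rw [← Real.cos_pi_div_three, Real.arccos_cos] <;> linarith [Real.pi_pos]
  rw [excess, Real.cos_zero, div_one, this]; ring

theorem concaveOn_excess {b : ℝ} (hb : b < Real.pi / 3) : ConcaveOn ℝ (Icc 0 b) excess := by
  have hd : ∀ w, 0 ≤ w → w < Real.pi / 3 → HasDerivAt excess
      (-(Real.sin w / (Real.cos w * Real.sqrt (4 * Real.cos w ^ 2 - 1))) +
        (3 / 2 - 1 / Real.sqrt 2) * 1) w := fun w h0 h1 =>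
    ((hasDerivAt_arccos_inv_cos h0 h1).sub_const _).add ((hasDerivAt_id w).const_mul _)
  apply AntitoneOn.concaveOn_of_deriv (convex_Icc 0 b)
  · exact fun w hw => (hd w hw.1 (by linarith [hw.2])).continuousAt.continuousWithinAt
  · intro w hw
    rw [interior_Icc] at hw
    exact (hd w hw.1.le (by linarith [hw.2])).differentiableAt.differentiableWithinAt
  · rw [interior_Icc]
    intro v hv w hw hvw
    rw [(hd v hv.1.le (by linarith [hv.2])).deriv, (hd w hw.1.le (by linarith [hw.2])).deriv]
    have hpi := Real.pi_pos
    have c1 := half_lt_cos hw.1.le (by linarith [hw.2])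
    have c2 : Real.cos w ≤ Real.cos v :=
      Real.cos_le_cos_of_nonneg_of_le_pi hv.1.le (by linarith [hw.2]) hvw
    have s1 : Real.sin v ≤ Real.sin w :=
      Real.sin_le_sin_of_le_of_le_pi_div_two (by linarith [hv.1]) (by linarith [hw.2]) hvw
    have s0 : 0 ≤ Real.sin v := Real.sin_nonneg_of_nonneg_of_le_pi hv.1.le (by linarith [hv.2])
    have hS : 0 < Real.sqrt (4 * Real.cos w ^ 2 - 1) := Real.sqrt_pos.2 (by nlinarith)
    have hSS : Real.sqrt (4 * Real.cos w ^ 2 - 1) ≤ Real.sqrt (4 * Real.cos v ^ 2 - 1) :=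
      Real.sqrt_le_sqrt (by nlinarith)
    have : Real.sin v / (Real.cos v * Real.sqrt (4 * Real.cos v ^ 2 - 1)) ≤
        Real.sin w / (Real.cos w * Real.sqrt (4 * Real.cos w ^ 2 - 1)) := by
      have : 0 < Real.cos w := by linarith
      have : 0 < Real.cos v := by linarith
      have : 0 ≤ Real.sin w := s0.trans s1
      gcongr
    linarith

theorem cBar_eq : cBar = Real.exp 0.15325 := by rw [cBar]; norm_num

theorem cBar_sq_gt : 1.3586 < cBar ^ 2 := by
  rw [cBar_eq, ← Real.exp_nat_mul]
  have := Real.sum_le_exp_of_nonneg (x := ((2 : ℕ) : ℝ) * 0.15325) (by norm_num) 5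
  refine lt_of_lt_of_le ?_ this
  simp only [Finset.sum_range_succ, Finset.sum_range_zero, Nat.factorial]
  norm_num

theorem cBar_lt : cBar < 1.16563 := by
  rw [cBar_eq]
  have := Real.exp_bound' (x := 0.15325) (by norm_num) (by norm_num) (n := 4) (by norm_num)
  refine lt_of_le_of_lt this ?_
  simp only [Finset.sum_range_succ, Finset.sum_range_zero, Nat.factorial]
  norm_num

theorem cBar_gt : 1.1655 < cBar := by
  have := cBar_sq_gt
  have h0 : 0 < cBar := Real.exp_pos _
  nlinarith

theorem sin_pi_div_three_sub_lt {d : ℝ} (h0 : 0 < d) :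
    Real.sin (Real.pi / 3 - d) < 0.86605 - (d - d ^ 3 / 6) / 2 := by
  rw [Real.sin_sub, Real.sin_pi_div_three, Real.cos_pi_div_three]
  have := Real.sin_gt_sub_cube h0
  have := Real.cos_le_one d
  have := sqrt_three_bounds
  nlinarith

theorem omega_cBar_mem : 1.03 < omega cBar ∧ omega cBar < Real.pi / 3 := by
  have h1 := cBar_gt
  have h2 := cBar_lt
  have hc : 1 < cBar := by linarith
  obtain ⟨o0, o1⟩ := omega_mem hc
  have hs := sin_omega hc
  have hpi := Real.pi_gt_d6
  have hpi2 := Real.pi_lt_d6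
  constructor
  · have h3 := sin_pi_div_three_sub_lt (d := 0.0171) (by norm_num)
    by_contra! h
    have : Real.sin (omega cBar) ≤ Real.sin (Real.pi / 3 - 0.0171) :=
      Real.sin_le_sin_of_le_of_le_pi_div_two (by linarith) (by linarith) (by linarith)
    rw [hs] at this
    have h4 : 1 / 1.16563 < 1 / cBar := by gcongr
    norm_num at h3 h4 this
    linarith
  · by_contra! h
    have : Real.sin (Real.pi / 3) ≤ Real.sin (omega cBar) :=
      Real.sin_le_sin_of_le_of_le_pi_div_two (by linarith) o1.le h
    rw [hs, Real.sin_pi_div_three] at this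
    have h4 : 1 / cBar < 1 / 1.1655 := by gcongr
    have h5 := sqrt_three_bounds.1
    rw [one_div] at this
    norm_num at h4 h5
    linarith

theorem excess_omega_cBar_pos : 0 < excess (omega cBar) := by
  obtain ⟨o0, o1⟩ := omega_cBar_mem
  have hc : 1 < cBar := by linarith [cBar_gt]
  have hC := cos_omega_pos hc
  have hC2 := cos_omega_sq hc
  obtain ⟨w1, w2⟩ := sqrt_two_bounds
  have hpi := Real.pi_lt_d6
  have hw : 1 / Real.sqrt 2 < 0.70712 := by
    rw [div_lt_iff₀ (by linarith)]; linarith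
  -- the cosine of `ω` at `c = cBar`
  have hCl : 0.51375 < Real.cos (omega cBar) := by
    have h3 : 1 / cBar ^ 2 < 1 / 1.3586 := by
      have := cBar_sq_gt
      gcongr
    norm_num at h3
    have h4 : 0.51375 ^ 2 < Real.cos (omega cBar) ^ 2 := by rw [hC2, one_div]; norm_num; linarith
    exact lt_of_pow_lt_pow_left₀ 2 hC.le h4
  set d := Real.pi / 3 - (3 / 2 - 1 / Real.sqrt 2) * omega cBar with hd
  have hd1 : d < 0.2306 := by nlinarith
  have hlt : d < Real.arccos (1 / 2 / Real.cos (omega cBar)) := by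
    rcases lt_or_ge d 0 with h | h
    · exact h.trans_le (Real.arccos_nonneg _)
    · have hcd := Real.one_sub_sq_div_two_le_cos (x := d)
      have hz : 1 / 2 / Real.cos (omega cBar) < Real.cos d := by
        have h5 : 0.9734 ≤ Real.cos d := by nlinarith
        rw [div_lt_iff₀ hC]
        nlinarith
      have := Real.arccos_lt_arccos (x := 1 / 2 / Real.cos (omega cBar)) (y := Real.cos d)
        (by have : 0 < 1 / 2 / Real.cos (omega cBar) := by positivity
            linarith) hz (Real.cos_le_one d)
      rwa [Real.arccos_cos h (by linarith)] at this
  rw [excess]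
  linarith

/-- The sum of the angles exceeds `π` for all energies `c ≥ cBar`: the chord bounds of the three
terms add up to `π` and a positive multiple of `excess (omega c)`. -/
theorem pi_lt_of_cBar_le {c : ℝ} (hc : cBar ≤ c) :
    Real.pi < h1 c + 2 * h2 c + 2 * thetaNA c := by
  have hs3 := sqrt_three_bounds
  have hstar : cStar < c := by
    rw [cStar_lt_iff]
    nlinarith [cBar_gt]
  have hc1 := one_lt_of_cStar_lt hstar
  obtain ⟨o0, o1⟩ := omega_mem hc1
  have hle : omega c ≤ omega cBar := by
    apply Real.monotone_arcsin
    have := cBar_gt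
    gcongr
  have hex : 0 < excess (omega c) := by
    have hconc := concaveOn_excess omega_cBar_mem.2
    have hB : 0 < omega cBar := by linarith [omega_cBar_mem.1]
    have := hconc.2 (⟨le_rfl, hB.le⟩ : (0 : ℝ) ∈ Icc 0 (omega cBar)) ⟨hB.le, le_rfl⟩
      (by rw [sub_nonneg, div_le_one hB]; exact hle : 0 ≤ 1 - omega c / omega cBar)
      (by positivity : 0 ≤ omega c / omega cBar) (by ring)
    simp only [smul_eq_mul, mul_zero, zero_add, excess_zero] at this
    rw [div_mul_cancel₀ _ hB.ne'] at this
    have h3 : 0 < omega c / omega cBar * excess (omega cBar) :=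
      mul_pos (by positivity) excess_omega_cBar_pos
    linarith
  obtain ⟨d0, d1, d2⟩ := RD_spec hstar
  have hDN := le_deltaTheta_of_le_one hc1 d0 d1.le le_rfl (by rw [d2]; exact mul_c_lt_c hc1)
  rw [psiOf_one, psiOf_of_K_eq hc1 d2, chi_omega hc1] at hDN
  have hNA := le_thetaNA hstar
  have hh1 := le_h1 hstar
  rw [h2_eq hstar]
  have hchi : chi c (Real.pi / 3) = Real.arccos (1 / 2 / Real.cos (omega c)) := by
    rw [chi, Real.cos_pi_div_three]
  rw [excess, ← hchi] at hex
  set X := chi c (Real.pi / 3)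
  have hr : 0 < 1 / Real.sqrt 2 := by positivity
  have hrr : 1 / Real.sqrt 2 * (1 / Real.sqrt 2) = 1 / 2 := by
    rw [div_mul_div_comm, Real.mul_self_sqrt (by norm_num)]; norm_num
  set r := 1 / Real.sqrt 2 with hrdef
  have einv : ∀ z, z / Real.sqrt 2 = z * r := fun z => div_eq_mul_one_div _ _
  simp only [einv] at hDN hNA hh1
  have hexr := mul_pos hr hex
  have e : r * (X - Real.pi / 3 + (3 / 2 - r) * omega c) =
      r * X - r * (Real.pi / 3) + 3 / 2 * r * omega c - omega c / 2 := by
    linear_combination (-omega c) * hrr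
  rw [e] at hexr
  linarith

/-! ### Trajectories in the phase plane -/

/-- The trajectories of the shrinker equation, in terms of the tangential part `σ = ⟨x, x_s⟩` and
the normal part `κ = x × x_s` of the position, as functions of the arc length on `[a, b]`.  Only
counterclockwise motion (`κ > 0`) is considered, and `c` is the energy. -/
structure Flow (c a b : ℝ) (σ κ : ℝ → ℝ) : Prop where
  hasDeriv_fst : ∀ s ∈ Icc a b, HasDerivWithinAt σ (1 - κ s ^ 2) (Icc a b) s
  hasDeriv_snd : ∀ s ∈ Icc a b, HasDerivWithinAt κ (σ s * κ s) (Icc a b) s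
  energy : ∀ s ∈ Icc a b, Real.exp ((σ s ^ 2 + κ s ^ 2 - 1) / 2) = c * κ s
  pos : ∀ s ∈ Icc a b, 0 < κ s

/-- The distance to the origin along a trajectory. -/
def rad (σ κ : ℝ → ℝ) (s : ℝ) : ℝ := Real.sqrt (σ s ^ 2 + κ s ^ 2)

/-- The angle `ψ` from the position to the tangent, given by `cot ψ = σ / κ`. -/
def psi (σ κ : ℝ → ℝ) (s : ℝ) : ℝ := Real.pi / 2 - Real.arctan (σ s / κ s)

/-- The change of the polar angle along a trajectory. -/
def ang (σ κ : ℝ → ℝ) (a b : ℝ) : ℝ := ∫ s in a..b, κ s / (σ s ^ 2 + κ s ^ 2)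

namespace Flow

variable {c a b : ℝ} {σ κ : ℝ → ℝ}

theorem mono (h : Flow c a b σ κ) {a' b' : ℝ} (ha : a ≤ a') (hb : b' ≤ b) : Flow c a' b' σ κ :=
  have hs : Icc a' b' ⊆ Icc a b := Icc_subset_Icc ha hb
  ⟨fun s m => (h.hasDeriv_fst s (hs m)).mono hs, fun s m => (h.hasDeriv_snd s (hs m)).mono hs,
    fun s m => h.energy s (hs m), fun s m => h.pos s (hs m)⟩

/-- Traversing a trajectory backwards, and reflecting the plane, gives a trajectory. -/
theorem reflect (h : Flow c a b σ κ) (x : ℝ) :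
    Flow c (x - b) (x - a) (fun s => -σ (x - s)) (fun s => κ (x - s)) := by
  have hm : MapsTo (fun s => x - s) (Icc (x - b) (x - a)) (Icc a b) := fun s hs =>
    ⟨by linarith [hs.2], by linarith [hs.1]⟩
  have hd : ∀ s, HasDerivWithinAt (fun s => x - s) (-1) (Icc (x - b) (x - a)) s := fun s =>
    ((hasDerivAt_id s).const_sub x).hasDerivWithinAt
  refine ⟨fun s m => ?_, fun s m => ?_, fun s m => ?_, fun s m => h.pos _ (hm m)⟩
  · refine (((h.hasDeriv_fst _ (hm m)).comp s (hd s) hm).neg).congr_deriv ?_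
    ring
  · refine ((h.hasDeriv_snd _ (hm m)).comp s (hd s) hm).congr_deriv ?_
    ring
  · rw [← h.energy _ (hm m)]; congr 2; ring

theorem continuousOn_fst (h : Flow c a b σ κ) : ContinuousOn σ (Icc a b) :=
  fun s hs => (h.hasDeriv_fst s hs).continuousWithinAt

theorem continuousOn_snd (h : Flow c a b σ κ) : ContinuousOn κ (Icc a b) :=
  fun s hs => (h.hasDeriv_snd s hs).continuousWithinAt

theorem sq_pos (h : Flow c a b σ κ) {s : ℝ} (hs : s ∈ Icc a b) : 0 < σ s ^ 2 + κ s ^ 2 := by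
  have := h.pos s hs; positivity

theorem rad_pos (h : Flow c a b σ κ) {s : ℝ} (hs : s ∈ Icc a b) : 0 < rad σ κ s :=
  Real.sqrt_pos.2 (h.sq_pos hs)

theorem rad_sq (h : Flow c a b σ κ) {s : ℝ} (hs : s ∈ Icc a b) :
    rad σ κ s ^ 2 = σ s ^ 2 + κ s ^ 2 := Real.sq_sqrt (h.sq_pos hs).le

theorem sin_psi (h : Flow c a b σ κ) {s : ℝ} (hs : s ∈ Icc a b) :
    Real.sin (psi σ κ s) = κ s / rad σ κ s := by
  have hk := h.pos s hs
  have hr := h.rad_pos hs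
  have e : 1 + (σ s / κ s) ^ 2 = (rad σ κ s / κ s) ^ 2 := by
    rw [div_pow, div_pow, h.rad_sq hs]; field_simp; ring
  rw [psi, Real.sin_pi_div_two_sub, Real.cos_arctan, e, Real.sqrt_sq (by positivity), one_div_div]

theorem K_rad (h : Flow c a b σ κ) {s : ℝ} (hs : s ∈ Icc a b) :
    K (rad σ κ s) = c * Real.sin (psi σ κ s) := by
  rw [h.sin_psi hs, K, h.rad_sq hs, h.energy s hs, mul_div_assoc]

theorem K_rad_le (h : Flow c a b σ κ) (hc : 0 < c) {s : ℝ} (hs : s ∈ Icc a b) :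
    K (rad σ κ s) ≤ c := by
  rw [h.K_rad hs]; nlinarith [Real.sin_le_one (psi σ κ s)]

theorem rad_eq_of_fst_eq_zero (h : Flow c a b σ κ) {s : ℝ} (hs : s ∈ Icc a b) (h0 : σ s = 0) :
    rad σ κ s = κ s := by
  rw [rad, h0]; simp [Real.sqrt_sq (h.pos s hs).le]

theorem K_snd_of_fst_eq_zero (h : Flow c a b σ κ) {s : ℝ} (hs : s ∈ Icc a b) (h0 : σ s = 0) :
    K (κ s) = c := by
  rw [← h.rad_eq_of_fst_eq_zero hs h0, h.K_rad hs, psi, h0]; simp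

theorem snd_ne_one (h : Flow c a b σ κ) (hc : 1 < c) {s : ℝ} (hs : s ∈ Icc a b) (h0 : σ s = 0) :
    κ s ≠ 1 := by
  intro h1
  have := h.K_snd_of_fst_eq_zero hs h0
  rw [h1, K_one] at this
  exact hc.ne this

theorem continuousOn_psi (h : Flow c a b σ κ) : ContinuousOn (psi σ κ) (Icc a b) :=
  continuousOn_const.sub (Real.continuous_arctan.comp_continuousOn
    (h.continuousOn_fst.div h.continuousOn_snd fun s hs => (h.pos s hs).ne'))

theorem continuousOn_rad (h : Flow c a b σ κ) : ContinuousOn (rad σ κ) (Icc a b) :=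
  ((h.continuousOn_fst.pow 2).add (h.continuousOn_snd.pow 2)).sqrt

theorem hasDerivAt_fst (h : Flow c a b σ κ) {s : ℝ} (hs : s ∈ Ioo a b) :
    HasDerivAt σ (1 - κ s ^ 2) s :=
  (h.hasDeriv_fst s (Ioo_subset_Icc_self hs)).hasDerivAt (Icc_mem_nhds hs.1 hs.2)

theorem hasDerivAt_snd (h : Flow c a b σ κ) {s : ℝ} (hs : s ∈ Ioo a b) :
    HasDerivAt κ (σ s * κ s) s :=
  (h.hasDeriv_snd s (Ioo_subset_Icc_self hs)).hasDerivAt (Icc_mem_nhds hs.1 hs.2)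

theorem hasDerivAt_rad (h : Flow c a b σ κ) {s : ℝ} (hs : s ∈ Ioo a b) :
    HasDerivAt (rad σ κ) (σ s / rad σ κ s) s := by
  have hp := h.sq_pos (Ioo_subset_Icc_self hs)
  have := (((h.hasDerivAt_fst hs).pow 2).add ((h.hasDerivAt_snd hs).pow 2)).sqrt hp.ne'
  refine this.congr_deriv ?_
  have hr := h.rad_pos (Ioo_subset_Icc_self hs)
  have hrr := h.rad_sq (Ioo_subset_Icc_self hs)
  change _ / (2 * rad σ κ s) = _
  field_simp
  simp
  ring

theorem hasDerivAt_psi (h : Flow c a b σ κ) {s : ℝ} (hs : s ∈ Ioo a b) :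
    HasDerivAt (psi σ κ) ((rad σ κ s ^ 2 - 1) * (κ s / (σ s ^ 2 + κ s ^ 2))) s := by
  have hk := h.pos s (Ioo_subset_Icc_self hs)
  have hp := h.sq_pos (Ioo_subset_Icc_self hs)
  have := (((h.hasDerivAt_fst hs).div (h.hasDerivAt_snd hs) hk.ne').arctan).const_sub
    (Real.pi / 2)
  refine this.congr_deriv ?_
  rw [h.rad_sq (Ioo_subset_Icc_self hs)]
  have : κ s ^ 2 + σ s ^ 2 ≠ 0 := by positivity
  have : 1 + (σ s / κ s) ^ 2 ≠ 0 := by positivity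
  simp only [Pi.div_apply]
  field_simp
  ring

theorem hasDerivAt_chi (h : Flow c a b σ κ) (hc : 1 < c) {s : ℝ} (hs : s ∈ Ioo a b)
    (h1 : rad σ κ s ≠ 1) :
    HasDerivAt (fun s => chi c (psi σ κ s)) (Real.sqrt 2 / shape (rad σ κ s ^ 2 - 1) *
      ((rad σ κ s ^ 2 - 1) * (κ s / (σ s ^ 2 + κ s ^ 2)))) s :=
  (Shrinker.hasDerivAt_chi hc (h.rad_pos (Ioo_subset_Icc_self hs)) h1
    (h.K_rad (Ioo_subset_Icc_self hs))).comp s (h.hasDerivAt_psi hs)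

theorem continuousOn_chi_psi (h : Flow c a b σ κ) :
    ContinuousOn (fun s => chi c (psi σ κ s)) (Icc a b) :=
  (continuous_chi c).comp_continuousOn h.continuousOn_psi

theorem continuousOn_integrand (h : Flow c a b σ κ) :
    ContinuousOn (fun s => κ s / (σ s ^ 2 + κ s ^ 2)) (Icc a b) :=
  h.continuousOn_snd.div ((h.continuousOn_fst.pow 2).add (h.continuousOn_snd.pow 2))
    fun _ hs => (h.sq_pos hs).ne'

theorem integrand_pos (h : Flow c a b σ κ) {s : ℝ} (hs : s ∈ Icc a b) :
    0 < κ s / (σ s ^ 2 + κ s ^ 2) := div_pos (h.pos s hs) (h.sq_pos hs)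

theorem intervalIntegrable (h : Flow c a b σ κ) {x y : ℝ} (hx : x ∈ Icc a b) (hy : y ∈ Icc a b) :
    IntervalIntegrable (fun s => κ s / (σ s ^ 2 + κ s ^ 2)) MeasureTheory.volume x y :=
  (h.continuousOn_integrand.mono (uIcc_subset_Icc hx hy)).intervalIntegrable

theorem ang_add (h : Flow c a b σ κ) {x y z : ℝ} (hx : x ∈ Icc a b) (hy : y ∈ Icc a b)
    (hz : z ∈ Icc a b) : ang σ κ x y + ang σ κ y z = ang σ κ x z :=
  intervalIntegral.integral_add_adjacent_intervals (h.intervalIntegrable hx hy)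
    (h.intervalIntegrable hy hz)

theorem ang_nonneg (h : Flow c a b σ κ) {x y : ℝ} (hx : a ≤ x) (hxy : x ≤ y) (hy : y ≤ b) :
    0 ≤ ang σ κ x y :=
  intervalIntegral.integral_nonneg hxy fun _ hs =>
    (h.integrand_pos ⟨hx.trans hs.1, hs.2.trans hy⟩).le

theorem ang_pos (h : Flow c a b σ κ) {x y : ℝ} (hx : a ≤ x) (hxy : x < y) (hy : y ≤ b) :
    0 < ang σ κ x y :=
  intervalIntegral.intervalIntegral_pos_of_pos_on
    (h.intervalIntegrable ⟨hx, by linarith⟩ ⟨by linarith, hy⟩)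
    (fun _ hs => h.integrand_pos ⟨hx.trans hs.1.le, hs.2.le.trans hy⟩) hxy

theorem rad_reflect (x s : ℝ) :
    rad (fun s => -σ (x - s)) (fun s => κ (x - s)) s = rad σ κ (x - s) := by
  simp only [rad, neg_sq]

theorem psi_reflect (x s : ℝ) :
    psi (fun s => -σ (x - s)) (fun s => κ (x - s)) s = Real.pi - psi σ κ (x - s) := by
  simp only [psi, neg_div, Real.arctan_neg]; ring

theorem ang_reflect (x y z : ℝ) :
    ang (fun s => -σ (x - s)) (fun s => κ (x - s)) y z = ang σ κ (x - z) (x - y) := by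
  simp only [ang, neg_sq]
  exact intervalIntegral.integral_comp_sub_left (fun s => κ s / (σ s ^ 2 + κ s ^ 2)) x

/-- Upper bounds of the polar angle by linear combinations of the angles `χ` and `ψ`. -/
theorem ang_le (h : Flow c a b σ κ) (hc : 1 < c) (hab : a ≤ b) (A B : ℝ)
    (hne : ∀ s ∈ Ioo a b, rad σ κ s ≠ 1)
    (hb : ∀ s ∈ Ioo a b,
      1 ≤ (A * Real.sqrt 2 / shape (rad σ κ s ^ 2 - 1) + B) * (rad σ κ s ^ 2 - 1)) :
    ang σ κ a b ≤ A * (chi c (psi σ κ b) - chi c (psi σ κ a)) +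
      B * (psi σ κ b - psi σ κ a) := by
  have := intervalIntegral.integral_le_sub_of_hasDeriv_right_of_le hab
    ((h.continuousOn_chi_psi.const_mul A).add (h.continuousOn_psi.const_mul B))
    (fun s hs => (((h.hasDerivAt_chi hc hs (hne s hs)).const_mul A).add
      ((h.hasDerivAt_psi hs).const_mul B)).hasDerivWithinAt)
    h.continuousOn_integrand.integrableOn_Icc (fun s hs => ?_)
  · rw [ang]; refine this.trans (le_of_eq ?_); simp only [Pi.add_apply]; ring
  · have h1 := hb s hs
    have h2 := h.integrand_pos (Ioo_subset_Icc_self hs)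
    have h3 := mul_le_mul_of_nonneg_right h1 h2.le
    rw [one_mul] at h3
    refine h3.trans (le_of_eq ?_)
    ring

/-- Lower bounds of the polar angle by linear combinations of the angles `χ` and `ψ`. -/
theorem le_ang (h : Flow c a b σ κ) (hc : 1 < c) (hab : a ≤ b) (A B : ℝ)
    (hne : ∀ s ∈ Ioo a b, rad σ κ s ≠ 1)
    (hb : ∀ s ∈ Ioo a b,
      (A * Real.sqrt 2 / shape (rad σ κ s ^ 2 - 1) + B) * (rad σ κ s ^ 2 - 1) ≤ 1) :
    A * (chi c (psi σ κ b) - chi c (psi σ κ a)) + B * (psi σ κ b - psi σ κ a) ≤ ang σ κ a b := by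
  have := intervalIntegral.sub_le_integral_of_hasDeriv_right_of_le hab
    ((h.continuousOn_chi_psi.const_mul A).add (h.continuousOn_psi.const_mul B))
    (fun s hs => (((h.hasDerivAt_chi hc hs (hne s hs)).const_mul A).add
      ((h.hasDerivAt_psi hs).const_mul B)).hasDerivWithinAt)
    h.continuousOn_integrand.integrableOn_Icc (fun s hs => ?_)
  · rw [ang]; refine le_trans (le_of_eq ?_) this; simp only [Pi.add_apply]; ring
  · have h1 := hb s hs
    have h2 := h.integrand_pos (Ioo_subset_Icc_self hs)
    have h3 := mul_le_mul_of_nonneg_right h1 h2.le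
    rw [one_mul] at h3
    refine le_trans (le_of_eq ?_) h3
    ring

theorem rad_sq_sub_one_mem_Ioo (h : Flow c a b σ κ) (hin : ∀ s ∈ Ioo a b, rad σ κ s < 1) {s : ℝ}
    (hs : s ∈ Ioo a b) : rad σ κ s ^ 2 - 1 ∈ Ioo (-1) (0 : ℝ) := by
  have h1 := hin s hs
  have h0 := h.rad_pos (Ioo_subset_Icc_self hs)
  constructor <;> nlinarith

section Inside

variable (h : Flow c a b σ κ) (hc : 1 < c) (hab : a ≤ b) (hin : ∀ s ∈ Ioo a b, rad σ κ s < 1)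
include h hc hab hin

/-- The upper bound inside of the unit circle, from the tangent of the shape function at its value
`√2` at `R = 0`. -/
theorem ang_le_of_inside :
    ang σ κ a b ≤ 2 / Real.exp 1 * (chi c (psi σ κ a) - chi c (psi σ κ b)) +
      (1 - 2 / Real.exp 1) * (psi σ κ a - psi σ κ b) := by
  refine (h.ang_le hc hab (-(2 / Real.exp 1)) (-(1 - 2 / Real.exp 1))
    (fun s hs => (hin s hs).ne) fun s hs => ?_).trans (le_of_eq (by ring))
  have hy := h.rad_sq_sub_one_mem_Ioo hin hs
  have hn := shape_pos hy.2.ne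
  have hs := shape_le_of_neg hy
  set n := shape (rad σ κ s ^ 2 - 1)
  set y := rad σ κ s ^ 2 - 1
  have e : (-(2 / Real.exp 1) * Real.sqrt 2 / n + -(1 - 2 / Real.exp 1)) * y =
      (-y * (2 * Real.sqrt 2 / Real.exp 1 + (1 - 2 / Real.exp 1) * n)) / n := by
    have := Real.exp_pos 1
    field_simp
    ring
  rw [e, le_div_iff₀ hn, one_mul]
  exact hs

/-- The lower bound inside of the unit circle, from the chord of the shape function. -/
theorem le_ang_of_inside :
    1 / Real.sqrt 2 * (chi c (psi σ κ a) - chi c (psi σ κ b)) +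
      (1 - 1 / Real.sqrt 2) * (psi σ κ a - psi σ κ b) ≤ ang σ κ a b := by
  refine le_trans (le_of_eq (by ring)) (h.le_ang hc hab (-(1 / Real.sqrt 2))
    (-(1 - 1 / Real.sqrt 2)) (fun s hs => (hin s hs).ne) fun s hs => ?_)
  have hy := h.rad_sq_sub_one_mem_Ioo hin hs
  have hn := shape_pos hy.2.ne
  have hs := shape_ge_of_neg hy
  set n := shape (rad σ κ s ^ 2 - 1)
  set y := rad σ κ s ^ 2 - 1
  have e : (-(1 / Real.sqrt 2) * Real.sqrt 2 / n + -(1 - 1 / Real.sqrt 2)) * y =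
      (-y * (1 + (1 - 1 / Real.sqrt 2) * n)) / n := by
    have : 0 < Real.sqrt 2 := by positivity
    field_simp
    ring
  rw [e, div_le_one hn]
  exact hs

/-- The lower bound `|dψ| ≤ dθ` inside of the unit circle, as `dψ / dθ = R² - 1 > -1`. -/
theorem psi_sub_le_ang_of_inside : psi σ κ a - psi σ κ b ≤ ang σ κ a b := by
  refine le_trans (le_of_eq (by ring)) (h.le_ang hc hab 0 (-1)
    (fun s hs => (hin s hs).ne) fun s hs => ?_)
  have hy := h.rad_sq_sub_one_mem_Ioo hin hs
  rw [zero_mul, zero_div]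
  linarith [hy.1]

end Inside

theorem rad_sq_sub_one_pos (hout : ∀ s ∈ Ioo a b, 1 < rad σ κ s) {s : ℝ} (hs : s ∈ Ioo a b) :
    0 < rad σ κ s ^ 2 - 1 := by
  have h1 := hout s hs
  nlinarith

section Outside

variable (h : Flow c a b σ κ) (hc : 1 < c) (hab : a ≤ b) (hout : ∀ s ∈ Ioo a b, 1 < rad σ κ s)
include h hc hab hout

/-- The upper bound outside of the unit circle from the near-tangent `shape_le_of_pos`. -/
theorem ang_le_of_outside :
    ang σ κ a b ≤ 1.152 / Real.sqrt 2 * (chi c (psi σ κ b) - chi c (psi σ κ a)) -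
      0.552 * (psi σ κ b - psi σ κ a) := by
  refine (h.ang_le hc hab (1.152 / Real.sqrt 2) (-0.552)
    (fun s hs => (hout s hs).ne') fun s hs => ?_).trans (le_of_eq (by ring))
  have hy := rad_sq_sub_one_pos hout hs
  have hn := shape_pos hy.ne'
  have hs := shape_le_of_pos hy
  set n := shape (rad σ κ s ^ 2 - 1)
  set y := rad σ κ s ^ 2 - 1
  have e : (1.152 / Real.sqrt 2 * Real.sqrt 2 / n + -0.552) * y =
      y * (1.152 - 0.552 * n) / n := by
    have : 0 < Real.sqrt 2 := by positivity
    field_simp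
    ring
  rw [e, le_div_iff₀ hn, one_mul]
  exact hs

/-- The simpler upper bound outside of the unit circle, from `n ≤ y`. -/
theorem ang_le_of_outside' :
    ang σ κ a b ≤ 1 / Real.sqrt 2 * (chi c (psi σ κ b) - chi c (psi σ κ a)) := by
  refine (h.ang_le hc hab (1 / Real.sqrt 2) 0
    (fun s hs => (hout s hs).ne') fun s hs => ?_).trans (le_of_eq (by ring))
  have hy := rad_sq_sub_one_pos hout hs
  have hn := shape_pos hy.ne'
  have hs := shape_le_self hy
  set n := shape (rad σ κ s ^ 2 - 1)
  set y := rad σ κ s ^ 2 - 1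
  have e : (1 / Real.sqrt 2 * Real.sqrt 2 / n + 0) * y = y / n := by
    have : 0 < Real.sqrt 2 := by positivity
    field_simp
    ring
  rw [e, le_div_iff₀ hn, one_mul]
  exact hs

end Outside

theorem psi_le_of_outside (h : Flow c a b σ κ) (hab : a ≤ b)
    (hout : ∀ s ∈ Ioo a b, 1 < rad σ κ s) : psi σ κ a ≤ psi σ κ b := by
  refine monotoneOn_of_deriv_nonneg (convex_Icc a b) h.continuousOn_psi ?_ ?_
    (left_mem_Icc.2 hab) (right_mem_Icc.2 hab) hab
  · rw [interior_Icc]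
    exact fun s hs => (h.hasDerivAt_psi hs).differentiableAt.differentiableWithinAt
  · rw [interior_Icc]
    intro s hs
    rw [(h.hasDerivAt_psi hs).deriv]
    exact (mul_pos (rad_sq_sub_one_pos hout hs)
      (h.integrand_pos (Ioo_subset_Icc_self hs))).le

/-! ### Pieces of trajectories on which the radius is monotone -/

theorem strictMonoOn_rad (h : Flow c a b σ κ) (hs : ∀ s ∈ Ioo a b, 0 < σ s) :
    StrictMonoOn (rad σ κ) (Icc a b) := by
  refine strictMonoOn_of_deriv_pos (convex_Icc a b) h.continuousOn_rad fun s m => ?_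
  rw [interior_Icc] at m
  rw [(h.hasDerivAt_rad m).deriv]
  exact div_pos (hs s m) (h.rad_pos (Ioo_subset_Icc_self m))

theorem sqrt_energy_sub (h : Flow c a b σ κ) {s : ℝ} (hs : s ∈ Icc a b) (hσ : 0 ≤ σ s)
    (hc : 0 < c) : Real.sqrt (c ^ 2 - K (rad σ κ s) ^ 2) = c * σ s / rad σ κ s := by
  have hr := h.rad_pos hs
  have e : c ^ 2 - K (rad σ κ s) ^ 2 = (c * σ s / rad σ κ s) ^ 2 := by
    rw [h.K_rad hs, h.sin_psi hs, div_pow, mul_pow, mul_pow, div_pow, h.rad_sq hs]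
    have := h.sq_pos hs
    field_simp
    ring
  rw [e, Real.sqrt_sq (by positivity)]

/-- On the branch `ψ < π / 2` the polar angle is the integral `deltaTheta`. -/
theorem ang_eq_deltaTheta (h : Flow c a b σ κ) (hc : 0 < c) (hab : a ≤ b)
    (hs : ∀ s ∈ Icc a b, 0 < σ s) :
    ang σ κ a b = deltaTheta c (rad σ κ a) (rad σ κ b) := by
  have key : ∀ s ∈ Icc a b, dTheta c (rad σ κ s) * (σ s / rad σ κ s) =
      κ s / (σ s ^ 2 + κ s ^ 2) := by
    intro s m
    have hr := h.rad_pos m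
    have hsg := hs s m
    rw [dTheta, h.sqrt_energy_sub m (hs s m).le hc, h.K_rad m, h.sin_psi m, ← h.rad_sq m]
    field_simp
  have hK : ∀ s ∈ Icc a b, K (rad σ κ s) < c := by
    intro s m
    have hr := h.rad_pos m
    have h1 := h.sqrt_energy_sub m (hs s m).le hc
    have h2 : 0 < c * σ s / rad σ κ s := by have := hs s m; positivity
    rw [← h1, Real.sqrt_pos] at h2
    nlinarith [K_pos hr]
  have := intervalIntegral.integral_comp_mul_deriv'' (a := a) (b := b) (f := rad σ κ)
    (f' := fun s => σ s / rad σ κ s) (g := dTheta c)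
    (by rw [uIcc_of_le hab]; exact h.continuousOn_rad)
    (by rw [min_eq_left hab, max_eq_right hab]
        exact fun s m => (h.hasDerivAt_rad m).hasDerivWithinAt)
    (by rw [uIcc_of_le hab]
        exact h.continuousOn_fst.div h.continuousOn_rad fun s m => (h.rad_pos m).ne')
    (by rw [uIcc_of_le hab]
        refine (continuousOn_dTheta c).mono ?_
        rintro _ ⟨s, m, rfl⟩
        exact ⟨h.rad_pos m, hK s m⟩)
  rw [deltaTheta, ang]
  refine Eq.trans ?_ this
  refine intervalIntegral.integral_congr fun s m => ?_
  rw [uIcc_of_le hab] at m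
  exact (key s m).symm

theorem rad_lt_one_of_bottom (h : Flow c a b σ κ) {s : ℝ} (hs : s ∈ Icc a b) (h0 : σ s = 0)
    (h1 : κ s < 1) : rad σ κ s < 1 := by rwa [h.rad_eq_of_fst_eq_zero hs h0]

end Flow

theorem h1_eq_two_mul {c : ℝ} (hc : cStar < c) :
    h1 c = 2 * ∫ ψ in (Real.pi / 3)..(Real.pi / 2), 1 / (1 - Rminus (c * Real.sin ψ) ^ 2) := by
  have hpi := Real.pi_pos
  have hco := continuousOn_h1_integrand hc
  set f := fun ψ => 1 / (1 - Rminus (c * Real.sin ψ) ^ 2) with hf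
  have i1 : IntervalIntegrable f MeasureTheory.volume (Real.pi / 3) (Real.pi / 2) := by
    refine (hco.mono ?_).intervalIntegrable
    rw [uIcc_of_le (by linarith)]; exact Icc_subset_Icc_right (by linarith)
  have i2 : IntervalIntegrable f MeasureTheory.volume (Real.pi / 2) (2 * Real.pi / 3) := by
    refine (hco.mono ?_).intervalIntegrable
    rw [uIcc_of_le (by linarith)]; exact Icc_subset_Icc_left (by linarith)
  have e : ∫ ψ in (Real.pi / 2)..(2 * Real.pi / 3), f ψ =
      ∫ ψ in (Real.pi / 3)..(Real.pi / 2), f ψ := by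
    have := intervalIntegral.integral_comp_sub_left (a := Real.pi / 3) (b := Real.pi / 2) f Real.pi
    rw [show Real.pi - Real.pi / 2 = Real.pi / 2 by ring,
      show Real.pi - Real.pi / 3 = 2 * Real.pi / 3 by ring] at this
    rw [← this]
    simp only [hf, Real.sin_pi_sub]
  rw [h1, ← intervalIntegral.integral_add_adjacent_intervals i1 i2, e]
  ring

/-- The integral `h1` is twice the change of the polar angle from a point of least radius to
`D`. -/
theorem Flow.ang_eq_half_h1 {c a b : ℝ} {σ κ : ℝ → ℝ} (h : Flow c a b σ κ) (hc : cStar < c)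
    (hab : a ≤ b) (h0 : σ a = 0) (hin : ∀ s ∈ Icc a b, rad σ κ s < 1)
    (hD : psi σ κ b = Real.pi / 3) : ang σ κ a b = h1 c / 2 := by
  have hpsi : psi σ κ a = Real.pi / 2 := by simp [psi, h0]
  have hR : ∀ s ∈ Icc a b, Rminus (c * Real.sin (psi σ κ s)) = rad σ κ s := fun s m => by
    rw [← h.K_rad m, Rminus_K ⟨h.rad_pos m, (hin s m).le⟩]
  have hne : ∀ s ∈ Icc a b, 1 - rad σ κ s ^ 2 ≠ 0 := fun s m => by
    nlinarith [hin s m, h.rad_pos m]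
  -- `ψ` decreases along the piece, hence stays in `[π / 3, π / 2]`
  have hanti : AntitoneOn (psi σ κ) (Icc a b) := by
    refine antitoneOn_of_deriv_nonpos (convex_Icc a b) h.continuousOn_psi ?_ ?_
    · rw [interior_Icc]
      exact fun s hs => (h.hasDerivAt_psi hs).differentiableAt.differentiableWithinAt
    · rw [interior_Icc]
      intro s hs
      rw [(h.hasDerivAt_psi hs).deriv]
      have m := Ioo_subset_Icc_self hs
      exact mul_nonpos_of_nonpos_of_nonneg (by nlinarith [hin s m, h.rad_pos m])
        (h.integrand_pos m).le
  have hpi := Real.pi_pos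
  have := intervalIntegral.integral_comp_mul_deriv'' (a := a) (b := b) (f := psi σ κ)
    (f' := fun s => (rad σ κ s ^ 2 - 1) * (κ s / (σ s ^ 2 + κ s ^ 2)))
    (g := fun ψ => 1 / (1 - Rminus (c * Real.sin ψ) ^ 2))
    (by rw [uIcc_of_le hab]; exact h.continuousOn_psi)
    (by rw [min_eq_left hab, max_eq_right hab]
        exact fun s m => (h.hasDerivAt_psi m).hasDerivWithinAt)
    (by rw [uIcc_of_le hab]
        exact ((h.continuousOn_rad.pow 2).sub continuousOn_const).mul h.continuousOn_integrand)
    (by rw [uIcc_of_le hab]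
        refine (continuousOn_h1_integrand hc).mono ?_
        rintro _ ⟨s, m, rfl⟩
        have l1 := hanti (left_mem_Icc.2 hab) m m.1
        have l2 := hanti m (right_mem_Icc.2 hab) m.2
        rw [hpsi] at l1
        rw [hD] at l2
        exact ⟨l2, by linarith⟩)
  rw [hpsi, hD] at this
  rw [h1_eq_two_mul hc, intervalIntegral.integral_symm (Real.pi / 2), ← this, ang,
    mul_div_cancel_left₀ _ two_ne_zero, ← intervalIntegral.integral_neg]
  refine intervalIntegral.integral_congr fun s m => ?_
  rw [uIcc_of_le hab] at m
  simp only [Function.comp, hR s m]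
  have := hne s m
  field_simp
  ring

open Filter Topology

/-! ### Tips and bottoms of a trajectory -/

theorem exists_first_zero {f : ℝ → ℝ} {a b : ℝ} (hab : a < b) (hf : ContinuousOn f (Icc a b))
    (ha : ∀ᶠ s in 𝓝[>] a, 0 < f s) (hb : f b ≤ 0) :
    ∃ t ∈ Ioc a b, f t = 0 ∧ ∀ s ∈ Ioo a t, 0 < f s := by
  obtain ⟨u, hu, hau⟩ := (mem_nhdsGT_iff_exists_Ioo_subset).1 ha
  have hub : u ≤ b := by
    by_contra! h
    exact absurd (hau ⟨hab, h⟩ : 0 < f b) (not_lt.2 hb)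
  have hua : a < u := hu
  have hcl : IsCompact (Icc u b ∩ f ⁻¹' Iic 0) := by
    refine isCompact_Icc.of_isClosed_subset ?_ inter_subset_left
    exact (hf.mono (Icc_subset_Icc_left hua.le)).preimage_isClosed_of_isClosed isClosed_Icc
      isClosed_Iic
  obtain ⟨t, ⟨⟨ht1, ht2⟩, ht3⟩, hmin⟩ := hcl.exists_isLeast ⟨b, ⟨hub, le_rfl⟩, hb⟩
  have hat : a < t := hua.trans_le ht1
  have hpos : ∀ s ∈ Ioo a t, 0 < f s := by
    intro s hs
    rcases lt_or_ge s u with h | h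
    · exact hau ⟨hs.1, h⟩
    · by_contra! h0
      exact absurd (hmin ⟨⟨h, hs.2.le.trans ht2⟩, h0⟩) (not_le.2 hs.2)
  refine ⟨t, ⟨hat, ht2⟩, le_antisymm ht3 ?_, hpos⟩
  have := right_nhdsWithin_Ioo_neBot hat
  refine ge_of_tendsto (((hf t ⟨hat.le, ht2⟩).mono
    (Ioo_subset_Icc_self.trans (Icc_subset_Icc_right ht2))) : Tendsto f (𝓝[Ioo a t] t) _) ?_
  filter_upwards [self_mem_nhdsWithin] with s hs using (hpos s hs).le

theorem eventually_pos_of_hasDerivWithinAt {f : ℝ → ℝ} {a b d : ℝ} (hab : a < b)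
    (hf : HasDerivWithinAt f d (Icc a b) a) (hd : 0 < d) (h0 : f a = 0) :
    ∀ᶠ s in 𝓝[>] a, 0 < f s := by
  have h := hf.mono (Ioc_subset_Icc_self)
  rw [hasDerivWithinAt_iff_tendsto_slope' (by simp)] at h
  rw [nhdsWithin_Ioc_eq_nhdsGT hab] at h
  filter_upwards [h.eventually (lt_mem_nhds hd), self_mem_nhdsWithin] with s hs has
  rw [slope_def_field, h0, sub_zero] at hs
  have has : a < s := has
  exact (div_pos_iff_of_pos_right (by linarith)).1 hs

namespace Flow

variable {c a b : ℝ} {σ κ : ℝ → ℝ}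

theorem eventually_pos (h : Flow c a b σ κ) (hab : a < b)
    (ha : 0 < σ a ∨ σ a = 0 ∧ κ a < 1) : ∀ᶠ s in 𝓝[>] a, 0 < σ s := by
  have hm : a ∈ Icc a b := left_mem_Icc.2 hab.le
  rcases ha with ha | ⟨ha, hk⟩
  · have := (h.continuousOn_fst a hm).mono Ioc_subset_Icc_self
    rw [ContinuousWithinAt, nhdsWithin_Ioc_eq_nhdsGT hab] at this
    exact this.eventually (lt_mem_nhds ha)
  · exact eventually_pos_of_hasDerivWithinAt hab (h.hasDeriv_fst a hm)
      (by nlinarith [h.pos a hm]) ha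

theorem eventually_neg (h : Flow c a b σ κ) (hab : a < b)
    (ha : σ a < 0 ∨ σ a = 0 ∧ 1 < κ a) : ∀ᶠ s in 𝓝[>] a, σ s < 0 := by
  have hm : a ∈ Icc a b := left_mem_Icc.2 hab.le
  rcases ha with ha | ⟨ha, hk⟩
  · have := (h.continuousOn_fst a hm).mono Ioc_subset_Icc_self
    rw [ContinuousWithinAt, nhdsWithin_Ioc_eq_nhdsGT hab] at this
    exact this.eventually (gt_mem_nhds ha)
  · have := eventually_pos_of_hasDerivWithinAt (f := fun s => -σ s) hab (h.hasDeriv_fst a hm).neg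
      (by nlinarith [h.pos a hm]) (by simp [ha])
    simpa using this

theorem one_lt_snd_of_left_pos (h : Flow c a b σ κ) (hc : 1 < c) (hab : a < b) (hb : σ b = 0)
    (hs : ∀ s ∈ Ioo a b, 0 < σ s) : 1 < κ b := by
  have hm : b ∈ Icc a b := right_mem_Icc.2 hab.le
  by_contra! hk
  have hk := lt_of_le_of_ne hk (h.snd_ne_one hc hm hb)
  have h' := h.reflect b
  have := h'.eventually_pos (by linarith) (Or.inr (by simp [hb, hk]))
  rw [sub_self] at this
  have h2 : ∀ᶠ s in 𝓝[>] (0 : ℝ), s < b - a :=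
    (eventually_lt_nhds (by linarith)).filter_mono nhdsWithin_le_nhds
  obtain ⟨s, ⟨h3, h4⟩, h5⟩ := ((this.and h2).and self_mem_nhdsWithin).exists
  have h5 : 0 < s := h5
  linarith [hs (b - s) ⟨by linarith, by linarith⟩]

theorem snd_lt_one_of_left_neg (h : Flow c a b σ κ) (hc : 1 < c) (hab : a < b) (hb : σ b = 0)
    (hs : ∀ s ∈ Ioo a b, σ s < 0) : κ b < 1 := by
  have hm : b ∈ Icc a b := right_mem_Icc.2 hab.le
  by_contra! hk
  have hk := lt_of_le_of_ne hk (h.snd_ne_one hc hm hb).symm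
  have h' := h.reflect b
  have := h'.eventually_neg (by linarith) (Or.inr (by simp [hb, hk]))
  rw [sub_self] at this
  have h2 : ∀ᶠ s in 𝓝[>] (0 : ℝ), s < b - a :=
    (eventually_lt_nhds (by linarith)).filter_mono nhdsWithin_le_nhds
  obtain ⟨s, ⟨h3, h4⟩, h5⟩ := ((this.and h2).and self_mem_nhdsWithin).exists
  have h5 : 0 < s := h5
  linarith [hs (b - s) ⟨by linarith, by linarith⟩]

/-- A tip is a point of greatest radius, with `σ = 0` and `κ > 1`.  A trajectory that starts
outwards and is not outwards at `x` passes a tip: at its first zero `σ` decreases, and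
`σ' = 1 - κ ^ 2`. -/
theorem exists_first_tip (h : Flow c a b σ κ) (hc : 1 < c)
    (ha : 0 < σ a ∨ σ a = 0 ∧ κ a < 1) {x : ℝ} (hx : x ∈ Ioc a b) (hx0 : σ x ≤ 0) :
    ∃ t ∈ Ioc a x, σ t = 0 ∧ 1 < κ t ∧ ∀ s ∈ Ioo a t, 0 < σ s := by
  have hf := h.mono le_rfl hx.2
  obtain ⟨t, ht, h0, hs⟩ := exists_first_zero hx.1 hf.continuousOn_fst
    (hf.eventually_pos hx.1 ha) hx0
  exact ⟨t, ht, h0, (hf.mono le_rfl ht.2).one_lt_snd_of_left_pos hc ht.1 h0 hs, hs⟩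

/-- A bottom is a point of least radius, with `σ = 0` and `κ < 1`.  A trajectory that starts inwards
and is not inwards at `x` passes a bottom. -/
theorem exists_first_bottom (h : Flow c a b σ κ) (hc : 1 < c)
    (ha : σ a < 0 ∨ σ a = 0 ∧ 1 < κ a) {x : ℝ} (hx : x ∈ Ioc a b) (hx0 : 0 ≤ σ x) :
    ∃ t ∈ Ioc a x, σ t = 0 ∧ κ t < 1 ∧ ∀ s ∈ Ioo a t, σ s < 0 := by
  have hf := h.mono le_rfl hx.2
  obtain ⟨t, ht, h0, hs⟩ := exists_first_zero (f := fun s => -σ s) hx.1 hf.continuousOn_fst.neg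
    (by simpa using hf.eventually_neg hx.1 ha) (by simpa using hx0)
  have h0 : σ t = 0 := by simpa using h0
  have hs : ∀ s ∈ Ioo a t, σ s < 0 := fun s m => by simpa using hs s m
  exact ⟨t, ht, h0, (hf.mono le_rfl ht.2).snd_lt_one_of_left_neg hc ht.1 h0 hs, hs⟩

theorem exists_last_tip (h : Flow c a b σ κ) (hc : 1 < c)
    (hb : σ b < 0 ∨ σ b = 0 ∧ κ b < 1) {x : ℝ} (hx : x ∈ Ico a b) (hx0 : 0 ≤ σ x) :
    ∃ t ∈ Ico x b, σ t = 0 ∧ 1 < κ t ∧ ∀ s ∈ Ioo t b, σ s < 0 := by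
  obtain ⟨t, ht, h0, hk, hs⟩ := (h.reflect b).exists_first_tip hc (by simpa using hb)
    (x := b - x) ⟨by linarith [hx.2], by linarith [hx.1]⟩ (by simpa using hx0)
  refine ⟨b - t, ⟨by linarith [ht.2], by linarith [ht.1]⟩, by simpa using h0, hk, fun s m => ?_⟩
  simpa using hs (b - s) ⟨by linarith [m.2], by linarith [m.1]⟩

theorem exists_last_bottom (h : Flow c a b σ κ) (hc : 1 < c)
    (hb : 0 < σ b ∨ σ b = 0 ∧ 1 < κ b) {x : ℝ} (hx : x ∈ Ico a b) (hx0 : σ x ≤ 0) :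
    ∃ t ∈ Ico x b, σ t = 0 ∧ κ t < 1 ∧ ∀ s ∈ Ioo t b, 0 < σ s := by
  obtain ⟨t, ht, h0, hk, hs⟩ := (h.reflect b).exists_first_bottom hc (by simpa using hb)
    (x := b - x) ⟨by linarith [hx.2], by linarith [hx.1]⟩ (by simpa using hx0)
  refine ⟨b - t, ⟨by linarith [ht.2], by linarith [ht.1]⟩, by simpa using h0, hk, fun s m => ?_⟩
  simpa using hs (b - s) ⟨by linarith [m.2], by linarith [m.1]⟩

theorem fst_nonneg (h : Flow c a b σ κ) (hab : a < b) (hs : ∀ s ∈ Ioo a b, 0 < σ s) {s : ℝ}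
    (hm : s ∈ Icc a b) : 0 ≤ σ s := by
  have h1 : s ∈ closure (Ioo a b) := by rwa [closure_Ioo hab.ne]
  have h2 : Tendsto σ (𝓝[Ioo a b] s) (𝓝 (σ s)) := (h.continuousOn_fst s hm).mono Ioo_subset_Icc_self
  have := mem_closure_iff_nhdsWithin_neBot.1 h1
  refine ge_of_tendsto h2 ?_
  filter_upwards [self_mem_nhdsWithin] with s hs' using (hs s hs').le

theorem psi_eq_psiOf (h : Flow c a b σ κ) (hc : 0 < c) {s : ℝ} (hs : s ∈ Icc a b)
    (h0 : 0 ≤ σ s) : psi σ κ s = psiOf c (rad σ κ s) := by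
  have hk := h.pos s hs
  have h1 : 0 ≤ Real.arctan (σ s / κ s) := Real.arctan_nonneg.2 (by positivity)
  have h2 := Real.arctan_lt_pi_div_two (σ s / κ s)
  rw [psiOf, h.K_rad hs, mul_div_cancel_left₀ _ hc.ne', Real.arcsin_sin] <;>
    rw [psi] <;> linarith [Real.pi_pos]

theorem psi_le_pi_div_two (h : Flow c a b σ κ) {s : ℝ} (hs : s ∈ Icc a b)
    (h0 : 0 ≤ σ s) : psi σ κ s ≤ Real.pi / 2 := by
  have hk := h.pos s hs
  have h1 : 0 ≤ Real.arctan (σ s / κ s) := Real.arctan_nonneg.2 (by positivity)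
  rw [psi]; linarith

theorem omega_le_psi (h : Flow c a b σ κ) (hc : 1 < c) {s : ℝ} (hs : s ∈ Icc a b)
    (h0 : 0 ≤ σ s) : omega c ≤ psi σ κ s := by
  rw [h.psi_eq_psiOf (by linarith) hs h0]
  apply Real.monotone_arcsin
  have := one_le_K (h.rad_pos hs)
  gcongr

theorem psi_pos (σ κ : ℝ → ℝ) (s : ℝ) : 0 < psi σ κ s := by
  rw [psi]; linarith [Real.arctan_lt_pi_div_two (σ s / κ s)]

theorem psi_of_fst_eq_zero {s : ℝ} (h0 : σ s = 0) : psi σ κ s = Real.pi / 2 := by simp [psi, h0]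

theorem RA_lt_rad_of_tip (h : Flow c a b σ κ) (hc : cStar < c) {s : ℝ} (hs : s ∈ Icc a b)
    (h0 : σ s = 0) (h1 : 1 < κ s) : RA c < rad σ κ s := by
  obtain ⟨a1, a2⟩ := RA_spec hc
  have hm := mul_c_lt_c (one_lt_of_cStar_lt hc)
  rw [h.rad_eq_of_fst_eq_zero hs h0]
  refine (strictMonoOn_K.lt_iff_lt (mem_Ici.2 a1.le) (mem_Ici.2 h1.le)).1 ?_
  rwa [a2, h.K_snd_of_fst_eq_zero hs h0]

theorem rad_lt_RD_of_bottom (h : Flow c a b σ κ) (hc : cStar < c) {s : ℝ} (hs : s ∈ Icc a b)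
    (h0 : σ s = 0) (h1 : κ s < 1) : rad σ κ s < RD c := by
  obtain ⟨d0, d1, d2⟩ := RD_spec hc
  have hm := mul_c_lt_c (one_lt_of_cStar_lt hc)
  rw [h.rad_eq_of_fst_eq_zero hs h0]
  refine (strictAntiOn_K.lt_iff_gt ⟨d0, d1.le⟩ ⟨h.pos s hs, h1.le⟩).1 ?_
  rwa [d2, h.K_snd_of_fst_eq_zero hs h0]

end Flow

theorem le_RA_of_K_le {c R : ℝ} (hc : cStar < c) (h : K R ≤ Real.sqrt 3 / 2 * c) : R ≤ RA c := by
  obtain ⟨a1, a2⟩ := RA_spec hc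
  rcases le_total R 1 with h1 | h1
  · linarith
  · exact (strictMonoOn_K.le_iff_le (mem_Ici.2 h1) (mem_Ici.2 a1.le)).1 (by rwa [a2])

theorem RD_le_of_K_le {c R : ℝ} (hc : cStar < c) (hR : 0 < R) (h : K R ≤ Real.sqrt 3 / 2 * c) :
    RD c ≤ R := by
  obtain ⟨d0, d1, d2⟩ := RD_spec hc
  rcases le_total R 1 with h1 | h1
  · exact (strictAntiOn_K.le_iff_ge ⟨hR, h1⟩ ⟨d0, d1.le⟩).1 (by rwa [d2])
  · linarith

theorem eq_RA_or_RD {c R : ℝ} (hc : cStar < c) (hR : 0 < R) (h : K R = Real.sqrt 3 / 2 * c) :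
    R = RA c ∨ R = RD c := by
  obtain ⟨a1, a2⟩ := RA_spec hc
  obtain ⟨d0, d1, d2⟩ := RD_spec hc
  rcases le_total R 1 with h1 | h1
  · exact Or.inr (strictAntiOn_K.injOn ⟨hR, h1⟩ ⟨d0, d1.le⟩ (by rw [d2, h]))
  · exact Or.inl (strictMonoOn_K.injOn (mem_Ici.2 h1) (mem_Ici.2 a1.le) (by rw [a2, h]))

namespace Flow

variable {c a b : ℝ} {σ κ : ℝ → ℝ}

theorem fst_ne_zero_of_rad_eq_RA (h : Flow c a b σ κ) (hc : cStar < c) {s : ℝ} (hs : s ∈ Icc a b)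
    (hR : rad σ κ s = RA c) : σ s ≠ 0 := by
  intro h0
  have h1 := h.K_snd_of_fst_eq_zero hs h0
  rw [← h.rad_eq_of_fst_eq_zero hs h0, hR, (RA_spec hc).2] at h1
  linarith [mul_c_lt_c (one_lt_of_cStar_lt hc)]

/-- A piece of increasing radius that starts at `R ≤ R_A` and reaches `R_A`. -/
theorem exists_ang_eq_deltaTheta (h : Flow c a b σ κ) (hc : cStar < c) (hab : a < b)
    (hs : ∀ s ∈ Ico a b, 0 < σ s) (h1 : rad σ κ a ≤ RA c) (h2 : RA c ≤ rad σ κ b) :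
    ∃ t ∈ Icc a b, rad σ κ t = RA c ∧ ang σ κ a t = deltaTheta c (rad σ κ a) (RA c) := by
  obtain ⟨t, ht, hR⟩ := intermediate_value_Icc hab.le h.continuousOn_rad ⟨h1, h2⟩
  refine ⟨t, ht, hR, ?_⟩
  have h0 : 0 < σ t := lt_of_le_of_ne
    (h.fst_nonneg hab (fun s m => hs s ⟨m.1.le, m.2⟩) ht) (h.fst_ne_zero_of_rad_eq_RA hc ht hR).symm
  rw [(h.mono le_rfl ht.2).ang_eq_deltaTheta (by linarith [one_lt_of_cStar_lt hc]) ht.1, hR]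
  intro s m
  rcases eq_or_lt_of_le m.2 with e | e
  · rwa [e]
  · exact hs s ⟨m.1, e.trans_le ht.2⟩

/-- From a point of least radius up to `A`. -/
theorem exists_ang_eq_ascent (h : Flow c a b σ κ) (hc : cStar < c) (hab : a < b) (h0 : σ a = 0)
    (hκ : κ a < 1) (hs : ∀ s ∈ Ioo a b, 0 < σ s) (hb : RA c ≤ rad σ κ b) :
    ∃ t ∈ Ioc a b, rad σ κ t = RA c ∧ ang σ κ a t = h1 c / 2 + h2 c := by
  have hc1 := one_lt_of_cStar_lt hc
  have ha : a ∈ Icc a b := left_mem_Icc.2 hab.le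
  have hlt := h.rad_lt_RD_of_bottom hc ha h0 hκ
  obtain ⟨a1, a2⟩ := RA_spec hc
  obtain ⟨d0, d1, d2⟩ := RD_spec hc
  obtain ⟨t, ht, hR⟩ := intermediate_value_Icc hab.le h.continuousOn_rad
    ⟨hlt.le, by linarith⟩
  have hmono := h.strictMonoOn_rad hs
  have hat : a < t := (hmono.lt_iff_lt ha ht).1 (by rwa [hR])
  have htb : t < b := (hmono.lt_iff_lt ht (right_mem_Icc.2 hab.le)).1 (by linarith)
  have hft := h.mono hat.le le_rfl
  obtain ⟨u, hu, hRu, hang⟩ := hft.exists_ang_eq_deltaTheta hc htb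
    (fun s m => hs s ⟨hat.trans_le m.1, m.2⟩) (by linarith) hb
  refine ⟨u, ⟨hat.trans_le hu.1, hu.2⟩, hRu, ?_⟩
  rw [← h.ang_add ha ht ⟨ht.1.trans hu.1, hu.2⟩, hang, hR, h2,
    (h.mono le_rfl ht.2).ang_eq_half_h1 hc hat.le h0]
  · intro s m
    have := hmono.monotoneOn ⟨m.1, m.2.trans ht.2⟩ ht m.2
    linarith
  · rw [h.psi_eq_psiOf (by linarith) ht (hs t ⟨hat, htb⟩).le, hR, psiOf_of_K_eq hc1 d2]

/-- A trajectory that starts at a point of least radius and reaches `R_A`. -/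
theorem exists_ang_eq_ascent' (h : Flow c a b σ κ) (hc : cStar < c) (h0 : σ a = 0)
    (hκ : κ a < 1) {x : ℝ} (hx : x ∈ Icc a b) (hb : RA c ≤ rad σ κ x) :
    ∃ t ∈ Ioc a b, rad σ κ t = RA c ∧ ang σ κ a t = h1 c / 2 + h2 c := by
  have hc1 := one_lt_of_cStar_lt hc
  obtain ⟨a1, a2⟩ := RA_spec hc
  have hax : a < x := by
    refine lt_of_le_of_ne hx.1 fun e => ?_
    have := h.rad_lt_one_of_bottom (left_mem_Icc.2 (hx.1.trans hx.2)) h0 hκ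
    rw [e] at this; linarith
  by_cases hn : ∃ s ∈ Ioc a x, σ s ≤ 0
  · obtain ⟨s, hs, hs0⟩ := hn
    obtain ⟨t, ht, ht0, hk, hpos⟩ := h.exists_first_tip hc1 (Or.inr ⟨h0, hκ⟩)
      ⟨hs.1, hs.2.trans hx.2⟩ hs0
    have htb : t ≤ b := ht.2.trans (hs.2.trans hx.2)
    obtain ⟨u, hu, h3⟩ := (h.mono le_rfl htb).exists_ang_eq_ascent hc ht.1 h0 hκ hpos
      (h.RA_lt_rad_of_tip hc ⟨ht.1.le, htb⟩ ht0 hk).le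
    exact ⟨u, ⟨hu.1, hu.2.trans htb⟩, h3⟩
  · push Not at hn
    obtain ⟨u, hu, h3⟩ := (h.mono le_rfl hx.2).exists_ang_eq_ascent hc hax h0 hκ
      (fun s m => hn s ⟨m.1, m.2.le⟩) hb
    exact ⟨u, ⟨hu.1, hu.2.trans hx.2⟩, h3⟩

/-- From a point of least radius over one or several tips down to a point with `R ≤ R_A`. -/
theorem le_ang_ascent_descent (h : Flow c a b σ κ) (hc : cStar < c) (hab : a < b) (h0 : σ a = 0)
    (hκ : κ a < 1) (hb : σ b < 0) (hK : K (rad σ κ b) ≤ Real.sqrt 3 / 2 * c) :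
    h1 c / 2 + h2 c + deltaTheta c (rad σ κ b) (RA c) ≤ ang σ κ a b := by
  have hc1 := one_lt_of_cStar_lt hc
  have ha : a ∈ Icc a b := left_mem_Icc.2 hab.le
  have hbm : b ∈ Icc a b := right_mem_Icc.2 hab.le
  obtain ⟨t, ht, ht0, htk, htpos⟩ := h.exists_first_tip hc1 (Or.inr ⟨h0, hκ⟩)
    ⟨hab, le_rfl⟩ hb.le
  have htb : t < b := lt_of_le_of_ne ht.2 fun e => by rw [e] at ht0; linarith
  obtain ⟨z, hz, hz0, hzk, hzneg⟩ := h.exists_last_tip hc1 (Or.inl hb)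
    ⟨ht.1.le, htb⟩ ht0.ge
  have hzm : z ∈ Icc a b := ⟨ht.1.le.trans hz.1, hz.2.le⟩
  obtain ⟨u, hu, hRu, hang⟩ := (h.mono le_rfl ht.2).exists_ang_eq_ascent hc ht.1 h0 hκ htpos
    (h.RA_lt_rad_of_tip hc ⟨ht.1.le, ht.2⟩ ht0 htk).le
  obtain ⟨v, hv, hRv, hang2⟩ := ((h.mono hzm.1 le_rfl).reflect b).exists_ang_eq_deltaTheta hc
    (by linarith [hz.2])
    (fun s m => by
      rw [sub_self] at m
      rcases eq_or_lt_of_le m.1 with e | e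
      · simp [← e, hb]
      · simpa using hzneg (b - s) ⟨by linarith [m.2], by linarith⟩)
    (by rw [rad_reflect, sub_self, sub_zero]; exact le_RA_of_K_le hc hK)
    (by rw [rad_reflect, sub_sub_cancel]; exact (h.RA_lt_rad_of_tip hc hzm hz0 hzk).le)
  rw [ang_reflect, rad_reflect, sub_self, sub_zero] at hang2
  rw [sub_self] at hv
  have hum : u ∈ Icc a b := ⟨hu.1.le, hu.2.trans ht.2⟩
  have hvm : b - v ∈ Icc a b := ⟨by linarith [hv.2, hzm.1], by linarith [hv.1]⟩
  rw [← h.ang_add ha hum hbm, ← h.ang_add hum hvm hbm, hang, hang2]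
  have := h.ang_nonneg hum.1 (by linarith [hu.2, hz.1, hv.2] : u ≤ b - v) hvm.2
  linarith

end Flow

/-! ### Bounds for the polar angle on monotone pieces -/

theorem chi_nonneg (c ψ : ℝ) : 0 ≤ chi c ψ := Real.arccos_nonneg _

/-- On the branch `R ≥ 1` one has `dχ / dψ = √2 / n ≥ 1`. -/
theorem monotoneOn_chi_sub {c : ℝ} (hc : 1 < c) :
    MonotoneOn (fun ψ => chi c ψ - ψ) (Icc (omega c) (Real.pi / 2)) := by
  obtain ⟨o0, o1⟩ := omega_mem hc
  have hd : ∀ ψ ∈ Ioo (omega c) (Real.pi / 2), HasDerivAt (fun ψ => chi c ψ - ψ)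
      (Real.sqrt 2 / shape (Rplus (c * Real.sin ψ) ^ 2 - 1) - 1) ψ ∧
      0 ≤ Real.sqrt 2 / shape (Rplus (c * Real.sin ψ) ^ 2 - 1) - 1 := by
    intro ψ hψ
    have h1 : 1 < c * Real.sin ψ := by
      have := Real.sin_lt_sin_of_lt_of_le_pi_div_two (by linarith) hψ.2.le hψ.1
      rw [sin_omega hc, div_lt_iff₀ (by linarith)] at this
      linarith
    have hR := one_lt_Rplus h1
    refine ⟨(hasDerivAt_chi hc (by linarith) hR.ne' (K_Rplus h1.le)).sub (hasDerivAt_id ψ), ?_⟩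
    have hy : Rplus (c * Real.sin ψ) ^ 2 - 1 ≠ 0 := by nlinarith
    rw [sub_nonneg, one_le_div (shape_pos hy)]
    exact (shape_lt (by nlinarith)).le
  refine monotoneOn_of_deriv_nonneg (convex_Icc _ _)
    ((continuous_chi c).sub continuous_id).continuousOn ?_ ?_
  · rw [interior_Icc]
    exact fun ψ hψ => (hd ψ hψ).1.differentiableAt.differentiableWithinAt
  · rw [interior_Icc]
    intro ψ hψ
    rw [(hd ψ hψ).1.deriv]
    exact (hd ψ hψ).2

namespace Flow

variable {c a b : ℝ} {σ κ : ℝ → ℝ}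

theorem psi_of_rad_eq_one (h : Flow c a b σ κ) (hc : 1 < c) {s : ℝ} (hs : s ∈ Icc a b)
    (h0 : 0 ≤ σ s) (h1 : rad σ κ s = 1) : psi σ κ s = omega c := by
  rw [h.psi_eq_psiOf (by linarith) hs h0, h1, psiOf_one]

/-- An increasing piece is divided by the circle `R = 1`. -/
theorem exists_rad_eq_one (h : Flow c a b σ κ) (hc : 1 < c) (hab : a < b)
    (hs : ∀ s ∈ Ioo a b, 0 < σ s) (ha : rad σ κ a ≤ 1) (hb : 1 ≤ rad σ κ b) :
    ∃ t ∈ Icc a b, psi σ κ t = omega c ∧ (∀ s ∈ Ioo a t, rad σ κ s < 1) ∧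
      ∀ s ∈ Ioo t b, 1 < rad σ κ s := by
  obtain ⟨t, ht, hR⟩ := intermediate_value_Icc hab.le h.continuousOn_rad ⟨ha, hb⟩
  have hmono := h.strictMonoOn_rad hs
  refine ⟨t, ht, h.psi_of_rad_eq_one hc ht (h.fst_nonneg hab hs ht) hR, fun s m => ?_,
    fun s m => ?_⟩
  · rw [← hR]; exact hmono ⟨m.1.le, m.2.le.trans ht.2⟩ ht m.2
  · rw [← hR]; exact hmono ht ⟨ht.1.trans m.1.le, m.2.le⟩ m.1

theorem rad_lt_of_lt (h : Flow c a b σ κ) (hs : ∀ s ∈ Ioo a b, 0 < σ s) {x y : ℝ}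
    (hx : a ≤ x) (hxy : x < y) (hy : y ≤ b) : rad σ κ x < rad σ κ y :=
  h.strictMonoOn_rad hs ⟨hx, hxy.le.trans hy⟩ ⟨hx.trans hxy.le, hy⟩ hxy

/-- From a point of least radius on, the polar angle changes by at least the decrease of `ψ`; after
the circle `R = 1` is reached, `ψ` increases again. -/
theorem sub_psi_le_ang (h : Flow c a b σ κ) (hc : 1 < c) (hab : a < b)
    (hs : ∀ s ∈ Ioo a b, 0 < σ s) (h0 : σ a = 0) (hκ : κ a < 1) :
    Real.pi / 2 - psi σ κ b ≤ ang σ κ a b := by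
  have ha := h.rad_lt_one_of_bottom (left_mem_Icc.2 hab.le) h0 hκ
  have hpa := psi_of_fst_eq_zero (κ := κ) h0
  rcases le_total (rad σ κ b) 1 with hb | hb
  · have := h.psi_sub_le_ang_of_inside hc hab.le fun s m =>
      (h.rad_lt_of_lt hs m.1.le m.2 le_rfl).trans_le hb
    rwa [hpa] at this
  · obtain ⟨t, ht, hpt, hin, hout⟩ := h.exists_rad_eq_one hc hab hs ha.le hb
    have h1 := (h.mono le_rfl ht.2).psi_sub_le_ang_of_inside hc ht.1 hin
    have h2 := (h.mono ht.1 le_rfl).psi_le_of_outside ht.2 hout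
    have h3 := h.ang_nonneg ht.1 ht.2 le_rfl
    rw [← h.ang_add (left_mem_Icc.2 hab.le) ht (right_mem_Icc.2 hab.le)]
    linarith

/-- The sharper lower bound on a piece that starts at a point of least radius. -/
theorem sub_chi_le_ang (h : Flow c a b σ κ) (hc : 1 < c) (hab : a < b)
    (hs : ∀ s ∈ Ioo a b, 0 < σ s) (h0 : σ a = 0) (hκ : κ a < 1) :
    1 / Real.sqrt 2 * (Real.pi / 2 - chi c (psi σ κ b)) +
      (1 - 1 / Real.sqrt 2) * (Real.pi / 2 - psi σ κ b) ≤ ang σ κ a b := by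
  have ha := h.rad_lt_one_of_bottom (left_mem_Icc.2 hab.le) h0 hκ
  have hpa := psi_of_fst_eq_zero (κ := κ) h0
  rcases le_total (rad σ κ b) 1 with hb | hb
  · have := h.le_ang_of_inside hc hab.le fun s m =>
      (h.rad_lt_of_lt hs m.1.le m.2 le_rfl).trans_le hb
    rwa [hpa, chi_pi_div_two] at this
  · obtain ⟨t, ht, hpt, hin, hout⟩ := h.exists_rad_eq_one hc hab hs ha.le hb
    have h1 := (h.mono le_rfl ht.2).le_ang_of_inside hc ht.1 hin
    have h2 := (h.mono ht.1 le_rfl).psi_le_of_outside ht.2 hout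
    have h3 := h.ang_nonneg ht.1 ht.2 le_rfl
    rw [hpa, chi_pi_div_two, hpt, chi_omega hc] at h1
    rw [hpt] at h2
    have h4 := chi_nonneg c (psi σ κ b)
    have h5 : (0 : ℝ) < 1 / Real.sqrt 2 := by positivity
    have h6 : 1 / Real.sqrt 2 < 1 := by
      rw [div_lt_one (by positivity)]; linarith [sqrt_two_bounds.1]
    rw [← h.ang_add (left_mem_Icc.2 hab.le) ht (right_mem_Icc.2 hab.le)]
    nlinarith

/-- Upper bound on a piece from a point of least radius to a point with `R ≤ 1`. -/
theorem ang_le_of_end_le_one (h : Flow c a b σ κ) (hc : 1 < c) (hab : a < b)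
    (hs : ∀ s ∈ Ioo a b, 0 < σ s) (h0 : σ a = 0) (hb : rad σ κ b ≤ 1) :
    ang σ κ a b ≤ 2 / Real.exp 1 * (Real.pi / 2 - chi c (psi σ κ b)) +
      (1 - 2 / Real.exp 1) * (Real.pi / 2 - psi σ κ b) := by
  have := h.ang_le_of_inside hc hab.le fun s m =>
    (h.rad_lt_of_lt hs m.1.le m.2 le_rfl).trans_le hb
  rwa [psi_of_fst_eq_zero h0, chi_pi_div_two] at this

/-- Upper bound on a piece from a point of least radius to a point with `R ≥ 1`. -/
theorem ang_le_of_one_le_end (h : Flow c a b σ κ) (hc : 1 < c) (hab : a < b)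
    (hs : ∀ s ∈ Ioo a b, 0 < σ s) (h0 : σ a = 0) (hκ : κ a < 1) (hb : 1 ≤ rad σ κ b) :
    ang σ κ a b ≤ 2 / Real.exp 1 * (Real.pi / 2) +
      (1 - 2 / Real.exp 1) * (Real.pi / 2 - omega c) +
      1 / Real.sqrt 2 * chi c (psi σ κ b) := by
  have ha := h.rad_lt_one_of_bottom (left_mem_Icc.2 hab.le) h0 hκ
  obtain ⟨t, ht, hpt, hin, hout⟩ := h.exists_rad_eq_one hc hab hs ha.le hb
  have h1 := (h.mono le_rfl ht.2).ang_le_of_inside hc ht.1 hin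
  have h2 := (h.mono ht.1 le_rfl).ang_le_of_outside' hc ht.2 hout
  rw [psi_of_fst_eq_zero h0, chi_pi_div_two, hpt, chi_omega hc] at h1
  rw [hpt, chi_omega hc] at h2
  rw [← h.ang_add (left_mem_Icc.2 hab.le) ht (right_mem_Icc.2 hab.le)]
  linarith

end Flow

theorem two_div_exp_bounds : 0.7357 < 2 / Real.exp 1 ∧ 2 / Real.exp 1 < 0.7358 := by
  have h1 := Real.exp_one_gt_d9
  have h2 := Real.exp_one_lt_d9
  constructor
  · rw [lt_div_iff₀ (by linarith)]; linarith
  · rw [div_lt_iff₀ (by linarith)]; linarith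

theorem one_div_sqrt_two_bounds : 0.7071 < 1 / Real.sqrt 2 ∧ 1 / Real.sqrt 2 < 0.70711 := by
  have h : 1 / Real.sqrt 2 = Real.sqrt 2 / 2 := by
    rw [div_eq_div_iff (by positivity) (by norm_num), one_mul, Real.mul_self_sqrt (by norm_num)]
  have h1 : 1.4142 < Real.sqrt 2 := by apply Real.lt_sqrt_of_sq_lt; norm_num
  have h2 : Real.sqrt 2 < 1.41422 := by rw [Real.sqrt_lt' (by norm_num)]; norm_num
  rw [h]; constructor <;> linarith

/-- The bound `1 + w² / 2 ≤ 1 / cos w`, in the form needed to compare `cos χ` with `cos ψ`. -/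
theorem cos_mul_one_add_sq_le {w : ℝ} (h0 : 0 < w) (h1 : w ≤ 2) :
    Real.cos w * (1 + w ^ 2 / 2) ≤ 1 := by
  have h2 := Real.sin_gt_sub_cube (x := w / 2) (by linarith)
  have h3 : Real.cos w = 1 - 2 * Real.sin (w / 2) ^ 2 := by
    have := Real.cos_sq (w / 2)
    have h4 := Real.sin_sq_add_cos_sq (w / 2)
    rw [show 2 * (w / 2) = w by ring] at this
    linarith
  have h4 : 0 < w / 2 - (w / 2) ^ 3 / 6 := by nlinarith [mul_pos h0 h0]
  have h5 : w ^ 2 / 4 * (1 - w ^ 2 / 12) ≤ Real.sin (w / 2) ^ 2 := by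
    have : (w / 2 - (w / 2) ^ 3 / 6) ^ 2 ≤ Real.sin (w / 2) ^ 2 := by gcongr
    refine le_trans ?_ this
    have : 0 ≤ w ^ 6 := by positivity
    nlinarith
  rw [h3]
  have h6 : w ^ 2 ≤ 4 := by nlinarith
  have h7 : 0 ≤ w ^ 4 := by positivity
  have : (1 - 2 * Real.sin (w / 2) ^ 2) * (1 + w ^ 2 / 2) ≤
      (1 - 2 * (w ^ 2 / 4 * (1 - w ^ 2 / 12))) * (1 + w ^ 2 / 2) := by
    have : 0 ≤ 1 + w ^ 2 / 2 := by positivity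
    gcongr
  refine this.trans ?_
  nlinarith

/-- An upper bound for the comparison angle at `A`, quadratic in `ω`. -/
theorem chi_pi_div_three_le {c : ℝ} (hc : 1 < c) (ho : omega c ≤ Real.pi / 3) :
    chi c (Real.pi / 3) ≤ Real.pi / 3 - 2 / Real.sqrt 3 * (omega c ^ 2 / 4) := by
  obtain ⟨o0, o1⟩ := omega_mem hc
  have hC := cos_omega_pos hc
  have hpi := Real.pi_gt_d6
  have hpi2 := Real.pi_lt_d6
  have hs3 := sqrt_three_bounds
  have hcos := cos_mul_one_add_sq_le o0 (by linarith)
  set w := omega c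
  set d := 2 / Real.sqrt 3 * (w ^ 2 / 4) with hd
  have hd0 : 0 ≤ d := by positivity
  have hd1 : d ≤ Real.pi / 3 := by
    have : 2 / Real.sqrt 3 ≤ 2 := by rw [div_le_iff₀ (by linarith)]; linarith
    have : w ^ 2 ≤ 1.0972 := by nlinarith
    have : d ≤ 2 * (1.0972 / 4) := by rw [hd]; gcongr
    linarith
  have hz : Real.cos (Real.pi / 3 - d) ≤ 1 / 2 / Real.cos w := by
    have h1 : Real.cos (Real.pi / 3 - d) ≤ 1 / 2 + w ^ 2 / 4 := by
      rw [Real.cos_sub, Real.cos_pi_div_three, Real.sin_pi_div_three]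
      have h2 := Real.cos_le_one d
      have h3 := Real.sin_le hd0
      have h4 : Real.sqrt 3 / 2 * d = w ^ 2 / 4 := by rw [hd]; field_simp
      nlinarith
    refine h1.trans ?_
    rw [le_div_iff₀ hC]
    linarith
  have := Real.arccos_le_arccos hz
  rw [Real.arccos_cos (by linarith) (by linarith)] at this
  rwa [chi, Real.cos_pi_div_three]

/-- An increasing piece that starts with `ψ ≤ π / 3` has a small change of the polar angle. -/
theorem Flow.ang_lt_of_increasing {c a b : ℝ} {σ κ : ℝ → ℝ} (h : Flow c a b σ κ) (hc : 1 < c)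
    (hab : a < b) (hs : ∀ s ∈ Ioo a b, 0 < σ s) (ha : psi σ κ a ≤ Real.pi / 3) :
    ang σ κ a b < Real.pi / 6 + psi σ κ a := by
  have ham := left_mem_Icc.2 hab.le
  have hbm := right_mem_Icc.2 hab.le
  have hwa := h.omega_le_psi hc ham (h.fst_nonneg hab hs ham)
  have hwb := h.omega_le_psi hc hbm (h.fst_nonneg hab hs hbm)
  have hb2 := h.psi_le_pi_div_two hbm (h.fst_nonneg hab hs hbm)
  obtain ⟨o0, o1⟩ := omega_mem hc
  have hpi := Real.pi_gt_d6
  have hpi2 := Real.pi_lt_d6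
  have hmon := monotoneOn_chi_sub hc
  have hA := chi_pi_div_three_le hc (hwa.trans ha)
  have m1 := hmon ⟨hwa, by linarith⟩ ⟨hwa.trans ha, by linarith⟩ ha
  have m2 := hmon ⟨hwb, hb2⟩ ⟨o1.le, le_rfl⟩ hb2
  have m3 := hmon ⟨le_rfl, o1.le⟩ ⟨hwa, by linarith⟩ hwa
  simp only [chi_pi_div_two, chi_omega hc] at m1 m2 m3
  obtain ⟨e1, e2⟩ := two_div_exp_bounds
  obtain ⟨r1, r2⟩ := one_div_sqrt_two_bounds
  have hs3 := sqrt_three_bounds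
  have ht3 : 1.1546 < 2 / Real.sqrt 3 := by rw [lt_div_iff₀ (by linarith)]; linarith
  have xa := chi_nonneg c (psi σ κ a)
  have xb := chi_nonneg c (psi σ κ b)
  set w := omega c
  set e := 2 / Real.exp 1
  have e3 : 1.152 / Real.sqrt 2 = 1.152 * (1 / Real.sqrt 2) := by ring
  set r := 1 / Real.sqrt 2
  set X := chi c (psi σ κ a)
  set Y := chi c (psi σ κ b)
  set α := psi σ κ a
  set β := psi σ κ b
  set Z := chi c (Real.pi / 3)
  -- the bounds of the parts inside and outside of the unit circle
  have hin : 0 ≤ e * X + (1 - e) * (α - w) :=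
    add_nonneg (by positivity) (mul_nonneg (by linarith) (by linarith))
  have hout : 1.152 * r * Y - 0.552 * (β - w) ≤
      1.152 * r * (Real.pi / 2) - 0.552 * (Real.pi / 2 - w) := by
    have : 0 ≤ (1.152 * r - 0.552) * (Real.pi / 2 - β) := mul_nonneg (by linarith) (by linarith)
    have : 0 ≤ r * (Real.pi / 2 - Real.pi / 2 - (Y - β)) := mul_nonneg (by linarith) (by linarith)
    linarith
  have hout0 : 0 ≤ 1.152 * r * (Real.pi / 2) - 0.552 * (Real.pi / 2 - w) := by
    have : 0 ≤ (1.152 * r - 0.552) * Real.pi := mul_nonneg (by linarith) (by linarith)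
    linarith
  have hmax : ang σ κ a b ≤ e * X + (1 - e) * (α - w) +
      (1.152 * r * (Real.pi / 2) - 0.552 * (Real.pi / 2 - w)) := by
    rcases le_total (rad σ κ b) 1 with hb | hb
    · have h1 := h.ang_le_of_inside hc hab.le fun s m =>
        (h.rad_lt_of_lt hs m.1.le m.2 le_rfl).trans_le hb
      have : 0 ≤ e * Y := by positivity
      have : 0 ≤ (1 - e) * (β - w) := mul_nonneg (by linarith) (by linarith)
      linarith
    · rcases le_total (rad σ κ a) 1 with ha1 | ha1
      · obtain ⟨t, ht, hpt, hin, hout⟩ := h.exists_rad_eq_one hc hab hs ha1 hb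
        have h1 := (h.mono le_rfl ht.2).ang_le_of_inside hc ht.1 hin
        have h2 := (h.mono ht.1 le_rfl).ang_le_of_outside hc ht.2 hout
        rw [hpt, chi_omega hc] at h1
        rw [hpt, chi_omega hc, e3] at h2
        rw [← h.ang_add ham ht hbm]
        linarith
      · have h2 := h.ang_le_of_outside hc hab.le fun s m =>
          ha1.trans_lt (h.rad_lt_of_lt hs le_rfl m.1 m.2.le)
        rw [e3] at h2
        have : 0 ≤ r * (X - α - (0 - w)) := mul_nonneg (by linarith) (by linarith)
        have : 0 ≤ (1.152 * r - 0.552) * (α - w) := mul_nonneg (by linarith) (by linarith)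
        linarith
  have h1 : e * (X - α) ≤ e * (-(1.1546 * (w ^ 2 / 4))) := by
    have : 1.1546 * (w ^ 2 / 4) ≤ 2 / Real.sqrt 3 * (w ^ 2 / 4) := by gcongr
    exact mul_le_mul_of_nonneg_left (by linarith) (by linarith)
  have h2 : e * (-(1.1546 * (w ^ 2 / 4))) ≤ 0.7357 * (-(1.1546 * (w ^ 2 / 4))) :=
    mul_le_mul_of_nonpos_right e1.le (neg_nonpos.2 (by positivity))
  have h3 : 1.152 * r * (Real.pi / 2) ≤ 1.152 * 0.70711 * (Real.pi / 2) :=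
    mul_le_mul_of_nonneg_right (by linarith) (by linarith)
  have h4 : (e - 0.448) * w ≤ 0.2878 * w :=
    mul_le_mul_of_nonneg_right (by linarith) o0.le
  -- what remains is a quadratic polynomial in `ω`, which is negative at its vertex near `0.6777`
  have h5 := sq_nonneg (w - 0.6777)
  linarith

/-- Lower bounds for a curve that starts inwards and ends outwards, and so passes a first and a last
point of least radius. -/
theorem Flow.psi_sub_psi_le_ang {c a b : ℝ} {σ κ : ℝ → ℝ} (h : Flow c a b σ κ) (hc : 1 < c)
    (hab : a < b) (ha : σ a < 0) (hb : 0 < σ b) :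
    psi σ κ a - psi σ κ b ≤ ang σ κ a b ∧
    1 / Real.sqrt 2 * (chi c (psi σ κ a) - chi c (psi σ κ b)) +
      (1 - 1 / Real.sqrt 2) * (psi σ κ a - psi σ κ b) ≤ ang σ κ a b := by
  obtain ⟨t, ht, ht0, htk, hneg⟩ := h.exists_first_bottom hc (Or.inl ha) ⟨hab, le_rfl⟩ hb.le
  have htb : t < b := lt_of_le_of_ne ht.2 fun e => by rw [e] at ht0; linarith
  obtain ⟨z, hz, hz0, hzk, hpos⟩ := h.exists_last_bottom hc (Or.inl hb) ⟨ht.1.le, htb⟩ ht0.le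
  have hz1 := (h.mono (ht.1.le.trans hz.1) le_rfl)
  have htm : t ∈ Icc a b := ⟨ht.1.le, ht.2⟩
  have hzm : z ∈ Icc a b := ⟨ht.1.le.trans hz.1, hz.2.le⟩
  have ht1 := (h.mono le_rfl ht.2).reflect t
  rw [sub_self] at ht1
  have hlt : 0 < t - a := by linarith [ht.1]
  have hpos' : ∀ s ∈ Ioo 0 (t - a), 0 < -σ (t - s) := fun s m => by
    have := hneg (t - s) ⟨by linarith [m.2], by linarith [m.1]⟩
    linarith
  have p1 := ht1.sub_psi_le_ang hc hlt hpos' (by simp [ht0]) (by simpa using htk)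
  have p2 := ht1.sub_chi_le_ang hc hlt hpos' (by simp [ht0]) (by simpa using htk)
  have q1 := hz1.sub_psi_le_ang hc hz.2 hpos hz0 hzk
  have q2 := hz1.sub_chi_le_ang hc hz.2 hpos hz0 hzk
  simp only [ang_reflect, psi_reflect, chi_pi_sub, sub_sub_cancel, sub_zero] at p1 p2
  rw [← h.ang_add (left_mem_Icc.2 hab.le) htm (right_mem_Icc.2 hab.le),
    ← h.ang_add htm hzm (right_mem_Icc.2 hab.le)]
  have := h.ang_nonneg htm.1 hz.1 hz.2.le
  constructor <;> linarith

/-- A curve without tips, with symmetric end directions, and with an endpoint in the unit disk,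
turns by at most `π`. -/
theorem Flow.ang_le_pi {c a b : ℝ} {σ κ : ℝ → ℝ} (h : Flow c a b σ κ) (hc : 1 < c)
    (hab : a < b) (ha : σ a < 0) (hb : 0 < σ b)
    (htip : ∀ s ∈ Icc a b, σ s = 0 → κ s < 1)
    (hsymm : psi σ κ a = Real.pi - psi σ κ b)
    (hR : rad σ κ a < 1 ∨ rad σ κ b < 1) : ang σ κ a b ≤ Real.pi := by
  obtain ⟨t, ht, ht0, htk, hneg⟩ := h.exists_first_bottom hc (Or.inl ha) ⟨hab, le_rfl⟩ hb.le
  have htb : t < b := lt_of_le_of_ne ht.2 fun e => by rw [e] at ht0; linarith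
  have hpos : ∀ s ∈ Ioo t b, 0 < σ s := by
    intro s m
    by_contra! h0
    obtain ⟨u, hu, hu0, huk, -⟩ := (h.mono ht.1.le le_rfl).exists_first_tip hc
      (Or.inr ⟨ht0, htk⟩) ⟨m.1, m.2.le⟩ h0
    exact absurd (htip u ⟨by linarith [hu.1, ht.1], by linarith [hu.2, m.2]⟩ hu0) (not_lt.2 huk.le)
  have hz1 := h.mono ht.1.le le_rfl
  have htm : t ∈ Icc a b := ⟨ht.1.le, ht.2⟩
  have ht1 := (h.mono le_rfl ht.2).reflect t
  rw [sub_self] at ht1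
  have hlt : 0 < t - a := by linarith [ht.1]
  have hpos' : ∀ s ∈ Ioo 0 (t - a), 0 < -σ (t - s) := fun s m => by
    have := hneg (t - s) ⟨by linarith [m.2], by linarith [m.1]⟩
    linarith
  have p1 := ht1.ang_le_of_end_le_one hc hlt hpos' (by simp [ht0])
  have p2 := ht1.ang_le_of_one_le_end hc hlt hpos' (by simp [ht0]) (by simpa using htk)
  have q1 := hz1.ang_le_of_end_le_one hc htb hpos ht0
  have q2 := hz1.ang_le_of_one_le_end hc htb hpos ht0 htk
  simp only [ang_reflect, psi_reflect, sub_sub_cancel, sub_zero, rad_reflect,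
    hsymm] at p1 p2
  rw [← h.ang_add (left_mem_Icc.2 hab.le) htm (right_mem_Icc.2 hab.le)]
  obtain ⟨e1, e2⟩ := two_div_exp_bounds
  obtain ⟨r1, r2⟩ := one_div_sqrt_two_bounds
  have hx := chi_nonneg c (psi σ κ b)
  have hy := psi_pos σ κ b
  obtain ⟨o0, o1⟩ := omega_mem hc
  set e := 2 / Real.exp 1
  set r := 1 / Real.sqrt 2
  set X := chi c (psi σ κ b)
  have k1 : 0 ≤ e * X := by positivity
  have k2 : 0 ≤ (1 - e) * psi σ κ b := mul_nonneg (by linarith) hy.le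
  have k3 : 0 ≤ (1 - e) * omega c := mul_nonneg (by linarith) o0.le
  have k4 : 0 ≤ (e - r) * X := mul_nonneg (by linarith) hx
  rcases le_total (rad σ κ a) 1 with h1 | h1 <;> rcases le_total (rad σ κ b) 1 with h2 | h2
  · linarith [p1 h1, q1 h2]
  · linarith [p1 h1, q2 h2]
  · linarith [p2 h1, q1 h2]
  · rcases hR with h | h <;> linarith

/-! ### Chains of trajectories with jumps at rays -/

/-- The phase space picture of an outer curve with `m` outward rays: consecutive trajectories of
the same energy, which jump from `ψ = π / 3` to `ψ = 2π / 3` at the rays, and with `cot ψ = x` at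
the initial point and `cot ψ = -x` at the final point. -/
structure FlowChain (c x : ℝ) (m : ℕ) (L : ℕ → ℝ) (σ κ : ℕ → ℝ → ℝ) : Prop where
  len_pos : ∀ i ≤ m, 0 < L i
  flow : ∀ i ≤ m, Flow c 0 (L i) (σ i) (κ i)
  jump_left : ∀ i < m, σ i (L i) = κ i (L i) / Real.sqrt 3
  jump_right : ∀ i < m, σ (i + 1) 0 = -(κ (i + 1) 0 / Real.sqrt 3)
  jump_snd : ∀ i < m, κ (i + 1) 0 = κ i (L i)
  fst_start : σ 0 0 = x * κ 0 0
  fst_end : σ m (L m) = -(x * κ m (L m))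

/-- The change of the polar angle along a chain, from parameter `s` of the piece `i` on. -/
def tailAng (m : ℕ) (L : ℕ → ℝ) (σ κ : ℕ → ℝ → ℝ) (i : ℕ) (s : ℝ) : ℝ :=
  ang (σ i) (κ i) s (L i) + ∑ j ∈ Finset.Ioc i m, ang (σ j) (κ j) 0 (L j)

theorem Flow.K_rad_of_fst_eq {c a b : ℝ} {σ κ : ℝ → ℝ} (h : Flow c a b σ κ) {s : ℝ}
    (hs : s ∈ Icc a b) (h1 : σ s ^ 2 = κ s ^ 2 / 3) :
    K (rad σ κ s) = Real.sqrt 3 / 2 * c := by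
  have hk := h.pos s hs
  have hr : rad σ κ s = 2 / Real.sqrt 3 * κ s := by
    have : σ s ^ 2 + κ s ^ 2 = (2 / Real.sqrt 3 * κ s) ^ 2 := by
      rw [mul_pow, div_pow, Real.sq_sqrt (by norm_num), h1]; ring
    rw [rad, this, Real.sqrt_sq (by positivity)]
  rw [h.K_rad hs, h.sin_psi hs, hr]
  field_simp

/-- The initial value of `K(R)` in terms of the slope `x = cot ψ ≥ 1 / √3`. -/
theorem Flow.K_rad_le_of_fst_eq {c a b x : ℝ} {σ κ : ℝ → ℝ} (h : Flow c a b σ κ) (hc : 0 < c)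
    {s : ℝ} (hs : s ∈ Icc a b) (hx : 1 / 3 ≤ x ^ 2) (h1 : σ s ^ 2 = (x * κ s) ^ 2) :
    K (rad σ κ s) ≤ Real.sqrt 3 / 2 * c := by
  have hk := h.pos s hs
  have hr : 2 / Real.sqrt 3 * κ s ≤ rad σ κ s := by
    have : (2 / Real.sqrt 3 * κ s) ^ 2 ≤ σ s ^ 2 + κ s ^ 2 := by
      rw [mul_pow, div_pow, Real.sq_sqrt (by norm_num), h1, mul_pow]
      nlinarith [sq_nonneg (κ s)]
    rw [rad]
    exact Real.le_sqrt_of_sq_le this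
  have hr0 : 0 < rad σ κ s := h.rad_pos hs
  rw [h.K_rad hs, h.sin_psi hs, mul_comm c]
  have : κ s / rad σ κ s ≤ Real.sqrt 3 / 2 := by
    have h3 : 0 < Real.sqrt 3 := by positivity
    rw [div_le_div_iff₀ hr0 (by norm_num)]
    rw [div_mul_eq_mul_div, div_le_iff₀ h3] at hr
    linarith
  gcongr

namespace FlowChain

variable {c x : ℝ} {m : ℕ} {L : ℕ → ℝ} {σ κ : ℕ → ℝ → ℝ}

theorem zero_mem (h : FlowChain c x m L σ κ) {i : ℕ} (hi : i ≤ m) : (0 : ℝ) ∈ Icc 0 (L i) :=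
  left_mem_Icc.2 (h.len_pos i hi).le

theorem len_mem (h : FlowChain c x m L σ κ) {i : ℕ} (hi : i ≤ m) : L i ∈ Icc 0 (L i) :=
  right_mem_Icc.2 (h.len_pos i hi).le

/-- Traversing a chain backwards, and reflecting the plane, gives a chain. -/
theorem reflect (h : FlowChain c x m L σ κ) :
    FlowChain c x m (fun i => L (m - i)) (fun i s => -σ (m - i) (L (m - i) - s))
      (fun i s => κ (m - i) (L (m - i) - s)) where
  len_pos i _ := h.len_pos _ (Nat.sub_le _ _)
  flow i _ := by
    have := (h.flow (m - i) (Nat.sub_le _ _)).reflect (L (m - i))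
    rwa [sub_self, sub_zero] at this
  jump_left i hi := by
    have := h.jump_right (m - (i + 1)) (by omega)
    rw [show m - (i + 1) + 1 = m - i by omega] at this
    simp [this]
  jump_right i hi := by
    have := h.jump_left (m - (i + 1)) (by omega)
    simp [this]
  jump_snd i hi := by
    have := h.jump_snd (m - (i + 1)) (by omega)
    rw [show m - (i + 1) + 1 = m - i by omega] at this
    simp [this]
  fst_start := by simp [h.fst_end]
  fst_end := by simp [h.fst_start]

theorem ang_nonneg (h : FlowChain c x m L σ κ) {i : ℕ} (hi : i ≤ m) :
    0 ≤ ang (σ i) (κ i) 0 (L i) :=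
  (h.flow i hi).ang_nonneg le_rfl (h.len_pos i hi).le le_rfl

theorem tailAng_le_of_le (h : FlowChain c x m L σ κ) {i : ℕ} (hi : i ≤ m) {s t : ℝ}
    (hs : 0 ≤ s) (hst : s ≤ t) (ht : t ≤ L i) :
    tailAng m L σ κ i t ≤ tailAng m L σ κ i s := by
  have hf := h.flow i hi
  have := hf.ang_nonneg hs hst ht
  have h2 := hf.ang_add (x := s) (y := t) (z := L i) ⟨hs, hst.trans ht⟩ ⟨hs.trans hst, ht⟩
    (h.len_mem hi)
  rw [tailAng, tailAng]
  linarith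

theorem tailAng_le_of_lt (h : FlowChain c x m L σ κ) {i j : ℕ} (hij : i < j) (hj : j ≤ m) {s t : ℝ}
    (hs : s ∈ Icc 0 (L i)) (ht : t ∈ Icc 0 (L j)) :
    tailAng m L σ κ j t ≤ tailAng m L σ κ i s := by
  refine (h.tailAng_le_of_le hj le_rfl ht.1 ht.2).trans ?_
  have h1 : tailAng m L σ κ j 0 = ∑ k ∈ Finset.Icc j m, ang (σ k) (κ k) 0 (L k) := by
    rw [tailAng, Finset.Icc_eq_cons_Ioc hj, Finset.sum_cons]
  rw [h1, tailAng]
  have h2 : ∑ k ∈ Finset.Icc j m, ang (σ k) (κ k) 0 (L k) ≤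
      ∑ k ∈ Finset.Ioc i m, ang (σ k) (κ k) 0 (L k) := by
    refine Finset.sum_le_sum_of_subset_of_nonneg (fun k hk => ?_) fun k hk _ =>
      h.ang_nonneg (Finset.mem_Ioc.1 hk).2
    rw [Finset.mem_Icc] at hk
    exact Finset.mem_Ioc.2 ⟨by omega, hk.2⟩
  have := (h.flow i (by omega)).ang_nonneg hs.1 hs.2 le_rfl
  linarith

/-- A piece between two rays has a point of least radius. -/
theorem exists_bottom (h : FlowChain c x m L σ κ) (hc : 1 < c) {i : ℕ} (h0 : 0 < i) (hi : i < m) :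
    ∃ s ∈ Icc 0 (L i), σ i s = 0 ∧ κ i s < 1 := by
  obtain ⟨j, rfl⟩ : ∃ j, i = j + 1 := ⟨i - 1, by omega⟩
  have hf := h.flow (j + 1) hi.le
  have k0 := hf.pos 0 (h.zero_mem hi.le)
  have k1 := hf.pos _ (h.len_mem hi.le)
  obtain ⟨t, ht, a1, a2, -⟩ := hf.exists_first_bottom hc
    (Or.inl (by rw [h.jump_right j (by omega), neg_lt_zero]; positivity))
    ⟨h.len_pos _ hi.le, le_rfl⟩ (by rw [h.jump_left _ hi]; positivity)
  exact ⟨t, ⟨ht.1.le, ht.2⟩, a1, a2⟩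

/-- The change of the polar angle from a point of least radius to the end.  If the last piece has a
point of least radius, then from there it rises through `R_A` and comes down to its end; otherwise
it is a descent from `R_A`, and the piece before it rises from a point of least radius to `R_A`. -/
theorem le_tailAng (h : FlowChain c x m L σ κ) (hc : cStar < c) (hx0 : 0 < x) (hx : 1 / 3 ≤ x ^ 2)
    {i : ℕ} (hi : i ≤ m) {s : ℝ} (hs : s ∈ Icc 0 (L i)) (h0 : σ i s = 0) (hk : κ i s < 1) :
    h1 c / 2 + h2 c + deltaTheta c (rad (σ m) (κ m) (L m)) (RA c) ≤ tailAng m L σ κ i s := by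
  have hc1 := one_lt_of_cStar_lt hc
  obtain ⟨a1, a2⟩ := RA_spec hc
  have hfm := h.flow m le_rfl
  have hLm := h.len_pos m le_rfl
  have hkm := hfm.pos _ (h.len_mem le_rfl)
  have hσL : σ m (L m) < 0 := by rw [h.fst_end, neg_lt_zero]; positivity
  have hKL : K (rad (σ m) (κ m) (L m)) ≤ Real.sqrt 3 / 2 * c :=
    hfm.K_rad_le_of_fst_eq (by linarith) (h.len_mem le_rfl) hx (by rw [h.fst_end, neg_sq])
  by_cases hb : ∃ t ∈ Icc 0 (L m), σ m t = 0 ∧ κ m t < 1 ∧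
      tailAng m L σ κ m t ≤ tailAng m L σ κ i s
  · obtain ⟨t, ht, t0, tk, hle⟩ := hb
    have htL : t < L m := lt_of_le_of_ne ht.2 fun e => by rw [e] at t0; linarith
    refine le_trans ?_ hle
    rw [tailAng, Finset.Ioc_self, Finset.sum_empty, add_zero]
    exact (hfm.mono ht.1 le_rfl).le_ang_ascent_descent hc htL t0 tk hσL hKL
  · push Not at hb
    -- the last piece comes straight down from `B`, the point with `R = R_A` and `ψ = 2π / 3`
    have him : i < m := by
      refine lt_of_le_of_ne hi fun e => ?_
      subst e
      exact absurd (hb s hs h0 hk) (lt_irrefl _)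
    obtain ⟨n, rfl⟩ : ∃ n, m = n + 1 := ⟨m - 1, by omega⟩
    have hk0 := hfm.pos _ (h.zero_mem le_rfl)
    have hstart : σ (n + 1) 0 < 0 := by
      rw [h.jump_right n (by omega), neg_lt_zero]; positivity
    have hneg : ∀ t ∈ Ioc 0 (L (n + 1)), σ (n + 1) t < 0 := by
      intro t ht
      by_contra! hpos
      obtain ⟨u, hu, u0, uk, -⟩ := hfm.exists_first_bottom hc1 (Or.inl hstart) ht hpos
      have hum : u ∈ Icc 0 (L (n + 1)) := ⟨hu.1.le, hu.2.trans ht.2⟩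
      exact absurd (hb u hum u0 uk) (not_lt.2 (h.tailAng_le_of_lt him le_rfl hs hum))
    have hrefl := hfm.reflect (L (n + 1))
    rw [sub_self, sub_zero] at hrefl
    have hpos' : ∀ t ∈ Ico 0 (L (n + 1)), 0 < -σ (n + 1) (L (n + 1) - t) := fun t ht => by
      have := hneg (L (n + 1) - t) ⟨by linarith [ht.2], by linarith [ht.1]⟩
      linarith
    have hmono := hrefl.strictMonoOn_rad fun t ht => hpos' t ⟨ht.1.le, ht.2⟩
    have hlt := hmono (left_mem_Icc.2 hLm.le) (right_mem_Icc.2 hLm.le) hLm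
    rw [Flow.rad_reflect, Flow.rad_reflect, sub_self, sub_zero] at hlt
    have hR0 : rad (σ (n + 1)) (κ (n + 1)) 0 = RA c := by
      have hK0 : K (rad (σ (n + 1)) (κ (n + 1)) 0) = Real.sqrt 3 / 2 * c :=
        hfm.K_rad_of_fst_eq (h.zero_mem le_rfl) (by
          rw [h.jump_right n (by omega), neg_sq, div_pow, Real.sq_sqrt (by norm_num)])
      rcases eq_RA_or_RD hc (hfm.rad_pos (h.zero_mem le_rfl)) hK0 with e | e
      · exact e
      · have := RD_le_of_K_le hc (hfm.rad_pos (h.len_mem le_rfl)) hKL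
        linarith
    have hang : ang (σ (n + 1)) (κ (n + 1)) 0 (L (n + 1)) =
        deltaTheta c (rad (σ (n + 1)) (κ (n + 1)) (L (n + 1))) (RA c) := by
      have := hrefl.ang_eq_deltaTheta (by linarith) hLm.le (fun t ht => by
        rcases eq_or_lt_of_le ht.2 with e | e
        · rw [e, sub_self]; linarith
        · exact hpos' t ⟨ht.1, e⟩)
      rwa [Flow.ang_reflect, Flow.rad_reflect, Flow.rad_reflect, sub_self, sub_zero, hR0] at this
    -- the piece before it has a point of least radius
    obtain ⟨t, ht, t0, tk, hle⟩ : ∃ t ∈ Icc 0 (L n), σ n t = 0 ∧ κ n t < 1 ∧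
        tailAng (n + 1) L σ κ n t ≤ tailAng (n + 1) L σ κ i s := by
      rcases Nat.lt_or_ge i n with hin | hin
      · obtain ⟨t, ht, t0, tk⟩ := h.exists_bottom hc1 (i := n) (by omega) (by omega)
        exact ⟨t, ht, t0, tk, h.tailAng_le_of_lt hin (by omega) hs ht⟩
      · obtain rfl : i = n := by omega
        exact ⟨s, hs, h0, hk, le_rfl⟩
    have hfn := h.flow n (by omega)
    have hRn : rad (σ n) (κ n) (L n) = RA c := by
      rw [← hR0, rad, rad, h.jump_left n (by omega), h.jump_right n (by omega),
        h.jump_snd n (by omega), neg_sq]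
    obtain ⟨u, hu, -, hua⟩ := (hfn.mono ht.1 le_rfl).exists_ang_eq_ascent' hc t0 tk
      (right_mem_Icc.2 ht.2) hRn.ge
    refine le_trans ?_ hle
    have hIoc : Finset.Ioc n (n + 1) = {n + 1} := by
      ext k; simp only [Finset.mem_Ioc, Finset.mem_singleton]; omega
    rw [tailAng, hIoc, Finset.sum_singleton, hang]
    have h3 := hfn.ang_add ht ⟨ht.1.trans hu.1.le, hu.2⟩ (h.len_mem (by omega))
    have h4 := hfn.ang_nonneg (ht.1.trans hu.1.le) hu.2 le_rfl
    linarith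

/-- The change of the polar angle along the whole chain, split at the parameter `s` of the piece `i`
into the part after it and the part before it, the latter as the tail of the reflected chain. -/
theorem sum_eq (h : FlowChain c x m L σ κ) {i : ℕ} (hi : i ≤ m) {s : ℝ} (hs : s ∈ Icc 0 (L i)) :
    tailAng m (fun i => L (m - i)) (fun i s => -σ (m - i) (L (m - i) - s))
      (fun i s => κ (m - i) (L (m - i) - s)) (m - i) (L i - s) + tailAng m L σ κ i s =
      ∑ j ∈ Finset.range (m + 1), ang (σ j) (κ j) 0 (L j) := by
  rw [tailAng, tailAng]
  simp only [Flow.ang_reflect, sub_self, sub_zero, Nat.sub_sub_self hi, sub_sub_cancel]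
  have e : ∑ j ∈ Finset.Ioc (m - i) m, ang (σ (m - j)) (κ (m - j)) 0 (L (m - j)) =
      ∑ j ∈ Finset.range i, ang (σ j) (κ j) 0 (L j) := by
    refine Finset.sum_nbij' (fun j => m - j) (fun j => m - j) ?_ ?_ ?_ ?_ ?_
    · intro j hj; rw [Finset.mem_Ioc] at hj; rw [Finset.mem_range]; omega
    · intro j hj; rw [Finset.mem_range] at hj; rw [Finset.mem_Ioc]; omega
    · intro j hj; rw [Finset.mem_Ioc] at hj; omega
    · intro j hj; rw [Finset.mem_range] at hj; omega
    · intro j hj; rfl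
  have e2 : Finset.Ioc i m = Finset.Ico (i + 1) (m + 1) := by
    ext k; simp only [Finset.mem_Ioc, Finset.mem_Ico]; omega
  rw [e, e2, ← Finset.sum_range_add_sum_Ico _ (show i + 1 ≤ m + 1 by omega),
    Finset.sum_range_succ,
    ← (h.flow i hi).ang_add (h.zero_mem hi) hs (h.len_mem hi)]
  ring

/-- A chain with a point of least radius turns at least by the changes `h1` and `2 h2` near it, and
by those between `R_A` and both ends. -/
theorem le_sum_of_bottom (h : FlowChain c x m L σ κ) (hc : cStar < c) (hx0 : 0 < x)
    (hx : 1 / 3 ≤ x ^ 2) {i : ℕ} (hi : i ≤ m) {s : ℝ} (hs : s ∈ Icc 0 (L i)) (h0 : σ i s = 0)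
    (hk : κ i s < 1) :
    h1 c + 2 * h2 c + deltaTheta c (rad (σ 0) (κ 0) 0) (RA c) +
      deltaTheta c (rad (σ m) (κ m) (L m)) (RA c) ≤
      ∑ j ∈ Finset.range (m + 1), ang (σ j) (κ j) 0 (L j) := by
  have e1 := h.le_tailAng hc hx0 hx hi hs h0 hk
  have e2 := h.reflect.le_tailAng hc hx0 hx (i := m - i) (Nat.sub_le _ _) (s := L i - s)
    (by simp only [Nat.sub_sub_self hi]; exact ⟨by linarith [hs.2], by linarith [hs.1]⟩)
    (by simp [Nat.sub_sub_self hi, h0]) (by simpa [Nat.sub_sub_self hi] using hk)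
  rw [Flow.rad_reflect] at e2
  simp only [Nat.sub_self, sub_self] at e2
  rw [← h.sum_eq hi hs]
  linarith

/-- A chain without points of least radius consists of a single rise and a single descent, perhaps
with a ray in between, and both of them turn by little. -/
theorem sum_lt_of_no_bottom (h : FlowChain c x m L σ κ) (hc : 1 < c) (hx0 : 0 < x)
    (hx : Real.pi / 2 - Real.arctan x ≤ Real.pi / 3)
    (hb : ∀ i ≤ m, ∀ s ∈ Icc 0 (L i), σ i s = 0 → 1 ≤ κ i s) :
    ∑ j ∈ Finset.range (m + 1), ang (σ j) (κ j) 0 (L j) <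
      Real.pi / 3 + 2 * (Real.pi / 2 - Real.arctan x) := by
  have hm : m ≤ 1 := by
    by_contra! hm
    obtain ⟨s, hs, h0, hk⟩ := h.exists_bottom hc (i := 1) one_pos hm
    linarith [hb 1 hm.le s hs h0]
  have hf0 := h.flow 0 (Nat.zero_le _)
  have hfm := h.flow m le_rfl
  have hL0 := h.len_pos 0 (Nat.zero_le _)
  have hLm := h.len_pos m le_rfl
  have hk0 := hf0.pos _ (h.zero_mem (Nat.zero_le _))
  have hkm := hfm.pos _ (h.len_mem le_rfl)
  have hs0 : 0 < σ 0 0 := by rw [h.fst_start]; positivity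
  have hsm : σ m (L m) < 0 := by rw [h.fst_end, neg_lt_zero]; positivity
  have hψ0 : psi (σ 0) (κ 0) 0 = Real.pi / 2 - Real.arctan x := by
    rw [psi, h.fst_start, mul_div_cancel_right₀ _ hk0.ne']
  have hψm : psi (σ m) (κ m) (L m) = Real.pi / 2 + Real.arctan x := by
    rw [psi, h.fst_end, neg_div, mul_div_cancel_right₀ _ hkm.ne', Real.arctan_neg]; ring
  have hrefl := hfm.reflect (L m)
  rw [sub_self, sub_zero] at hrefl
  have hψm' : psi (fun s => -σ m (L m - s)) (fun s => κ m (L m - s)) 0 =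
      Real.pi / 2 - Real.arctan x := by rw [Flow.psi_reflect, sub_zero, hψm]; ring
  -- the two monotone ends
  have key : ∀ t ∈ Ioc 0 (L 0), (∀ s ∈ Ioo 0 t, 0 < σ 0 s) →
      ang (σ 0) (κ 0) 0 t < Real.pi / 6 + (Real.pi / 2 - Real.arctan x) := fun t ht hs => by
    have := (hf0.mono le_rfl ht.2).ang_lt_of_increasing hc ht.1 hs (by rwa [hψ0])
    rwa [hψ0] at this
  have key2 : ∀ t ∈ Ico 0 (L m), (∀ s ∈ Ioo t (L m), σ m s < 0) →
      ang (σ m) (κ m) t (L m) < Real.pi / 6 + (Real.pi / 2 - Real.arctan x) := fun t ht hs => by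
    have := (hrefl.mono (b' := L m - t) le_rfl (by linarith [ht.1])).ang_lt_of_increasing hc
      (by linarith [ht.2]) (fun s m' => by
        have := hs (L m - s) ⟨by linarith [m'.2], by linarith [m'.1]⟩
        linarith) (by rwa [hψm'])
    rwa [hψm', Flow.ang_reflect, sub_sub_cancel, sub_zero] at this
  have hcases : m = 0 ∨ m = 1 := by omega
  rcases hcases with rfl | rfl
  · rw [Finset.sum_range_one]
    obtain ⟨t, ht, t0, tk, hpos⟩ := hf0.exists_first_tip hc (Or.inl hs0) ⟨hL0, le_rfl⟩ hsm.le
    have htL : t < L 0 := lt_of_le_of_ne ht.2 fun e => by rw [e] at t0; linarith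
    have hneg : ∀ s ∈ Ioo t (L 0), σ 0 s < 0 := by
      intro s hs
      by_contra! hs0
      obtain ⟨u, hu, u0, uk, -⟩ := (hf0.mono ht.1.le le_rfl).exists_first_bottom hc
        (Or.inr ⟨t0, tk⟩) ⟨hs.1, hs.2.le⟩ hs0
      linarith [hb 0 le_rfl u ⟨by linarith [hu.1, ht.1], by linarith [hu.2, hs.2]⟩ u0]
    have htm : t ∈ Icc 0 (L 0) := ⟨ht.1.le, ht.2⟩
    rw [← hf0.ang_add (h.zero_mem le_rfl) htm (h.len_mem le_rfl)]
    linarith [key t ht hpos, key2 t ⟨ht.1.le, htL⟩ hneg]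
  · rw [Finset.sum_range_succ, Finset.sum_range_one]
    have hkL := hf0.pos _ (h.len_mem (Nat.zero_le _))
    have hk1 := hfm.pos _ (h.zero_mem le_rfl)
    have hsL : 0 < σ 0 (L 0) := by rw [h.jump_left 0 one_pos]; positivity
    have hs1 : σ 1 0 < 0 := by
      have := h.jump_right 0 one_pos
      rw [zero_add] at this
      rw [this, neg_lt_zero]; positivity
    have hpos : ∀ s ∈ Ioo 0 (L 0), 0 < σ 0 s := by
      intro s hs
      by_contra! hs0
      obtain ⟨u, hu, u0, uk, -⟩ := hf0.exists_last_bottom hc (Or.inl hsL) ⟨hs.1.le, hs.2⟩ hs0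
      linarith [hb 0 (by omega) u ⟨hs.1.le.trans hu.1, hu.2.le⟩ u0]
    have hneg : ∀ s ∈ Ioo 0 (L 1), σ 1 s < 0 := by
      intro s hs
      by_contra! hs0
      obtain ⟨u, hu, u0, uk, -⟩ := hfm.exists_first_bottom hc (Or.inl hs1) ⟨hs.1, hs.2.le⟩ hs0
      linarith [hb 1 le_rfl u ⟨hu.1.le, hu.2.trans hs.2.le⟩ u0]
    linarith [key (L 0) ⟨hL0, le_rfl⟩ hpos, key2 0 ⟨le_rfl, hLm⟩ hneg]

end FlowChain

/-- An endpoint in the unit disk contributes more than `Δθ_NA`, by an amount that the chord of the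
shape function bounds below. -/
theorem deltaTheta_eq_add_thetaNA {c R : ℝ} (hc : cStar < c) (h0 : 0 < R) (h1 : R < 1)
    (hK : K R ≤ Real.sqrt 3 / 2 * c) :
    deltaTheta c R (RA c) = deltaTheta c R 1 + thetaNA c ∧
    1 / Real.sqrt 2 * chi c (psiOf c R) + (1 - 1 / Real.sqrt 2) * (psiOf c R - omega c) ≤
      deltaTheta c R 1 ∧ omega c < psiOf c R := by
  have hc1 := one_lt_of_cStar_lt hc
  obtain ⟨a1, a2⟩ := RA_spec hc
  have hsub := Icc_RD_RA_subset hc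
  have hRD := RD_le_of_K_le hc h0 hK
  have hcc := mul_c_lt_c hc1
  refine ⟨?_, ?_, ?_⟩
  · rw [thetaNA, deltaTheta_add]
    · rw [uIcc_of_le h1.le]; exact (Icc_subset_Icc hRD a1.le).trans hsub
    · rw [uIcc_of_le a1.le]; exact (Icc_subset_Icc_left (hRD.trans h1.le)).trans hsub
  · have := le_deltaTheta_of_le_one hc1 h0 h1.le le_rfl (by linarith)
    rw [psiOf_one, chi_omega hc1] at this
    refine le_trans (le_of_eq ?_) this
    ring
  · have h2 := one_lt_K h0 h1.ne
    apply Real.arcsin_lt_arcsin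
    · have : 0 < 1 / c := by positivity
      linarith
    · gcongr
    · rw [div_le_one (by linarith)]; linarith

/-- Two endpoints with the same value of `K(R)`, not both outside of the unit circle, contribute
more than `2 Δθ_NA`. -/
theorem two_mul_thetaNA_lt {c R S : ℝ} (hc : cStar < c) (h0 : 0 < R) (h1 : R < 1) (hS : 0 < S)
    (hRS : K S = K R) (hK : K R ≤ Real.sqrt 3 / 2 * c) :
    2 * thetaNA c < deltaTheta c R (RA c) + deltaTheta c S (RA c) := by
  have hc1 := one_lt_of_cStar_lt hc
  obtain ⟨r1, r2⟩ := one_div_sqrt_two_bounds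
  obtain ⟨e1, e2, e3⟩ := deltaTheta_eq_add_thetaNA hc h0 h1 hK
  have hx := chi_nonneg c (psiOf c R)
  have hpos : 0 < (1 - 1 / Real.sqrt 2) * (psiOf c R - omega c) :=
    mul_pos (by linarith) (by linarith)
  rcases lt_or_ge S 1 with hS1 | hS1
  · obtain rfl : S = R := strictAntiOn_K.injOn ⟨hS, hS1.le⟩ ⟨h0, h1.le⟩ hRS
    have : 0 ≤ 1 / Real.sqrt 2 * chi c (psiOf c S) := by positivity
    linarith
  · obtain ⟨a1, a2⟩ := RA_spec hc
    have hsub := Icc_RD_RA_subset hc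
    have hSA : S ≤ RA c := le_RA_of_K_le hc (by rwa [hRS])
    have hD := (RD_spec hc).2.1
    have hadd : deltaTheta c 1 S + deltaTheta c S (RA c) = thetaNA c := by
      rw [thetaNA, deltaTheta_add]
      · rw [uIcc_of_le hS1]; exact (Icc_subset_Icc hD.le hSA).trans hsub
      · rw [uIcc_of_le hSA]; exact (Icc_subset_Icc_left (hD.le.trans hS1)).trans hsub
    have hle := deltaTheta_le_of_one_le hc1 le_rfl hS1
      (by rw [hRS]; linarith [mul_c_lt_c hc1])
    have hψ : psiOf c S = psiOf c R := by rw [psiOf, psiOf, hRS]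
    rw [psiOf_one, chi_omega hc1, hψ, sub_zero] at hle
    have : chi c (psiOf c R) / Real.sqrt 2 = 1 / Real.sqrt 2 * chi c (psiOf c R) := by ring
    linarith

namespace FlowChain

variable {c x : ℝ} {m : ℕ} {L : ℕ → ℝ} {σ κ : ℕ → ℝ → ℝ}

theorem K_rad_start_eq (h : FlowChain c x m L σ κ) :
    K (rad (σ 0) (κ 0) 0) = K (rad (σ m) (κ m) (L m)) := by
  have hf0 := h.flow 0 (Nat.zero_le _)
  have hfm := h.flow m le_rfl
  have m0 := h.zero_mem (Nat.zero_le m)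
  have mm := h.len_mem (le_refl m)
  rw [hf0.K_rad m0, hfm.K_rad mm, psi, psi, h.fst_start, h.fst_end,
    mul_div_cancel_right₀ _ (hf0.pos _ m0).ne', neg_div,
    mul_div_cancel_right₀ _ (hfm.pos _ mm).ne', Real.arctan_neg, ← Real.sin_pi_sub]
  congr 2; ring

theorem cStar_lt (h : FlowChain c x m L σ κ) (hc : 0 < c) (hx : 1 / 3 ≤ x ^ 2)
    (hR : rad (σ 0) (κ 0) 0 < 1 ∨ rad (σ m) (κ m) (L m) < 1) : cStar < c := by
  have hf0 := h.flow 0 (Nat.zero_le _)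
  have m0 := h.zero_mem (Nat.zero_le m)
  have hle := hf0.K_rad_le_of_fst_eq hc m0 hx (by rw [h.fst_start])
  rw [cStar_lt_iff]
  refine lt_of_lt_of_le ?_ hle
  rcases hR with hR | hR
  · exact one_lt_K (hf0.rad_pos m0) hR.ne
  · rw [h.K_rad_start_eq]
    exact one_lt_K ((h.flow m le_rfl).rad_pos (h.len_mem le_rfl)) hR.ne

/-- The lower bound for a chain with a point of least radius. -/
theorem lt_sum_of_bottom (h : FlowChain c x m L σ κ) (hc : cStar < c) (hx0 : 0 < x)
    (hx : 1 / 3 ≤ x ^ 2) {i : ℕ} (hi : i ≤ m) {s : ℝ} (hs : s ∈ Icc 0 (L i)) (h0 : σ i s = 0)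
    (hk : κ i s < 1)
    (hR : rad (σ 0) (κ 0) 0 < 1 ∨ rad (σ m) (κ m) (L m) < 1) :
    h1 c + 2 * h2 c + 2 * thetaNA c <
      ∑ j ∈ Finset.range (m + 1), ang (σ j) (κ j) 0 (L j) := by
  have hf0 := h.flow 0 (Nat.zero_le _)
  have hfm := h.flow m le_rfl
  have m0 := h.zero_mem (Nat.zero_le m)
  have mm := h.len_mem (le_refl m)
  have hle := hf0.K_rad_le_of_fst_eq (by linarith [one_lt_of_cStar_lt hc]) m0 hx
    (by rw [h.fst_start])
  have hKe := h.K_rad_start_eq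
  have := h.le_sum_of_bottom hc hx0 hx hi hs h0 hk
  rcases hR with hR | hR
  · linarith [two_mul_thetaNA_lt hc (hf0.rad_pos m0) hR (hfm.rad_pos mm) hKe.symm hle]
  · linarith [two_mul_thetaNA_lt hc (hfm.rad_pos mm) hR (hf0.rad_pos m0) hKe (by rwa [← hKe])]

end FlowChain

/-! ### Shrinking arcs -/

theorem inner_eq (z w : ℂ) : inner ℝ z w = z.re * w.re + z.im * w.im := by
  rw [Complex.inner]; simp; ring

theorem normSq_eq (z : ℂ) : ‖z‖ ^ 2 = z.re ^ 2 + z.im ^ 2 := by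
  rw [← Complex.normSq_eq_norm_sq, Complex.normSq_apply]; ring

theorem hasDerivWithinAt_integral {E : Type*} [NormedAddCommGroup E] [NormedSpace ℝ E]
    [CompleteSpace E] {g : ℝ → E} {a b : ℝ} (hg : ContinuousOn g (Icc a b)) {s : ℝ}
    (hs : s ∈ Icc a b) :
    HasDerivWithinAt (fun s => ∫ t in a..s, g t) (g s) (Icc a b) s := by
  have : Fact (s ∈ Icc a b) := ⟨hs⟩
  refine intervalIntegral.integral_hasDerivWithinAt_right ?_
    (hg.stronglyMeasurableAtFilter_nhdsWithin measurableSet_Icc s) (hg s hs)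
  exact (hg.mono (uIcc_subset_Icc ⟨le_rfl, hs.1.trans hs.2⟩ hs)).intervalIntegrable

theorem eq_of_hasDerivWithinAt_zero {E : Type*} [NormedAddCommGroup E] [NormedSpace ℝ E]
    {f : ℝ → E} {a b : ℝ} (hf : ∀ s ∈ Icc a b, HasDerivWithinAt f 0 (Icc a b) s) {s : ℝ}
    (hs : s ∈ Icc a b) : f s = f a := by
  rcases eq_or_lt_of_le (hs.1.trans hs.2) with e | hab
  · have : s = a := le_antisymm (e ▸ hs.2) hs.1
    rw [this]
  · exact constant_of_derivWithin_zero (fun s hs => (hf s hs).differentiableWithinAt)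
      (fun s hs => (hf s (Ico_subset_Icc_self hs)).derivWithin
        (uniqueDiffOn_Icc hab s (Ico_subset_Icc_self hs))) s hs

namespace Arc

variable (γ : Arc)

/-- The tangential part `σ = ⟨x, x_s⟩` of the position. -/
def sig (s : ℝ) : ℝ := inner ℝ (γ.pos s) (γ.vel s)

/-- The normal part `κ = x × x_s` of the position. -/
def kap (s : ℝ) : ℝ := cross (γ.pos s) (γ.vel s)

theorem zero_mem : (0 : ℝ) ∈ Icc 0 γ.len := left_mem_Icc.2 γ.len_pos.le

theorem len_mem : γ.len ∈ Icc 0 γ.len := right_mem_Icc.2 γ.len_pos.le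

theorem sig_eq (s : ℝ) :
    γ.sig s = (γ.pos s).re * (γ.vel s).re + (γ.pos s).im * (γ.vel s).im := inner_eq _ _

theorem kap_eq (s : ℝ) :
    γ.kap s = (γ.pos s).re * (γ.vel s).im - (γ.pos s).im * (γ.vel s).re := rfl

theorem vel_sq {s : ℝ} (hs : s ∈ Icc 0 γ.len) : (γ.vel s).re ^ 2 + (γ.vel s).im ^ 2 = 1 := by
  rw [← normSq_eq, γ.norm_vel s hs, one_pow]

theorem norm_pos_sq {s : ℝ} (hs : s ∈ Icc 0 γ.len) : ‖γ.pos s‖ ^ 2 = γ.sig s ^ 2 + γ.kap s ^ 2 := by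
  rw [normSq_eq, sig_eq, kap_eq]
  linear_combination (-(γ.pos s).re ^ 2 - (γ.pos s).im ^ 2) * γ.vel_sq hs

theorem rad_eq {s : ℝ} (hs : s ∈ Icc 0 γ.len) : rad γ.sig γ.kap s = ‖γ.pos s‖ := by
  rw [rad, ← γ.norm_pos_sq hs, Real.sqrt_sq (norm_nonneg _)]

theorem continuousOn_pos : ContinuousOn γ.pos (Icc 0 γ.len) :=
  fun s hs => (γ.hasDeriv_pos s hs).continuousWithinAt

theorem continuousOn_vel : ContinuousOn γ.vel (Icc 0 γ.len) :=
  fun s hs => (γ.shrinker s hs).continuousWithinAt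

theorem hasDeriv_components {s : ℝ} (hs : s ∈ Icc 0 γ.len) :
    HasDerivWithinAt (fun s => (γ.pos s).re) (γ.vel s).re (Icc 0 γ.len) s ∧
    HasDerivWithinAt (fun s => (γ.pos s).im) (γ.vel s).im (Icc 0 γ.len) s ∧
    HasDerivWithinAt (fun s => (γ.vel s).re) (-((γ.pos s).re - γ.sig s * (γ.vel s).re))
      (Icc 0 γ.len) s ∧
    HasDerivWithinAt (fun s => (γ.vel s).im) (-((γ.pos s).im - γ.sig s * (γ.vel s).im))
      (Icc 0 γ.len) s := by
  have h1 := γ.hasDeriv_pos s hs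
  have h2 := γ.shrinker s hs
  have re : ∀ {f : ℝ → ℂ} {f' : ℂ}, HasDerivWithinAt f f' (Icc 0 γ.len) s →
      HasDerivWithinAt (fun s => (f s).re) f'.re (Icc 0 γ.len) s := fun h =>
    Complex.reCLM.hasFDerivAt.comp_hasDerivWithinAt s h
  have im : ∀ {f : ℝ → ℂ} {f' : ℂ}, HasDerivWithinAt f f' (Icc 0 γ.len) s →
      HasDerivWithinAt (fun s => (f s).im) f'.im (Icc 0 γ.len) s := fun h =>
    Complex.imCLM.hasFDerivAt.comp_hasDerivWithinAt s h
  refine ⟨re h1, im h1, ?_, ?_⟩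
  · refine (re h2).congr_deriv ?_
    simp [sig]
  · refine (im h2).congr_deriv ?_
    simp [sig]

theorem hasDeriv_sig {s : ℝ} (hs : s ∈ Icc 0 γ.len) :
    HasDerivWithinAt γ.sig (1 - γ.kap s ^ 2) (Icc 0 γ.len) s := by
  obtain ⟨h1, h2, h3, h4⟩ := γ.hasDeriv_components hs
  have e : γ.sig = fun s => (γ.pos s).re * (γ.vel s).re + (γ.pos s).im * (γ.vel s).im :=
    funext γ.sig_eq
  have := (h1.mul h3).add (h2.mul h4)
  rw [e]
  refine this.congr_deriv ?_
  have hv := γ.vel_sq hs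
  have hn := γ.norm_pos_sq hs
  rw [normSq_eq] at hn
  have hs' := γ.sig_eq s
  linear_combination hv - hn - γ.sig s * hs'

theorem hasDeriv_kap {s : ℝ} (hs : s ∈ Icc 0 γ.len) :
    HasDerivWithinAt γ.kap (γ.sig s * γ.kap s) (Icc 0 γ.len) s := by
  obtain ⟨h1, h2, h3, h4⟩ := γ.hasDeriv_components hs
  have e : γ.kap = fun s => (γ.pos s).re * (γ.vel s).im - (γ.pos s).im * (γ.vel s).re :=
    funext γ.kap_eq
  have := (h1.mul h4).sub (h2.mul h3)
  rw [e]
  refine this.congr_deriv ?_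
  ring

/-- The quantity `κ exp (-R² / 2)` is a first integral of the shrinker equation. -/
theorem kap_eq_mul_exp {s : ℝ} (hs : s ∈ Icc 0 γ.len) :
    γ.kap s = γ.kap 0 * Real.exp ((‖γ.pos s‖ ^ 2 - ‖γ.pos 0‖ ^ 2) / 2) := by
  have hd : ∀ t ∈ Icc 0 γ.len, HasDerivWithinAt
      (fun t => γ.kap t * Real.exp (-(γ.sig t ^ 2 + γ.kap t ^ 2) / 2)) 0 (Icc 0 γ.len) t := by
    intro t ht
    have h1 := γ.hasDeriv_sig ht
    have h2 := γ.hasDeriv_kap ht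
    have := h2.mul ((((h1.pow 2).add (h2.pow 2)).neg.div_const 2).exp)
    refine this.congr_deriv ?_
    simp
    ring
  have := eq_of_hasDerivWithinAt_zero hd hs
  rw [← γ.norm_pos_sq hs, ← γ.norm_pos_sq γ.zero_mem] at this
  have e : Real.exp ((‖γ.pos s‖ ^ 2 - ‖γ.pos 0‖ ^ 2) / 2) =
      Real.exp (-‖γ.pos 0‖ ^ 2 / 2) / Real.exp (-‖γ.pos s‖ ^ 2 / 2) := by
    rw [← Real.exp_sub]; congr 1; ring
  rw [e, ← mul_div_assoc, ← this]
  have := Real.exp_pos (-‖γ.pos s‖ ^ 2 / 2)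
  field_simp

theorem kap_pos (h : 0 < γ.kap 0) {s : ℝ} (hs : s ∈ Icc 0 γ.len) : 0 < γ.kap s := by
  rw [γ.kap_eq_mul_exp hs]; positivity

theorem pos_ne_zero_of_kap_ne {s : ℝ} (h : γ.kap s ≠ 0) : γ.pos s ≠ 0 := by
  intro h0; apply h; rw [kap_eq, h0]; simp

theorem energy_eq (h : γ.kap 0 ≠ 0) :
    γ.energy = Real.exp ((‖γ.source‖ ^ 2 - 1) / 2) / γ.kap 0 := by
  have h1 : 0 < ‖γ.source‖ := norm_pos_iff.2 (γ.pos_ne_zero_of_kap_ne h)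
  rw [Arc.energy, K, source, ← Arc.kap]
  rw [source] at h1
  field_simp

/-- A counterclockwise arc is a trajectory in the phase plane. -/
theorem flow (h : 0 < γ.kap 0) : Flow γ.energy 0 γ.len γ.sig γ.kap where
  hasDeriv_fst _ hs := γ.hasDeriv_sig hs
  hasDeriv_snd _ hs := γ.hasDeriv_kap hs
  pos _ hs := γ.kap_pos h hs
  energy s hs := by
    rw [γ.energy_eq h.ne', source, ← γ.norm_pos_sq hs, γ.kap_eq_mul_exp hs]
    have e2 : Real.exp ((‖γ.pos s‖ ^ 2 - 1) / 2) = Real.exp ((‖γ.pos 0‖ ^ 2 - 1) / 2) *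
        Real.exp ((‖γ.pos s‖ ^ 2 - ‖γ.pos 0‖ ^ 2) / 2) := by
      rw [← Real.exp_add]; congr 1; ring
    rw [e2]
    field_simp

/-- The change of the polar angle up to the parameter `s`. -/
def lift (s : ℝ) : ℝ := ang γ.sig γ.kap 0 s

theorem lift_zero : γ.lift 0 = 0 := intervalIntegral.integral_same

theorem angle_eq : γ.angle = γ.lift γ.len := by
  refine intervalIntegral.integral_congr fun s hs => ?_
  rw [uIcc_of_le γ.len_pos.le] at hs
  rw [← γ.norm_pos_sq hs, Arc.kap]

/-! ### Polar coordinates along an arc -/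

theorem continuousOn_vel_div {w : ℂ} (hw : w ∉ γ.carrier) :
    ContinuousOn (fun t => γ.vel t / (γ.pos t - w)) (Icc 0 γ.len) :=
  γ.continuousOn_vel.div (γ.continuousOn_pos.sub continuousOn_const) fun t ht h =>
    hw ⟨t, ht, sub_eq_zero.1 h⟩

theorem pos_sub_eq {w : ℂ} (hw : w ∉ γ.carrier) {s : ℝ} (hs : s ∈ Icc 0 γ.len) :
    γ.pos s - w = (γ.pos 0 - w) * Complex.exp (∫ t in (0 : ℝ)..s, γ.vel t / (γ.pos t - w)) := by
  have hc := γ.continuousOn_vel_div hw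
  have hd : ∀ t ∈ Icc 0 γ.len, HasDerivWithinAt (fun s => (γ.pos s - w) *
      Complex.exp (-∫ t in (0 : ℝ)..s, γ.vel t / (γ.pos t - w))) 0 (Icc 0 γ.len) t := by
    intro t ht
    have h0 : γ.pos t - w ≠ 0 := fun h => hw ⟨t, ht, sub_eq_zero.1 h⟩
    refine (((γ.hasDeriv_pos t ht).sub_const w).mul
      (hasDerivWithinAt_integral hc ht).neg.cexp).congr_deriv ?_
    field_simp
    ring
  have := eq_of_hasDerivWithinAt_zero hd hs
  simp only [intervalIntegral.integral_same, neg_zero, Complex.exp_zero, mul_one] at this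
  rw [← this, mul_assoc, ← Complex.exp_add, neg_add_cancel, Complex.exp_zero, mul_one]

theorem vel_div_pos {s : ℝ} (hs : s ∈ Icc 0 γ.len) :
    (γ.vel s / γ.pos s).im = γ.kap s / (γ.sig s ^ 2 + γ.kap s ^ 2) := by
  rw [Complex.div_im, Complex.normSq_eq_norm_sq, γ.norm_pos_sq hs, kap_eq]
  ring

theorem lift_eq_im (h : (0 : ℂ) ∉ γ.carrier) {s : ℝ} (hs : s ∈ Icc 0 γ.len) :
    γ.lift s = (∫ t in (0 : ℝ)..s, γ.vel t / (γ.pos t - 0)).im := by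
  have hi : IntervalIntegrable (fun t => γ.vel t / (γ.pos t - 0)) MeasureTheory.volume 0 s :=
    ((γ.continuousOn_vel_div h).mono (uIcc_subset_Icc γ.zero_mem hs)).intervalIntegrable
  have := Complex.imCLM.intervalIntegral_comp_comm hi
  simp only [Complex.imCLM_apply] at this
  rw [← this, lift, ang]
  refine intervalIntegral.integral_congr fun t ht => ?_
  have ht' := uIcc_subset_Icc γ.zero_mem hs ht
  simp only [sub_zero]
  rw [γ.vel_div_pos ht']

/-- The unit vector in the direction of `z`. -/
def dir (z : ℂ) : ℂ := z / ‖z‖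

theorem norm_mul_dir (z : ℂ) : (‖z‖ : ℂ) * dir z = z := by
  rcases eq_or_ne z 0 with rfl | h
  · simp
  · have : (‖z‖ : ℂ) ≠ 0 := by simpa using h
    rw [dir, mul_div_cancel₀ _ this]

theorem dir_mul (z w : ℂ) : dir (z * w) = dir z * dir w := by
  rw [dir, dir, dir, norm_mul, Complex.ofReal_mul, mul_div_mul_comm]

theorem dir_exp (z : ℂ) : dir (Complex.exp z) = Complex.exp (z.im * Complex.I) := by
  have h : (Real.exp z.re : ℂ) ≠ 0 := by exact_mod_cast (Real.exp_pos _).ne'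
  rw [dir, Complex.norm_exp, div_eq_iff h, Complex.ofReal_exp, ← Complex.exp_add]
  congr 1
  conv_lhs => rw [← Complex.re_add_im z]
  ring

theorem dir_pos (h : (0 : ℂ) ∉ γ.carrier) {s : ℝ} (hs : s ∈ Icc 0 γ.len) :
    dir (γ.pos s) = dir γ.source * Complex.exp (γ.lift s * Complex.I) := by
  have := γ.pos_sub_eq h hs
  rw [sub_zero, sub_zero] at this
  rw [this, dir_mul, dir_exp, γ.lift_eq_im h hs, source]

theorem zero_notMem_carrier (h : 0 < γ.kap 0) : (0 : ℂ) ∉ γ.carrier := by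
  rintro ⟨s, hs, h0⟩
  exact γ.pos_ne_zero_of_kap_ne (γ.kap_pos h hs).ne' h0

theorem strictMonoOn_lift (h : 0 < γ.kap 0) : StrictMonoOn γ.lift (Icc 0 γ.len) := by
  intro s hs t ht hst
  have hf := γ.flow h
  rw [lift, lift, ← hf.ang_add γ.zero_mem hs ht]
  linarith [hf.ang_pos hs.1 hst ht.2]

theorem hasDeriv_lift (h : 0 < γ.kap 0) {s : ℝ} (hs : s ∈ Icc 0 γ.len) :
    HasDerivWithinAt γ.lift (γ.kap s / (γ.sig s ^ 2 + γ.kap s ^ 2)) (Icc 0 γ.len) s :=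
  hasDerivWithinAt_integral (γ.flow h).continuousOn_integrand hs

theorem continuousOn_lift (h : 0 < γ.kap 0) : ContinuousOn γ.lift (Icc 0 γ.len) :=
  fun _ hs => (γ.hasDeriv_lift h hs).continuousWithinAt

theorem lift_nonneg (h : 0 < γ.kap 0) {s : ℝ} (hs : s ∈ Icc 0 γ.len) : 0 ≤ γ.lift s := by
  have := (γ.strictMonoOn_lift h).monotoneOn γ.zero_mem hs hs.1
  rwa [lift_zero] at this

theorem lift_le_angle (h : 0 < γ.kap 0) {s : ℝ} (hs : s ∈ Icc 0 γ.len) : γ.lift s ≤ γ.angle := by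
  rw [angle_eq]
  exact (γ.strictMonoOn_lift h).monotoneOn hs γ.len_mem hs.2

theorem angle_pos (h : 0 < γ.kap 0) : 0 < γ.angle := by
  have := γ.strictMonoOn_lift h γ.zero_mem γ.len_mem γ.len_pos
  rwa [lift_zero, ← angle_eq] at this

theorem exists_lift_eq (h : 0 < γ.kap 0) {θ : ℝ} (hθ : θ ∈ Icc 0 γ.angle) :
    ∃ s ∈ Icc 0 γ.len, γ.lift s = θ := by
  have := intermediate_value_Icc γ.len_pos.le (γ.continuousOn_lift h)
  rw [lift_zero, ← angle_eq] at this
  exact this hθ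

/-- The distance to the origin is a continuous function of the polar angle. -/
theorem exists_polar (h : 0 < γ.kap 0) : ∃ ρ : ℝ → ℝ, ContinuousOn ρ (Icc 0 γ.angle) ∧
    ∀ s ∈ Icc 0 γ.len, ρ (γ.lift s) = ‖γ.pos s‖ := by
  have hinv : ∀ s ∈ Icc 0 γ.len, invFunOn γ.lift (Icc 0 γ.len) (γ.lift s) = s := fun s hs =>
    (γ.strictMonoOn_lift h).injOn.leftInvOn_invFunOn hs
  have himg : γ.lift '' Icc 0 γ.len = Icc 0 γ.angle := by
    ext θ
    constructor
    · rintro ⟨s, hs, rfl⟩; exact ⟨γ.lift_nonneg h hs, γ.lift_le_angle h hs⟩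
    · intro hθ; obtain ⟨s, hs, e⟩ := γ.exists_lift_eq h hθ; exact ⟨s, hs, e⟩
  have hcont := continuousOn_leftInv_of_isCompact isCompact_Icc (γ.continuousOn_lift h)
    (g := invFunOn γ.lift (Icc 0 γ.len)) hinv
  rw [himg] at hcont
  refine ⟨fun θ => ‖γ.pos (invFunOn γ.lift (Icc 0 γ.len) θ)‖, ?_, fun s hs => ?_⟩
  · refine (γ.continuousOn_pos.comp hcont ?_).norm
    intro θ hθ
    rw [← himg] at hθ
    obtain ⟨s, hs, rfl⟩ := hθ
    rwa [hinv s hs]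
  · simp only [hinv s hs]

/-! ### Reversal of an arc -/

/-- The same arc, traversed backwards. -/
def reverse : Arc where
  len := γ.len
  pos s := γ.pos (γ.len - s)
  vel s := -γ.vel (γ.len - s)
  len_pos := γ.len_pos
  hasDeriv_pos s hs := by
    have hm : MapsTo (fun s => γ.len - s) (Icc 0 γ.len) (Icc 0 γ.len) := fun s hs =>
      ⟨by linarith [hs.2], by linarith [hs.1]⟩
    have := (γ.hasDeriv_pos _ (hm hs)).scomp s
      ((hasDerivAt_id s).const_sub γ.len).hasDerivWithinAt hm
    refine this.congr_deriv ?_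
    simp
  norm_vel s hs := by
    rw [norm_neg]; exact γ.norm_vel _ ⟨by linarith [hs.2], by linarith [hs.1]⟩
  shrinker s hs := by
    have hm : MapsTo (fun s => γ.len - s) (Icc 0 γ.len) (Icc 0 γ.len) := fun s hs =>
      ⟨by linarith [hs.2], by linarith [hs.1]⟩
    have := ((γ.shrinker _ (hm hs)).scomp s
      ((hasDerivAt_id s).const_sub γ.len).hasDerivWithinAt hm).neg
    refine this.congr_deriv ?_
    simp
    ring
  simple := by
    intro s hs t ht e
    have := γ.simple (⟨by linarith [hs.2], by linarith [hs.1]⟩ : γ.len - s ∈ Icc 0 γ.len)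
      (⟨by linarith [ht.2], by linarith [ht.1]⟩ : γ.len - t ∈ Icc 0 γ.len) e
    linarith

theorem kap_reverse (s : ℝ) : γ.reverse.kap s = -γ.kap (γ.len - s) := by
  simp only [kap, reverse, cross, Complex.neg_re, Complex.neg_im]; ring

theorem source_reverse : γ.reverse.source = γ.target := by simp [source, target, reverse]

theorem target_reverse : γ.reverse.target = γ.source := by simp [source, target, reverse]

theorem carrier_reverse : γ.reverse.carrier = γ.carrier := by
  ext z
  constructor
  · rintro ⟨s, hs, rfl⟩
    exact ⟨γ.len - s, ⟨by linarith [hs.2, show γ.reverse.len = γ.len from rfl], by linarith [hs.1]⟩,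
      rfl⟩
  · rintro ⟨s, hs, rfl⟩
    exact ⟨γ.len - s, ⟨by linarith [hs.2], by
      change γ.len - s ≤ γ.len
      linarith [hs.1]⟩, by simp [reverse]⟩

/-- The mirror image of an arc. -/
def conj : Arc where
  len := γ.len
  pos s := (starRingEnd ℂ) (γ.pos s)
  vel s := (starRingEnd ℂ) (γ.vel s)
  len_pos := γ.len_pos
  hasDeriv_pos s hs :=
    Complex.conjCLE.toContinuousLinearMap.hasFDerivAt.comp_hasDerivWithinAt s (γ.hasDeriv_pos s hs)
  norm_vel s hs := by rw [RCLike.norm_conj]; exact γ.norm_vel s hs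
  shrinker s hs := by
    refine (Complex.conjCLE.toContinuousLinearMap.hasFDerivAt.comp_hasDerivWithinAt s
      (γ.shrinker s hs)).congr_deriv ?_
    have : inner ℝ ((starRingEnd ℂ) (γ.pos s)) ((starRingEnd ℂ) (γ.vel s)) =
        inner ℝ (γ.pos s) (γ.vel s) := by
      rw [inner_eq, inner_eq]; simp
    rw [this]
    simp
  simple s hs t ht e := γ.simple hs ht ((starRingEnd ℂ).injective e)

/-- The mirror image of an arc, traversed backwards.  It runs counterclockwise if the arc does. -/
def mirror : Arc := γ.reverse.conj

theorem len_mirror : γ.mirror.len = γ.len := rfl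

theorem norm_pos_mirror (s : ℝ) : ‖γ.mirror.pos s‖ = ‖γ.pos (γ.len - s)‖ := by
  simp [mirror, conj, reverse]

theorem sig_mirror : γ.mirror.sig = fun s => -γ.sig (γ.len - s) := by
  funext s
  simp only [sig_eq, mirror, conj, reverse, Complex.conj_re, Complex.conj_im, Complex.neg_re,
    Complex.neg_im]
  ring

theorem kap_mirror : γ.mirror.kap = fun s => γ.kap (γ.len - s) := by
  funext s
  simp only [kap_eq, mirror, conj, reverse, Complex.conj_re, Complex.conj_im, Complex.neg_re,
    Complex.neg_im]
  ring

theorem lift_mirror (h : 0 < γ.kap 0) {s : ℝ} (hs : s ∈ Icc 0 γ.len) :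
    γ.mirror.lift s = γ.angle - γ.lift (γ.len - s) := by
  have hm : γ.len - s ∈ Icc 0 γ.len := ⟨by linarith [hs.2], by linarith [hs.1]⟩
  rw [lift, sig_mirror, kap_mirror, Flow.ang_reflect, sub_zero, angle_eq, lift, lift,
    ← (γ.flow h).ang_add γ.zero_mem hm γ.len_mem]
  ring

/-! ### The integral of `dz / (z - w)` along an arc -/

/-- The integral of `dz / (z - w)` along an arc. -/
def windInt (w : ℂ) : ℂ := ∫ t in (0 : ℝ)..γ.len, γ.vel t / (γ.pos t - w)

theorem target_sub_eq {w : ℂ} (hw : w ∉ γ.carrier) :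
    γ.target - w = (γ.source - w) * Complex.exp (γ.windInt w) := γ.pos_sub_eq hw γ.len_mem

theorem im_windInt_zero (h : (0 : ℂ) ∉ γ.carrier) : (γ.windInt 0).im = γ.angle := by
  rw [angle_eq, γ.lift_eq_im h γ.len_mem, windInt]

theorem isCompact_carrier : IsCompact γ.carrier :=
  isCompact_Icc.image_of_continuousOn γ.continuousOn_pos

theorem norm_windInt_le {w : ℂ} {d : ℝ} (hd : 0 < d) (hw : ∀ z ∈ γ.carrier, d ≤ ‖z - w‖) :
    ‖γ.windInt w‖ ≤ γ.len / d := by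
  have := intervalIntegral.norm_integral_le_of_norm_le_const (a := 0) (b := γ.len) (C := 1 / d)
    (f := fun t => γ.vel t / (γ.pos t - w)) fun t ht => by
      rw [uIoc_of_le γ.len_pos.le] at ht
      have ht := Ioc_subset_Icc_self ht
      have h1 := hw _ ⟨t, ht, rfl⟩
      rw [norm_div, γ.norm_vel t ht]
      gcongr
  rw [sub_zero, abs_of_pos γ.len_pos] at this
  rw [windInt]
  refine this.trans (le_of_eq ?_)
  ring

theorem continuousAt_windInt {w : ℂ} (hw : w ∉ γ.carrier) : ContinuousAt γ.windInt w := by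
  have hcl := γ.isCompact_carrier.isClosed
  obtain ⟨ε, hε, hb⟩ := Metric.isOpen_iff.1 hcl.isOpen_compl w hw
  have hnear : ∀ᶠ v in 𝓝 w, dist v w < ε / 2 := Metric.ball_mem_nhds w (by linarith)
  have hfar : ∀ v, dist v w < ε / 2 → ∀ z ∈ γ.carrier, ε / 2 ≤ ‖z - v‖ := by
    intro v hv z hz
    have : ε ≤ dist z w := by
      by_contra! h
      exact hb (Metric.mem_ball.2 h) hz
    have h2 := dist_triangle z v w
    rw [← dist_eq_norm]
    linarith
  refine intervalIntegral.continuousAt_of_dominated_interval (bound := fun _ => 1 / (ε / 2)) ?_ ?_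
    (by simp) ?_
  · filter_upwards [hnear] with v hv
    have hvc : v ∉ γ.carrier := fun hvc => by
      have := hfar v hv v hvc
      rw [sub_self, norm_zero] at this
      linarith
    have := (γ.continuousOn_vel_div hvc).aestronglyMeasurable measurableSet_Icc
      (μ := MeasureTheory.volume)
    refine this.mono_measure (MeasureTheory.Measure.restrict_mono ?_ le_rfl)
    rw [uIoc_of_le γ.len_pos.le]
    exact Ioc_subset_Icc_self
  · filter_upwards [hnear] with v hv
    refine Eventually.of_forall fun t ht => ?_
    rw [uIoc_of_le γ.len_pos.le] at ht
    have ht := Ioc_subset_Icc_self ht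
    rw [norm_div, γ.norm_vel t ht]
    have := hfar v hv _ ⟨t, ht, rfl⟩
    gcongr
  · refine Eventually.of_forall fun t ht => ?_
    rw [uIoc_of_le γ.len_pos.le] at ht
    have ht := Ioc_subset_Icc_self ht
    refine continuousAt_const.div (continuousAt_const.sub continuousAt_id) fun h => ?_
    exact hw ⟨t, ht, sub_eq_zero.1 h⟩

end Arc

/-! ### Paths of counterclockwise arcs -/

/-- The change of the polar angle along the first `i` arcs of a sequence. -/
def cumAngle (f : ℕ → Arc) (i : ℕ) : ℝ := ∑ j ∈ Finset.range i, (f j).angle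

/-- The change of the polar angle up to the parameter `s` of the arc `i`. -/
def polarAngle (f : ℕ → Arc) (i : ℕ) (s : ℝ) : ℝ := cumAngle f i + (f i).lift s

theorem cumAngle_zero (f : ℕ → Arc) : cumAngle f 0 = 0 := by simp [cumAngle]

theorem cumAngle_succ (f : ℕ → Arc) (i : ℕ) :
    cumAngle f (i + 1) = cumAngle f i + (f i).angle := by
  simp [cumAngle, Finset.sum_range_succ]

theorem polarAngle_zero (f : ℕ → Arc) (i : ℕ) : polarAngle f i 0 = cumAngle f i := by
  rw [polarAngle, Arc.lift_zero, add_zero]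

theorem polarAngle_len (f : ℕ → Arc) (i : ℕ) : polarAngle f i (f i).len = cumAngle f (i + 1) := by
  rw [polarAngle, ← Arc.angle_eq, cumAngle_succ]

/-- The integral of `dz / (z - w)` along consecutive arcs. -/
theorem target_sub_eq_mul_exp_sum {f : ℕ → Arc} {m : ℕ}
    (hj : ∀ i < m, (f i).target = (f (i + 1)).source) {w : ℂ} (hw : ∀ i ≤ m, w ∉ (f i).carrier) :
    (f m).target - w =
      ((f 0).source - w) * Complex.exp (∑ i ∈ Finset.range (m + 1), (f i).windInt w) := by
  induction m with
  | zero => simpa using (f 0).target_sub_eq (hw 0 le_rfl)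
  | succ m ih =>
    rw [Finset.sum_range_succ, Complex.exp_add, ← mul_assoc,
      ← ih (fun i hi => hj i (by omega)) (fun i hi => hw i (by omega)), hj m (by omega)]
    exact (f (m + 1)).target_sub_eq (hw _ le_rfl)

/-- Consecutive arcs that run counterclockwise around the origin. -/
structure CcwPath (f : ℕ → Arc) (m : ℕ) : Prop where
  kap_pos : ∀ i ≤ m, 0 < (f i).kap 0
  target_eq : ∀ i < m, (f i).target = (f (i + 1)).source

namespace CcwPath

variable {f : ℕ → Arc} {m : ℕ}

theorem mono (h : CcwPath f m) {n : ℕ} (hn : n ≤ m) : CcwPath f n :=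
  ⟨fun i hi => h.kap_pos i (hi.trans hn), fun i hi => h.target_eq i (hi.trans_le hn)⟩

theorem cumAngle_le (h : CcwPath f m) {i j : ℕ} (hij : i ≤ j) (hj : j ≤ m + 1) :
    cumAngle f i ≤ cumAngle f j := by
  refine Finset.sum_le_sum_of_subset_of_nonneg (Finset.range_mono hij) fun k hk _ => ?_
  rw [Finset.mem_range] at hk
  exact ((f k).angle_pos (h.kap_pos k (by omega))).le

theorem cumAngle_nonneg (h : CcwPath f m) {i : ℕ} (hi : i ≤ m + 1) : 0 ≤ cumAngle f i := by
  rw [← cumAngle_zero f]; exact h.cumAngle_le (Nat.zero_le _) hi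

theorem cumAngle_pos (h : CcwPath f m) {i : ℕ} (h0 : 0 < i) (hi : i ≤ m + 1) :
    0 < cumAngle f i := by
  obtain ⟨j, rfl⟩ : ∃ j, i = j + 1 := ⟨i - 1, by omega⟩
  rw [cumAngle_succ]
  have := h.cumAngle_nonneg (i := j) (by omega)
  have := (f j).angle_pos (h.kap_pos j (by omega))
  linarith

theorem cumAngle_lt (h : CcwPath f m) {i : ℕ} (hi : i < m + 1) :
    cumAngle f i < cumAngle f (m + 1) := by
  have h1 := h.cumAngle_le (i := i + 1) (j := m + 1) (by omega) le_rfl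
  rw [cumAngle_succ] at h1
  have := (f i).angle_pos (h.kap_pos i (by omega))
  linarith

theorem polarAngle_mem (h : CcwPath f m) {i : ℕ} (hi : i ≤ m) {s : ℝ} (hs : s ∈ Icc 0 (f i).len) :
    polarAngle f i s ∈ Icc 0 (cumAngle f (m + 1)) := by
  have h1 := (f i).lift_nonneg (h.kap_pos i hi) hs
  have h2 := (f i).lift_le_angle (h.kap_pos i hi) hs
  have h3 := h.cumAngle_nonneg (i := i) (by omega)
  have h4 := h.cumAngle_le (i := i + 1) (j := m + 1) (by omega) le_rfl
  rw [cumAngle_succ] at h4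
  constructor <;> rw [polarAngle] <;> linarith

theorem dir_pos (h : CcwPath f m) {i : ℕ} (hi : i ≤ m) {s : ℝ} (hs : s ∈ Icc 0 (f i).len) :
    Arc.dir ((f i).pos s) = Arc.dir (f 0).source * Complex.exp (polarAngle f i s * Complex.I) := by
  induction i generalizing s with
  | zero =>
    rw [(f 0).dir_pos ((f 0).zero_notMem_carrier (h.kap_pos 0 hi)) hs, polarAngle, cumAngle_zero,
      zero_add]
  | succ i ih =>
    have h1 := ih (by omega) (f i).len_mem
    rw [polarAngle_len] at h1
    rw [(f (i + 1)).dir_pos ((f (i + 1)).zero_notMem_carrier (h.kap_pos _ hi)) hs,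
      ← h.target_eq i (by omega), Arc.target, h1, mul_assoc, ← Complex.exp_add, polarAngle]
    congr 2
    push_cast
    ring

theorem exists_polarAngle_eq (h : CcwPath f m) {θ : ℝ} (hθ : θ ∈ Ico 0 (cumAngle f (m + 1))) :
    ∃ i ≤ m, ∃ s ∈ Ico 0 (f i).len, polarAngle f i s = θ := by
  induction m with
  | zero =>
    rw [cumAngle_succ, cumAngle_zero, zero_add] at hθ
    obtain ⟨s, hs, e⟩ := (f 0).exists_lift_eq (h.kap_pos 0 le_rfl) ⟨hθ.1, hθ.2.le⟩
    refine ⟨0, le_rfl, s, ⟨hs.1, lt_of_le_of_ne hs.2 fun e2 => ?_⟩, ?_⟩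
    · rw [e2, ← Arc.angle_eq] at e; linarith [hθ.2]
    · rw [polarAngle, cumAngle_zero, zero_add, e]
  | succ m ih =>
    rcases lt_or_ge θ (cumAngle f (m + 1)) with hlt | hge
    · obtain ⟨i, hi, s, hs, e⟩ := ih (h.mono (by omega)) ⟨hθ.1, hlt⟩
      exact ⟨i, by omega, s, hs, e⟩
    · have h2 := hθ.2
      rw [cumAngle_succ] at h2
      obtain ⟨s, hs, e⟩ := (f (m + 1)).exists_lift_eq (h.kap_pos _ le_rfl)
        (θ := θ - cumAngle f (m + 1)) ⟨by linarith, by linarith⟩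
      refine ⟨m + 1, le_rfl, s, ⟨hs.1, lt_of_le_of_ne hs.2 fun e2 => ?_⟩, ?_⟩
      · rw [e2, ← Arc.angle_eq] at e; linarith
      · rw [polarAngle, e]; ring

/-- The distance to the origin is a continuous function of the polar angle. -/
theorem exists_polar (h : CcwPath f m) :
    ∃ ρ : ℝ → ℝ, ContinuousOn ρ (Icc 0 (cumAngle f (m + 1))) ∧
      ∀ i ≤ m, ∀ s ∈ Icc 0 (f i).len, ρ (polarAngle f i s) = ‖(f i).pos s‖ := by
  induction m with
  | zero =>
    obtain ⟨ρ, h1, h2⟩ := (f 0).exists_polar (h.kap_pos 0 le_rfl)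
    refine ⟨ρ, by rwa [cumAngle_succ, cumAngle_zero, zero_add], fun i hi s hs => ?_⟩
    obtain rfl : i = 0 := by omega
    rw [polarAngle, cumAngle_zero, zero_add]
    exact h2 s hs
  | succ m ih =>
    have hm := h.mono (Nat.le_succ m)
    obtain ⟨ρ, h1, h2⟩ := ih hm
    have hκ := h.kap_pos (m + 1) le_rfl
    obtain ⟨ρ', h1', h2'⟩ := (f (m + 1)).exists_polar hκ
    set T := cumAngle f (m + 1) with hT
    have hT0 : 0 ≤ T := hm.cumAngle_nonneg le_rfl
    have ha := (f (m + 1)).angle_pos hκ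
    have hmatch : ρ T = ρ' 0 := by
      have e1 := h2 m le_rfl _ (f m).len_mem
      have e2 := h2' 0 (f (m + 1)).zero_mem
      rw [polarAngle_len] at e1
      rw [Arc.lift_zero] at e2
      rw [hT, e1, e2]
      exact congrArg _ (h.target_eq m (by omega))
    refine ⟨fun θ => if θ ≤ T then ρ θ else ρ' (θ - T), ?_, ?_⟩
    · have hc1 : ContinuousOn (fun θ => if θ ≤ T then ρ θ else ρ' (θ - T)) (Icc 0 T) :=
        h1.congr fun θ hθ => if_pos hθ.2
      have hc2 : ContinuousOn (fun θ => if θ ≤ T then ρ θ else ρ' (θ - T))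
          (Icc T (T + (f (m + 1)).angle)) := by
        have : ContinuousOn (fun θ => ρ' (θ - T)) (Icc T (T + (f (m + 1)).angle)) :=
          h1'.comp (by fun_prop) fun θ hθ => ⟨by linarith [hθ.1], by linarith [hθ.2]⟩
        refine this.congr fun θ hθ => ?_
        rcases eq_or_lt_of_le hθ.1 with e | e
        · rw [← e]; simp [hmatch]
        · exact if_neg (not_le.2 e)
      have := hc1.union_of_isClosed hc2 isClosed_Icc isClosed_Icc
      rwa [Icc_union_Icc_eq_Icc hT0 (by linarith), hT, ← cumAngle_succ] at this
    · intro i hi s hs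
      beta_reduce
      rcases Nat.lt_or_ge m i with hi' | hi'
      · obtain rfl : i = m + 1 := by omega
        have hl := (f (m + 1)).lift_nonneg hκ hs
        have e : polarAngle f (m + 1) s - T = (f (m + 1)).lift s := by rw [polarAngle, ← hT]; ring
        rcases eq_or_lt_of_le hl with e0 | e0
        · have e1 : polarAngle f (m + 1) s = T := by rw [polarAngle, ← hT, ← e0, add_zero]
          rw [e1, if_pos le_rfl, hmatch, e0]
          exact h2' s hs
        · have e1 : T < polarAngle f (m + 1) s := by rw [polarAngle, ← hT]; linarith
          rw [if_neg (not_le.2 e1), e]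
          exact h2' s hs
      · have := (hm.polarAngle_mem hi' hs).2
        rw [if_pos this]
        exact h2 i hi' s hs

end CcwPath

/-! ### Simple closed counterclockwise curves -/

/-- A simple closed curve that consists of arcs running counterclockwise around the origin. -/
structure CcwLoop (f : ℕ → Arc) (m : ℕ) : Prop extends CcwPath f m where
  closed : (f m).target = (f 0).source
  inj : ∀ i ≤ m, ∀ j ≤ m, ∀ s ∈ Ico 0 (f i).len, ∀ t ∈ Ico 0 (f j).len,
    (f i).pos s = (f j).pos t → i = j ∧ s = t

namespace CcwLoop

variable {f : ℕ → Arc} {m : ℕ}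

theorem dir_source_ne_zero (h : CcwLoop f m) : Arc.dir (f 0).source ≠ 0 := by
  have h0 : (f 0).source ≠ 0 := (f 0).pos_ne_zero_of_kap_ne (h.kap_pos 0 (Nat.zero_le _)).ne'
  rw [Arc.dir]
  exact div_ne_zero h0 (by simpa using h0)

/-- A simple closed curve goes around the origin only once: otherwise the radius, as a function of
the polar angle, would take the same value at two angles that differ by `2π`. -/
theorem cumAngle_eq_two_pi (h : CcwLoop f m) : cumAngle f (m + 1) = 2 * Real.pi := by
  obtain ⟨ρ, hρ, hval⟩ := h.toCcwPath.exists_polar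
  have hpi := Real.pi_pos
  set Θ := cumAngle f (m + 1) with hΘ
  have hΘ0 : 0 < Θ := h.toCcwPath.cumAngle_pos (Nat.succ_pos m) le_rfl
  have hd0 := h.dir_source_ne_zero
  -- the total change of the angle is a multiple of `2π`
  obtain ⟨k, hk⟩ : ∃ k : ℕ, Θ = k * (2 * Real.pi) := by
    have h1 := h.toCcwPath.dir_pos le_rfl (f m).len_mem
    rw [polarAngle_len, ← hΘ, ← Arc.target, h.closed] at h1
    have h2 : Complex.exp (Θ * Complex.I) = 1 := by
      have h3 := mul_left_cancel₀ hd0 ((mul_one _).trans h1)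
      exact h3.symm
    obtain ⟨n, hn⟩ := Complex.exp_eq_one_iff.1 h2
    have hn' : Θ = n * (2 * Real.pi) := by
      have := congrArg Complex.im hn
      simpa using this
    have hn0 : 0 < n := by
      by_contra! hneg
      have : (n : ℝ) ≤ 0 := by exact_mod_cast hneg
      nlinarith
    obtain ⟨k, rfl⟩ := Int.eq_ofNat_of_zero_le hn0.le
    exact ⟨k, by simpa using hn'⟩
  have hinj : ∀ θ ∈ Ico 0 Θ, ∀ θ' ∈ Ico 0 Θ, ρ θ = ρ θ' →
      Complex.exp (θ * Complex.I) = Complex.exp (θ' * Complex.I) → θ = θ' := by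
    intro θ hθ θ' hθ' e1 e2
    obtain ⟨i, hi, s, hs, rfl⟩ := h.toCcwPath.exists_polarAngle_eq hθ
    obtain ⟨j, hj, t, ht, rfl⟩ := h.toCcwPath.exists_polarAngle_eq hθ'
    have p1 := h.toCcwPath.dir_pos hi (Ico_subset_Icc_self hs)
    have p2 := h.toCcwPath.dir_pos hj (Ico_subset_Icc_self ht)
    rw [hval i hi s (Ico_subset_Icc_self hs), hval j hj t (Ico_subset_Icc_self ht)] at e1
    have : (f i).pos s = (f j).pos t := by
      rw [← Arc.norm_mul_dir ((f i).pos s), ← Arc.norm_mul_dir ((f j).pos t), p1, p2, e1, e2]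
    obtain ⟨rfl, rfl⟩ := h.inj i hi j hj s hs t ht this
    rfl
  have hclosed : ρ Θ = ρ 0 := by
    have e1 := hval m le_rfl _ (f m).len_mem
    have e2 := hval 0 (Nat.zero_le _) _ (f 0).zero_mem
    rw [polarAngle_len] at e1
    rw [polarAngle_zero, cumAngle_zero] at e2
    rw [hΘ, e1, e2]
    exact congrArg _ h.closed
  have hk0 : k ≠ 0 := by rintro rfl; simp at hk; linarith
  by_contra hne
  have hk2 : 2 ≤ k := by
    by_contra! hk2
    obtain rfl : k = 1 := by omega
    exact hne (by simpa using hk)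
  have hk2' : (2 : ℝ) ≤ k := by exact_mod_cast hk2
  have hΘ2 : 0 < Θ - 2 * Real.pi := by nlinarith
  set g : ℝ → ℝ := fun θ => ρ (θ + 2 * Real.pi) - ρ θ with hg
  have hgc : ContinuousOn g (Icc 0 (Θ - 2 * Real.pi)) := by
    refine (hρ.comp (by fun_prop) fun θ hθ => ?_).sub (hρ.mono fun θ hθ => ?_)
    · exact ⟨by linarith [hθ.1], by linarith [hθ.2]⟩
    · exact ⟨hθ.1, by linarith [hθ.2]⟩
  have hexp : ∀ θ : ℝ, Complex.exp (((θ + 2 * Real.pi : ℝ) : ℂ) * Complex.I) =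
      Complex.exp (θ * Complex.I) := by
    intro θ
    have := Complex.exp_periodic (θ * Complex.I)
    rw [← this]
    congr 1
    push_cast
    ring
  have hgne : ∀ θ ∈ Icc 0 (Θ - 2 * Real.pi), g θ ≠ 0 := by
    intro θ hθ h0
    have h0 : ρ (θ + 2 * Real.pi) = ρ θ := sub_eq_zero.1 h0
    rcases eq_or_lt_of_le hθ.2 with e | e
    · have e2 : θ + 2 * Real.pi = Θ := by rw [e]; ring
      have : θ = 0 := by
        refine hinj θ ⟨hθ.1, by linarith⟩ 0 ⟨le_rfl, hΘ0⟩ ?_ ?_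
        · rw [← h0, e2, hclosed]
        · rw [← hexp, e2, hk]
          rw [Complex.exp_eq_exp_iff_exists_int]
          exact ⟨k, by push_cast; ring⟩
      linarith
    · have := hinj (θ + 2 * Real.pi) ⟨by linarith [hθ.1], by linarith⟩ θ
        ⟨hθ.1, by linarith⟩ h0 (hexp θ)
      linarith
  -- the sum of `g` over the multiples of `2π` vanishes
  have hsum : ∑ j ∈ Finset.range k, g (j * (2 * Real.pi)) = 0 := by
    have : ∀ j : ℕ, g (j * (2 * Real.pi)) =
        ρ ((j + 1 : ℕ) * (2 * Real.pi)) - ρ (j * (2 * Real.pi)) := by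
      intro j
      simp only [hg]
      push_cast
      congr 2
      ring
    simp only [this]
    rw [Finset.sum_range_sub (fun j : ℕ => ρ (j * (2 * Real.pi))), ← hk, hclosed]
    simp
  have hmem : ∀ j ∈ Finset.range k, (j * (2 * Real.pi) : ℝ) ∈ Icc 0 (Θ - 2 * Real.pi) := by
    intro j hj
    have : (j : ℝ) + 1 ≤ k := by exact_mod_cast Finset.mem_range.1 hj
    exact ⟨by positivity, by nlinarith⟩
  have h0mem : (0 : ℝ) ∈ Icc 0 (Θ - 2 * Real.pi) := ⟨le_rfl, hΘ2.le⟩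
  have hnonempty : (Finset.range k).Nonempty := ⟨0, Finset.mem_range.2 (by omega)⟩
  rcases lt_or_gt_of_ne (hgne 0 h0mem) with hs | hs
  · have : ∀ θ ∈ Icc 0 (Θ - 2 * Real.pi), g θ < 0 := by
      intro θ hθ
      by_contra! hpos
      obtain ⟨t, ht, ht0⟩ := intermediate_value_Icc hθ.1
        (hgc.mono (Icc_subset_Icc_right hθ.2)) ⟨hs.le, hpos⟩
      exact hgne t ⟨ht.1, ht.2.trans hθ.2⟩ ht0
    exact absurd hsum (Finset.sum_neg (fun j hj => this _ (hmem j hj)) hnonempty).ne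
  · have : ∀ θ ∈ Icc 0 (Θ - 2 * Real.pi), 0 < g θ := by
      intro θ hθ
      by_contra! hneg
      obtain ⟨t, ht, ht0⟩ := intermediate_value_Icc' hθ.1
        (hgc.mono (Icc_subset_Icc_right hθ.2)) ⟨hneg, hs.le⟩
      exact hgne t ⟨ht.1, ht.2.trans hθ.2⟩ ht0
    exact absurd hsum (Finset.sum_pos (fun j hj => this _ (hmem j hj)) hnonempty).ne'

theorem exists_half_open (h : CcwLoop f m) {i : ℕ} (hi : i ≤ m) {s : ℝ}
    (hs : s ∈ Icc 0 (f i).len) :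
    ∃ j ≤ m, ∃ t ∈ Ico 0 (f j).len, (f j).pos t = (f i).pos s := by
  rcases lt_or_eq_of_le hs.2 with e | e
  · exact ⟨i, hi, s, ⟨hs.1, e⟩, rfl⟩
  · rcases Nat.lt_or_ge i m with hlt | hge
    · exact ⟨i + 1, hlt, 0, ⟨le_rfl, (f (i + 1)).len_pos⟩, by
        rw [e]; exact (h.target_eq i hlt).symm⟩
    · obtain rfl : i = m := by omega
      exact ⟨0, Nat.zero_le _, 0, ⟨le_rfl, (f 0).len_pos⟩, by rw [e]; exact h.closed.symm⟩

/-- A simple closed counterclockwise curve meets every half-line from the origin only once. -/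
theorem eq_of_dir_eq (h : CcwLoop f m) {i j : ℕ} (hi : i ≤ m) (hj : j ≤ m) {s t : ℝ}
    (hs : s ∈ Icc 0 (f i).len) (ht : t ∈ Icc 0 (f j).len)
    (e : Arc.dir ((f i).pos s) = Arc.dir ((f j).pos t)) : (f i).pos s = (f j).pos t := by
  obtain ⟨i', hi', s', hs', es⟩ := h.exists_half_open hi hs
  obtain ⟨j', hj', t', ht', et⟩ := h.exists_half_open hj ht
  rw [← es, ← et] at e ⊢
  have hhalf : ∀ i ≤ m, ∀ s ∈ Ico 0 (f i).len, polarAngle f i s < 2 * Real.pi := by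
    intro i hi s hs
    rw [← h.cumAngle_eq_two_pi]
    have h1 := h.toCcwPath.cumAngle_le (i := i + 1) (j := m + 1) (by omega) le_rfl
    refine lt_of_lt_of_le ?_ h1
    rw [← polarAngle_len, polarAngle, polarAngle]
    have := (f i).strictMonoOn_lift (h.kap_pos i hi) (Ico_subset_Icc_self hs) (f i).len_mem hs.2
    linarith
  rw [h.toCcwPath.dir_pos hi' (Ico_subset_Icc_self hs'),
    h.toCcwPath.dir_pos hj' (Ico_subset_Icc_self ht')] at e
  have e := mul_left_cancel₀ h.dir_source_ne_zero e
  have hpi := Real.pi_pos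
  have a1 := (h.toCcwPath.polarAngle_mem hi' (Ico_subset_Icc_self hs')).1
  have a2 := hhalf i' hi' s' hs'
  have b1 := (h.toCcwPath.polarAngle_mem hj' (Ico_subset_Icc_self ht')).1
  have b2 := hhalf j' hj' t' ht'
  obtain ⟨n, hn⟩ := Complex.exp_eq_exp_iff_exists_int.1 e
  have hn : polarAngle f i' s' = polarAngle f j' t' + n * (2 * Real.pi) := by
    have := congrArg Complex.im hn
    simpa using this
  have hn0 : n = 0 := by
    have l1 : (n : ℝ) < 1 := by nlinarith
    have l2 : (-1 : ℝ) < n := by nlinarith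
    have l1' : n < 1 := by exact_mod_cast l1
    have l2' : -1 < n := by exact_mod_cast l2
    omega
  rw [hn0] at hn
  have hn : polarAngle f i' s' = polarAngle f j' t' := by simpa using hn
  obtain ⟨ρ, -, hval⟩ := h.toCcwPath.exists_polar
  have n1 := hval i' hi' s' (Ico_subset_Icc_self hs')
  have n2 := hval j' hj' t' (Ico_subset_Icc_self ht')
  rw [← Arc.norm_mul_dir ((f i').pos s'), ← Arc.norm_mul_dir ((f j').pos t'), ← n1, ← n2,
    h.toCcwPath.dir_pos hi' (Ico_subset_Icc_self hs'),
    h.toCcwPath.dir_pos hj' (Ico_subset_Icc_self ht'), hn]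

end CcwLoop

/-! ### Comparison of two arcs with a common initial point -/

/-- With respect to the polar angle, `log R²` has the slope `2σ / κ` at the initial point. -/
theorem Arc.eventually_log_lt (γ : Arc) (h : 0 < γ.kap 0) {x : ℝ} (hx : γ.sig 0 < x * γ.kap 0) :
    ∀ᶠ s in 𝓝[>] (0 : ℝ),
      Real.log (γ.sig s ^ 2 + γ.kap s ^ 2) - Real.log (γ.sig 0 ^ 2 + γ.kap 0 ^ 2) <
        2 * x * γ.lift s := by
  have hf := γ.flow h
  have hp := hf.sq_pos γ.zero_mem
  have hd := (((hf.hasDeriv_fst 0 γ.zero_mem).pow 2).add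
    ((hf.hasDeriv_snd 0 γ.zero_mem).pow 2)).log hp.ne'
  have hd2 := ((γ.hasDeriv_lift h γ.zero_mem).const_mul (2 * x)).sub
    (hd.sub_const (Real.log (γ.sig 0 ^ 2 + γ.kap 0 ^ 2)))
  have := eventually_pos_of_hasDerivWithinAt γ.len_pos hd2 ?_ (by simp [γ.lift_zero])
  · filter_upwards [this] with s hs
    simpa using hs
  · have e : 2 * x * (γ.kap 0 / (γ.sig 0 ^ 2 + γ.kap 0 ^ 2)) -
        (2 * γ.sig 0 * (1 - γ.kap 0 ^ 2) + 2 * γ.kap 0 * (γ.sig 0 * γ.kap 0)) /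
          (γ.sig 0 ^ 2 + γ.kap 0 ^ 2) =
        2 * (x * γ.kap 0 - γ.sig 0) / (γ.sig 0 ^ 2 + γ.kap 0 ^ 2) := by
      field_simp
      ring
    have : 0 < 2 * (x * γ.kap 0 - γ.sig 0) / (γ.sig 0 ^ 2 + γ.kap 0 ^ 2) :=
      div_pos (by linarith) hp
    rw [← e] at this
    simpa using this

theorem Arc.eventually_lt_log (γ : Arc) (h : 0 < γ.kap 0) {x : ℝ} (hx : x * γ.kap 0 < γ.sig 0) :
    ∀ᶠ s in 𝓝[>] (0 : ℝ), 2 * x * γ.lift s <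
      Real.log (γ.sig s ^ 2 + γ.kap s ^ 2) - Real.log (γ.sig 0 ^ 2 + γ.kap 0 ^ 2) := by
  have hf := γ.flow h
  have hp := hf.sq_pos γ.zero_mem
  have hd := (((hf.hasDeriv_fst 0 γ.zero_mem).pow 2).add
    ((hf.hasDeriv_snd 0 γ.zero_mem).pow 2)).log hp.ne'
  have hd2 := (hd.sub_const (Real.log (γ.sig 0 ^ 2 + γ.kap 0 ^ 2))).sub
    ((γ.hasDeriv_lift h γ.zero_mem).const_mul (2 * x))
  have := eventually_pos_of_hasDerivWithinAt γ.len_pos hd2 ?_ (by simp [γ.lift_zero])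
  · filter_upwards [this] with s hs
    simpa using hs
  · have e : (2 * γ.sig 0 * (1 - γ.kap 0 ^ 2) + 2 * γ.kap 0 * (γ.sig 0 * γ.kap 0)) /
          (γ.sig 0 ^ 2 + γ.kap 0 ^ 2) - 2 * x * (γ.kap 0 / (γ.sig 0 ^ 2 + γ.kap 0 ^ 2)) =
        2 * (γ.sig 0 - x * γ.kap 0) / (γ.sig 0 ^ 2 + γ.kap 0 ^ 2) := by
      field_simp
      ring
    have : 0 < 2 * (γ.sig 0 - x * γ.kap 0) / (γ.sig 0 ^ 2 + γ.kap 0 ^ 2) :=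
      div_pos (by linarith) hp
    rw [← e] at this
    simpa using this

/-- If an arc stays below another one with the same initial point, as functions of the polar
angle, then its initial slope is not larger. -/
theorem Arc.sig_mul_kap_le (γ δ : Arc) (hγ : 0 < γ.kap 0) (hδ : 0 < δ.kap 0)
    (h0 : ‖γ.pos 0‖ = ‖δ.pos 0‖)
    (hlt : ∀ s ∈ Ioo 0 γ.len, ∀ t ∈ Ioo 0 δ.len, γ.lift s = δ.lift t → ‖γ.pos s‖ < ‖δ.pos t‖) :
    γ.sig 0 * δ.kap 0 ≤ δ.sig 0 * γ.kap 0 := by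
  by_contra! hcon
  have hslope : δ.sig 0 / δ.kap 0 < γ.sig 0 / γ.kap 0 := by
    rw [div_lt_div_iff₀ hδ hγ]; exact hcon
  obtain ⟨x, hx1, hx2⟩ := exists_between hslope
  rw [div_lt_iff₀ hδ] at hx1
  rw [lt_div_iff₀ hγ] at hx2
  obtain ⟨u, hu, hu2⟩ := mem_nhdsGT_iff_exists_Ioo_subset.1 (δ.eventually_log_lt hδ hx1)
  obtain ⟨v, hv, hv2⟩ := mem_nhdsGT_iff_exists_Ioo_subset.1 (γ.eventually_lt_log hγ hx2)
  have hu : 0 < u := hu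
  have hv : 0 < v := hv
  -- a common small polar angle
  have key : ∀ (α : Arc) (w : ℝ), 0 < α.kap 0 → 0 < w → ∃ η > 0, ∀ θ ∈ Ioo 0 η,
      ∃ s ∈ Ioo 0 α.len, s < w ∧ α.lift s = θ := by
    intro α w hα hw
    have hmm : min w α.len ∈ Icc 0 α.len :=
      ⟨le_min hw.le α.len_pos.le, min_le_right _ _⟩
    have hpos : 0 < min w α.len := lt_min hw α.len_pos
    refine ⟨α.lift (min w α.len), ?_, fun θ hθ => ?_⟩
    · have := α.strictMonoOn_lift hα α.zero_mem hmm hpos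
      rwa [α.lift_zero] at this
    · have hc := (α.continuousOn_lift hα).mono (Icc_subset_Icc_right hmm.2)
      have := intermediate_value_Ioo hpos.le hc
      rw [α.lift_zero] at this
      obtain ⟨s, hs, e⟩ := this hθ
      exact ⟨s, ⟨hs.1, hs.2.trans_le (min_le_right _ _)⟩, hs.2.trans_le (min_le_left _ _), e⟩
  obtain ⟨η, hη, hη2⟩ := key γ v hγ hv
  obtain ⟨η', hη', hη2'⟩ := key δ u hδ hu
  have hmin : 0 < min η η' := lt_min hη hη'
  obtain ⟨s, hs, hsv, es⟩ := hη2 (min η η' / 2)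
    ⟨by linarith, by linarith [min_le_left η η']⟩
  obtain ⟨t, ht, htu, et⟩ := hη2' (min η η' / 2)
    ⟨by linarith, by linarith [min_le_right η η']⟩
  have l1 : 2 * x * γ.lift s < _ := hv2 ⟨hs.1, hsv⟩
  have l2 : _ < 2 * x * δ.lift t := hu2 ⟨ht.1, htu⟩
  rw [← γ.norm_pos_sq (Ioo_subset_Icc_self hs), ← γ.norm_pos_sq γ.zero_mem, es] at l1
  rw [← δ.norm_pos_sq (Ioo_subset_Icc_self ht), ← δ.norm_pos_sq δ.zero_mem, et, ← h0] at l2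
  have hγ0 : 0 < ‖γ.pos s‖ :=
    norm_pos_iff.2 (γ.pos_ne_zero_of_kap_ne (γ.kap_pos hγ (Ioo_subset_Icc_self hs)).ne')
  have hlog : Real.log (‖γ.pos s‖ ^ 2) ≤ Real.log (‖δ.pos t‖ ^ 2) := by
    have := hlt s hs t ht (es.trans et.symm)
    gcongr
  linarith

/-! ### Outer curves -/

namespace Chain

variable (Γ : Chain)

/-- The arcs of a chain, indexed by the natural numbers (constant after the last one). -/
def arcN (i : ℕ) : Arc := Γ.arc ⟨min i Γ.numRays, by omega⟩

theorem arcN_eq {i : ℕ} (hi : i < Γ.numRays + 1) : Γ.arcN i = Γ.arc ⟨i, hi⟩ := by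
  rw [arcN]; congr 2; omega

theorem first_eq : Γ.first = Γ.arcN 0 := (Γ.arcN_eq (Nat.succ_pos _)).symm

theorem last_eq : Γ.last = Γ.arcN Γ.numRays := (Γ.arcN_eq (Nat.lt_succ_self _)).symm

theorem target_arcN {i : ℕ} (hi : i < Γ.numRays) :
    (Γ.arcN i).target = (Γ.ray ⟨i, hi⟩).base := by
  rw [Γ.arcN_eq (by omega)]; exact Γ.target_eq ⟨i, hi⟩

theorem source_arcN {i : ℕ} (hi : i < Γ.numRays) :
    (Γ.arcN (i + 1)).source = (Γ.ray ⟨i, hi⟩).base := by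
  rw [Γ.arcN_eq (by omega)]; exact Γ.source_eq ⟨i, hi⟩

theorem vel_arcN_succ {i : ℕ} (hi : i < Γ.numRays) :
    (Γ.arcN (i + 1)).vel 0 = (Γ.arcN i).vel (Γ.arcN i).len - (Γ.ray ⟨i, hi⟩).dir := by
  rw [Γ.arcN_eq (i := i + 1) (by omega), Γ.arcN_eq (i := i) (by omega)]
  have := Γ.herring ⟨i, hi⟩
  rw [eq_sub_iff_add_eq, ← sub_eq_zero, ← this]
  simp only [Fin.castSucc_mk, Fin.succ_mk]
  ring

theorem carrier_eq : Γ.carrier = ⋃ i ≤ Γ.numRays, (Γ.arcN i).carrier := by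
  ext z
  simp only [carrier, mem_iUnion]
  constructor
  · rintro ⟨i, hi⟩
    exact ⟨i, by omega, by rwa [Γ.arcN_eq i.2]⟩
  · rintro ⟨i, hi, hz⟩
    exact ⟨⟨i, by omega⟩, by rwa [← Γ.arcN_eq]⟩

theorem angle_eq : Γ.angle = cumAngle Γ.arcN (Γ.numRays + 1) := by
  rw [angle, cumAngle, ← Fin.sum_univ_eq_sum_range (fun i => (Γ.arcN i).angle)]
  exact Finset.sum_congr rfl fun i _ => by rw [Γ.arcN_eq i.2]

theorem kap_arcN_succ {i : ℕ} (hi : i < Γ.numRays) :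
    (Γ.arcN (i + 1)).kap 0 = (Γ.arcN i).kap (Γ.arcN i).len := by
  have hs := Γ.source_arcN hi
  have ht := Γ.target_arcN hi
  have hr := (Γ.ray ⟨i, hi⟩).shrinker
  rw [Arc.source] at hs
  rw [Arc.target] at ht
  rw [cross] at hr
  rw [Arc.kap_eq, Arc.kap_eq, hs, ht, Γ.vel_arcN_succ hi, Complex.sub_re, Complex.sub_im]
  linear_combination -hr

/-- The first integral `κ exp (-R² / 2)` is the same for all arcs of a chain. -/
theorem kap_arcN_eq {i : ℕ} (hi : i ≤ Γ.numRays) {s : ℝ} (hs : s ∈ Icc 0 (Γ.arcN i).len) :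
    (Γ.arcN i).kap s = Γ.first.kap 0 *
      Real.exp ((‖(Γ.arcN i).pos s‖ ^ 2 - ‖Γ.first.source‖ ^ 2) / 2) := by
  induction i generalizing s with
  | zero => rw [first_eq]; exact (Γ.arcN 0).kap_eq_mul_exp hs
  | succ i ih =>
    have h1 := ih (by omega) (Γ.arcN i).len_mem
    have h2 : (Γ.arcN i).pos (Γ.arcN i).len = (Γ.arcN (i + 1)).pos 0 :=
      (Γ.target_arcN (by omega)).trans (Γ.source_arcN (by omega)).symm
    rw [(Γ.arcN (i + 1)).kap_eq_mul_exp hs, Γ.kap_arcN_succ (by omega), h1, h2, mul_assoc,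
      ← Real.exp_add]
    congr 2
    ring

theorem energy_arcN (h : Γ.first.kap 0 ≠ 0) {i : ℕ} (hi : i ≤ Γ.numRays) :
    (Γ.arcN i).energy = Γ.energy := by
  have hk := Γ.kap_arcN_eq hi (Γ.arcN i).zero_mem
  have hk0 : (Γ.arcN i).kap 0 ≠ 0 := by rw [hk]; exact mul_ne_zero h (Real.exp_pos _).ne'
  rw [(Γ.arcN i).energy_eq hk0, Chain.energy, Γ.first.energy_eq h, hk, div_eq_div_iff
    (mul_ne_zero h (Real.exp_pos _).ne') h]
  have : Real.exp ((‖(Γ.arcN i).source‖ ^ 2 - 1) / 2) =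
      Real.exp ((‖(Γ.arcN i).pos 0‖ ^ 2 - ‖Γ.first.source‖ ^ 2) / 2) *
        Real.exp ((‖Γ.first.source‖ ^ 2 - 1) / 2) := by
    rw [← Real.exp_add, Arc.source]; congr 1; ring
  rw [this]
  ring

theorem ccwPath (h : 0 < Γ.first.kap 0) : CcwPath Γ.arcN Γ.numRays where
  kap_pos i hi := by rw [Γ.kap_arcN_eq hi (Γ.arcN i).zero_mem]; positivity
  target_eq i hi := (Γ.target_arcN hi).trans (Γ.source_arcN hi).symm

theorem kap_arcN_neg (h : Γ.first.kap 0 < 0) {i : ℕ} (hi : i ≤ Γ.numRays) {s : ℝ}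
    (hs : s ∈ Icc 0 (Γ.arcN i).len) : (Γ.arcN i).kap s < 0 := by
  rw [Γ.kap_arcN_eq hi hs]
  exact mul_neg_of_neg_of_pos h (Real.exp_pos _)

end Chain

namespace Ray

theorem dir_sq (r : Ray) : r.dir.re ^ 2 + r.dir.im ^ 2 = 1 := by
  rw [← normSq_eq, r.norm_dir, one_pow]

theorem inner_sq (r : Ray) : (inner ℝ r.base r.dir : ℝ) ^ 2 = ‖r.base‖ ^ 2 := by
  have h := r.shrinker
  rw [cross] at h
  rw [inner_eq, normSq_eq]
  linear_combination (r.base.re ^ 2 + r.base.im ^ 2) * r.dir_sq -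
    (r.base.re * r.dir.im - r.base.im * r.dir.re) * h

/-- A ray that points inwards contains all points of its line that lie below its base point. -/
theorem mem_openCarrier_of_inward (r : Ray) (h : (inner ℝ r.base r.dir : ℝ) ≤ 0)
    (h0 : r.base ≠ 0) {l : ℝ} (hl : l < 1) : (l : ℂ) * r.base ∈ r.openCarrier := by
  have hR : 0 < ‖r.base‖ := norm_pos_iff.2 h0
  have hp : (inner ℝ r.base r.dir : ℝ) = -‖r.base‖ := by
    have := r.inner_sq
    rcases sq_eq_sq_iff_eq_or_eq_neg.1 this with e | e
    · linarith
    · exact e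
  have hc := r.shrinker
  rw [cross] at hc
  rw [inner_eq] at hp
  have hd := r.dir_sq
  have hre : r.base.re = -‖r.base‖ * r.dir.re := by
    linear_combination (-r.base.re) * hd + r.dir.re * hp + r.dir.im * hc
  have him : r.base.im = -‖r.base‖ * r.dir.im := by
    linear_combination (-r.base.im) * hd + r.dir.im * hp - r.dir.re * hc
  refine ⟨(1 - l) * ‖r.base‖, mul_pos (by linarith) hR, ?_⟩
  apply Complex.ext
  · simp
    linear_combination (l - 1) * hre
  · simp
    linear_combination (l - 1) * him

end Ray

/-- At an outward ray the curve jumps from `ψ = π / 3` to `ψ = 2π / 3`. -/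
theorem Chain.jump (Γ : Chain) {i : ℕ} (hi : i < Γ.numRays)
    (hk : 0 < (Γ.arcN i).kap (Γ.arcN i).len)
    (hout : 0 < (inner ℝ (Γ.ray ⟨i, hi⟩).base (Γ.ray ⟨i, hi⟩).dir : ℝ)) :
    (Γ.arcN i).sig (Γ.arcN i).len = (Γ.arcN i).kap (Γ.arcN i).len / Real.sqrt 3 ∧
    (Γ.arcN (i + 1)).sig 0 = -((Γ.arcN (i + 1)).kap 0 / Real.sqrt 3) := by
  have hs := Γ.source_arcN hi
  have ht := Γ.target_arcN hi
  have hv := Γ.vel_arcN_succ hi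
  have hkk := Γ.kap_arcN_succ hi
  have v1 := (Γ.arcN i).vel_sq (Γ.arcN i).len_mem
  have v2 := (Γ.arcN (i + 1)).vel_sq (Γ.arcN (i + 1)).zero_mem
  have hn := (Γ.arcN i).norm_pos_sq (Γ.arcN i).len_mem
  have hsg := (Γ.arcN i).sig_eq (Γ.arcN i).len
  have hsg' := (Γ.arcN (i + 1)).sig_eq 0
  rw [Arc.source] at hs
  rw [Arc.target] at ht
  set r := Γ.ray ⟨i, hi⟩
  have hd := r.dir_sq
  have hc := r.shrinker
  rw [cross] at hc
  have hp : (inner ℝ r.base r.dir : ℝ) = ‖r.base‖ := by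
    rcases sq_eq_sq_iff_eq_or_eq_neg.1 r.inner_sq with e | e
    · exact e
    · linarith [norm_nonneg r.base]
  rw [ht] at hn hsg
  rw [hs, hv] at hsg'
  rw [hv, Complex.sub_re, Complex.sub_im] at v2
  rw [Complex.sub_re, Complex.sub_im] at hsg'
  rw [inner_eq] at hp hout
  set v := (Γ.arcN i).vel (Γ.arcN i).len
  set z := r.base
  set d := r.dir
  have hvd : v.re * d.re + v.im * d.im = 1 / 2 := by linarith
  have e1 : (Γ.arcN i).sig (Γ.arcN i).len = ‖z‖ / 2 := by
    rw [hsg]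
    linear_combination (-(z.re * v.re + z.im * v.im)) * hd + ‖z‖ * hvd +
      (v.re * d.re + v.im * d.im) * hp + (v.re * d.im - v.im * d.re) * hc
  have e2 : (Γ.arcN (i + 1)).sig 0 = -(‖z‖ / 2) := by
    rw [hsg']
    linarith
  have h3 : 0 < Real.sqrt 3 := by positivity
  have h33 : Real.sqrt 3 ^ 2 = 3 := Real.sq_sqrt (by norm_num)
  have e3 : (Γ.arcN i).kap (Γ.arcN i).len / Real.sqrt 3 = ‖z‖ / 2 := by
    rw [div_eq_iff h3.ne']
    refine (sq_eq_sq₀ hk.le (by positivity)).1 ?_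
    rw [e1] at hn
    linear_combination -hn - ‖z‖ ^ 2 / 4 * h33
  rw [hkk, e1, e2, e3]
  exact ⟨rfl, rfl⟩

/-- Three unit vectors with vanishing sum. -/
theorem inner_cross_of_add_eq_zero {a b d : ℂ} (ha : ‖a‖ = 1) (hb : ‖b‖ = 1) (hd : ‖d‖ = 1)
    (h : a + b + d = 0) :
    a.re * b.re + a.im * b.im = -1 / 2 ∧
      (cross a b = Real.sqrt 3 / 2 ∨ cross a b = -(Real.sqrt 3 / 2)) := by
  have a1 := normSq_eq a
  have b1 := normSq_eq b
  have d1 := normSq_eq d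
  rw [ha] at a1
  rw [hb] at b1
  rw [hd] at d1
  have hre := congrArg Complex.re h
  have him := congrArg Complex.im h
  simp only [Complex.add_re, Complex.add_im, Complex.zero_re, Complex.zero_im] at hre him
  have dre : d.re = -(a.re + b.re) := by linarith
  have dim : d.im = -(a.im + b.im) := by linarith
  rw [dre, dim] at d1
  have hin : a.re * b.re + a.im * b.im = -1 / 2 := by linarith
  refine ⟨hin, sq_eq_sq_iff_eq_or_eq_neg.1 ?_⟩
  rw [div_pow, Real.sq_sqrt (by norm_num), cross]
  linear_combination (-(b.re ^ 2 + b.im ^ 2)) * a1 - b1 -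
    (a.re * b.re + a.im * b.im - 1 / 2) * hin

/-! ### The closed curve formed by the outer curves -/

namespace ThetaShrinker

variable (N : ThetaShrinker)

/-- The index of the last arc of the closed curve `γ_up ∪ γ_down`. -/
def loopLast : ℕ := N.up.numRays + 1 + N.down.numRays

/-- The arcs of `γ_up`, followed by the reversed arcs of `γ_down`. -/
def loopArc (i : ℕ) : Arc :=
  if i ≤ N.up.numRays then N.up.arcN i else (N.down.arcN (N.loopLast - i)).reverse

theorem loopArc_up {i : ℕ} (hi : i ≤ N.up.numRays) : N.loopArc i = N.up.arcN i := if_pos hi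

theorem loopArc_down {i : ℕ} (hi : N.up.numRays < i) :
    N.loopArc i = (N.down.arcN (N.loopLast - i)).reverse := if_neg (by omega)

open Classical in
/-- The label of the point with parameter `s` on the arc `i` of the closed curve; `z` says whether
it is the initial point of this arc. -/
def loopCell (i : ℕ) (hi : i ≤ N.loopLast) (z : Prop) : Cell N.up.numRays N.down.numRays :=
  if h : i ≤ N.up.numRays then
    if z then
      if h0 : i = 0 then .startPt else .upPt ⟨i - 1, by omega⟩
    else .upArc ⟨i, by omega⟩
  else
    if z then
      if h0 : i = N.up.numRays + 1 then .endPt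
      else .downPt ⟨N.loopLast - i, by unfold loopLast at *; omega⟩
    else .downArc ⟨N.loopLast - i, by unfold loopLast at *; omega⟩

theorem loopCell_inj {i j : ℕ} {hi : i ≤ N.loopLast} {hj : j ≤ N.loopLast} {z w : Prop}
    (h : N.loopCell i hi z = N.loopCell j hj w) : i = j ∧ (z ↔ w) := by
  unfold loopCell at h
  split_ifs at h <;> simp_all <;> omega

theorem mem_cellSet_loopCell {i : ℕ} (hi : i ≤ N.loopLast) {s : ℝ}
    (hs : s ∈ Ico 0 (N.loopArc i).len) :
    (N.loopArc i).pos s ∈ cellSet N.up N.down N.mid (N.loopCell i hi (s = 0)) := by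
  have hlast : N.loopLast = N.up.numRays + 1 + N.down.numRays := rfl
  unfold loopCell
  split_ifs with h1 h2 h3 h4 h5
  · subst h2 h3
    rw [N.loopArc_up h1]
    exact (congrArg Arc.source N.up.first_eq).symm.trans N.up_source
  · subst h2
    rw [N.loopArc_up h1]
    obtain ⟨j, rfl⟩ : ∃ j, i = j + 1 := ⟨i - 1, by omega⟩
    exact N.up.source_arcN (by omega)
  · rw [N.loopArc_up h1] at hs ⊢
    rw [N.up.arcN_eq (by omega)] at hs ⊢
    exact ⟨s, ⟨lt_of_le_of_ne hs.1 (Ne.symm h2), hs.2⟩, rfl⟩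
  · subst h4 h5
    rw [N.loopArc_down (by omega)]
    change Arc.source _ = _
    rw [Arc.source_reverse, hlast, Nat.add_sub_cancel_left, ← N.down.last_eq]
    exact N.down_target
  · subst h4
    rw [N.loopArc_down (by omega)]
    change Arc.source _ = _
    rw [Arc.source_reverse]
    exact N.down.target_arcN (by omega)
  · rw [N.loopArc_down (by omega)] at hs ⊢
    rw [N.down.arcN_eq (by omega)] at hs ⊢
    have hs0 : 0 < s := lt_of_le_of_ne hs.1 (Ne.symm h4)
    have hs1 : s < (N.down.arc ⟨N.loopLast - i, by omega⟩).len := hs.2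
    exact ⟨_, ⟨by linarith, by linarith⟩, rfl⟩

theorem cell_eq_of_mem {c c' : Cell N.up.numRays N.down.numRays} {p : ℂ}
    (h : p ∈ cellSet N.up N.down N.mid c) (h' : p ∈ cellSet N.up N.down N.mid c') : c = c' := by
  by_contra hne
  exact Set.disjoint_left.1 (N.embedded hne) h h'

theorem ccwLoop (hup : 0 < N.up.first.kap 0) (hdown : N.down.first.kap 0 < 0) :
    CcwLoop N.loopArc N.loopLast where
  kap_pos i hi := by
    rcases Nat.lt_or_ge N.up.numRays i with h | h
    · rw [N.loopArc_down h, Arc.kap_reverse, sub_zero, neg_pos]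
      exact N.down.kap_arcN_neg hdown (by unfold loopLast; omega) (Arc.len_mem _)
    · rw [N.loopArc_up h]
      exact (N.up.ccwPath hup).kap_pos i h
  target_eq i hi := by
    have hlast : N.loopLast = N.up.numRays + 1 + N.down.numRays := rfl
    rcases Nat.lt_trichotomy i N.up.numRays with h | h | h
    · rw [N.loopArc_up h.le, N.loopArc_up h]
      exact (N.up.ccwPath hup).target_eq i h
    · rw [N.loopArc_up h.le, N.loopArc_down (by omega), Arc.source_reverse, h, hlast,
        Nat.add_sub_cancel_left, ← N.up.last_eq, ← N.down.last_eq, N.up_target, N.down_target]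
    · rw [N.loopArc_down h, N.loopArc_down (by omega), Arc.source_reverse, Arc.target_reverse,
        show N.loopLast - i = N.loopLast - (i + 1) + 1 by omega,
        N.down.source_arcN (i := N.loopLast - (i + 1)) (by omega),
        N.down.target_arcN (i := N.loopLast - (i + 1)) (by omega)]
  closed := by
    rw [N.loopArc_down (by unfold loopLast; omega), N.loopArc_up (Nat.zero_le _),
      Arc.target_reverse, Nat.sub_self, ← N.up.first_eq, ← N.down.first_eq, N.up_source,
      N.down_source]
  inj i hi j hj s hs t ht e := by
    have h1 := N.mem_cellSet_loopCell hi hs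
    have h2 := N.mem_cellSet_loopCell hj ht
    rw [e] at h1
    obtain ⟨rfl, -⟩ := N.loopCell_inj (N.cell_eq_of_mem h1 h2)
    exact ⟨rfl, (N.loopArc i).simple (Ico_subset_Icc_self hs) (Ico_subset_Icc_self ht) e⟩

theorem exists_loopArc_of_mem {p : ℂ} (hp : p ∈ N.up.carrier ∪ N.down.carrier) :
    ∃ i ≤ N.loopLast, p ∈ (N.loopArc i).carrier := by
  have hlast : N.loopLast = N.up.numRays + 1 + N.down.numRays := rfl
  rw [Chain.carrier_eq, Chain.carrier_eq] at hp
  rcases hp with hp | hp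
  · simp only [mem_iUnion] at hp
    obtain ⟨i, hi, hp⟩ := hp
    exact ⟨i, by omega, by rwa [N.loopArc_up hi]⟩
  · simp only [mem_iUnion] at hp
    obtain ⟨i, hi, hp⟩ := hp
    refine ⟨N.loopLast - i, by omega, ?_⟩
    rwa [N.loopArc_down (by omega), Arc.carrier_reverse, Nat.sub_sub_self (by omega)]

theorem thetaUp_lt_two_pi (hL : CcwLoop N.loopArc N.loopLast) : N.thetaUp < 2 * Real.pi := by
  have h1 := hL.cumAngle_eq_two_pi
  have h2 : N.thetaUp = cumAngle N.loopArc (N.up.numRays + 1) := by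
    rw [thetaUp, Chain.angle_eq]
    refine Finset.sum_congr rfl fun i hi => ?_
    rw [N.loopArc_up (by rw [Finset.mem_range] at hi; omega)]
  rw [h2, ← h1]
  exact hL.toCcwPath.cumAngle_lt (by unfold loopLast; omega)

/-- The inner curve lies below the upper curve: otherwise the half-line from a point of the inner
curve to infinity would avoid the outer curves. -/
theorem norm_lt_of_dir_eq (hL : CcwLoop N.loopArc N.loopLast) {z : ℂ}
    (hz : z ∈ N.mid.openCarrier) {i : ℕ} (hi : i ≤ N.up.numRays) {s : ℝ}
    (hs : s ∈ Icc 0 (N.up.arcN i).len) (e : Arc.dir ((N.up.arcN i).pos s) = Arc.dir z) :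
    ‖z‖ < ‖(N.up.arcN i).pos s‖ := by
  have hiL : i ≤ N.loopLast := by unfold loopLast; omega
  rw [← N.loopArc_up hi] at hs e ⊢
  obtain ⟨hzJ, hbd⟩ := N.mid_inside hz
  by_contra! hle
  have hp0 : (N.loopArc i).pos s ≠ 0 := fun h0 =>
    (N.loopArc i).zero_notMem_carrier (hL.kap_pos i hiL) ⟨s, hs, h0⟩
  have hz0 : z ≠ 0 := by
    rintro rfl
    rw [norm_zero] at hle
    exact hp0 (norm_le_zero_iff.1 hle)
  have hzn : 0 < ‖z‖ := norm_pos_iff.2 hz0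
  set H : Set ℂ := (fun l : ℝ => (l : ℂ) * z) '' Ici 1 with hH
  have hdirl : ∀ l : ℝ, 1 ≤ l → Arc.dir ((l : ℂ) * z) = Arc.dir z := by
    intro l hl
    have hl0 : (l : ℂ) ≠ 0 := by exact_mod_cast (by linarith : l ≠ 0)
    rw [Arc.dir_mul, Arc.dir, Complex.norm_real, Real.norm_of_nonneg (by linarith), div_self hl0,
      one_mul]
  have hHJ : H ⊆ (N.up.carrier ∪ N.down.carrier)ᶜ := by
    rintro _ ⟨l, hl, rfl⟩ hmem
    have hl : 1 ≤ l := hl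
    obtain ⟨j, hj, t, ht, ept⟩ := N.exists_loopArc_of_mem hmem
    have heq := hL.eq_of_dir_eq hj hiL ht hs (by rw [ept, e]; exact hdirl l hl)
    have hnorm : l * ‖z‖ = ‖(N.loopArc i).pos s‖ := by
      rw [← heq, ept, norm_mul, Complex.norm_real, Real.norm_of_nonneg (by linarith)]
    have hl1 : l = 1 := by nlinarith
    rw [hl1] at hmem
    simp only [Complex.ofReal_one, one_mul] at hmem
    exact hzJ hmem
  have hHc : IsPreconnected H :=
    isPreconnected_Ici.image _ (by fun_prop)
  have hzH : z ∈ H := ⟨1, mem_Ici.2 le_rfl, by simp⟩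
  have hsub := hHc.subset_connectedComponentIn hzH hHJ
  obtain ⟨C, hC⟩ := (hbd.subset hsub).exists_norm_le
  have hm : ((max 1 ((C + 1) / ‖z‖) : ℝ) : ℂ) * z ∈ H := ⟨_, mem_Ici.2 (le_max_left _ _), rfl⟩
  have h1 := hC _ hm
  rw [norm_mul, Complex.norm_real, Real.norm_of_nonneg (by positivity)] at h1
  have h2 : (C + 1) / ‖z‖ * ‖z‖ ≤ max 1 ((C + 1) / ‖z‖) * ‖z‖ := by gcongr; exact le_max_right _ _
  rw [div_mul_cancel₀ _ hzn.ne'] at h2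
  linarith

/-! ### The polar angles of the upper and the inner curve agree -/

/-- The integral of `dz / (z - w)` along the closed curve `γ_up ∪ γ_in` is a multiple of `2πi`, is
continuous in `w` off the curve, and is small for large `w`.  So it vanishes on the unbounded
component, to which the origin belongs. -/
theorem thetaUp_eq_angle_mid (hup : 0 < N.up.first.kap 0) (h0 : (0 : ℂ) ∉ N.upperRegion)
    (hmid : (0 : ℂ) ∉ N.mid.carrier) : N.thetaUp = N.mid.angle := by
  have hpath := N.up.ccwPath hup
  set m := N.up.numRays with hm
  set J := N.up.carrier ∪ N.mid.carrier with hJ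
  have hwup : ∀ {w}, w ∉ J → ∀ i ≤ m, w ∉ (N.up.arcN i).carrier := by
    intro w hw i hi hwi
    refine hw (Or.inl ?_)
    rw [Chain.carrier_eq]
    simp only [mem_iUnion]
    exact ⟨i, hi, hwi⟩
  have hwmid : ∀ {w}, w ∉ J → w ∉ N.mid.carrier := fun hw h => hw (Or.inr h)
  have h0J : (0 : ℂ) ∉ J := by
    rintro (h | h)
    · rw [Chain.carrier_eq] at h
      simp only [mem_iUnion] at h
      obtain ⟨i, hi, h⟩ := h
      exact (N.up.arcN i).zero_notMem_carrier (hpath.kap_pos i hi) h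
    · exact hmid h
  -- the integral of `dz / (z - w)` along the closed curve
  set I : ℂ → ℂ := fun w =>
    ∑ i ∈ Finset.range (m + 1), (N.up.arcN i).windInt w - N.mid.windInt w with hI
  have hexp : ∀ w, w ∉ J → Complex.exp (I w) = 1 := by
    intro w hw
    have e1 := target_sub_eq_mul_exp_sum hpath.target_eq (hwup hw)
    have e2 := N.mid.target_sub_eq (hwmid hw)
    rw [← N.up.first_eq, ← N.up.last_eq, N.up_source, N.up_target, e2] at e1
    have hne : N.mid.source - w ≠ 0 := fun h =>
      hwmid hw ⟨0, N.mid.zero_mem, sub_eq_zero.1 h⟩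
    have e3 := mul_left_cancel₀ hne e1
    rw [hI]
    simp only
    rw [Complex.exp_sub, ← e3, div_self (Complex.exp_ne_zero _)]
  have hint : ∀ w, w ∉ J → ∃ n : ℤ, (I w).im = n * (2 * Real.pi) := by
    intro w hw
    obtain ⟨n, hn⟩ := Complex.exp_eq_one_iff.1 (hexp w hw)
    refine ⟨n, ?_⟩
    rw [hn]
    simp
  have hcont : ∀ w, w ∉ J → ContinuousAt (fun w => (I w).im) w := by
    intro w hw
    refine Complex.continuous_im.continuousAt.comp ((?_ : ContinuousAt _ w).sub
      (N.mid.continuousAt_windInt (hwmid hw)))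
    exact tendsto_finsetSum _ fun i hi =>
      (N.up.arcN i).continuousAt_windInt (hwup hw i (by rw [Finset.mem_range] at hi; omega))
  -- the component of the origin is unbounded, and the integral is small far away
  have hunb : ¬ Bornology.IsBounded (connectedComponentIn Jᶜ 0) := fun hb => h0 ⟨h0J, hb⟩
  have hcomp : IsCompact J := by
    refine IsCompact.union ?_ N.mid.isCompact_carrier
    rw [Chain.carrier_eq]
    exact (Set.finite_Iic m).isCompact_biUnion fun i _ => (N.up.arcN i).isCompact_carrier
  obtain ⟨M, hM⟩ := hcomp.isBounded.exists_norm_le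
  set S := ∑ i ∈ Finset.range (m + 1), (N.up.arcN i).len + N.mid.len with hS
  have hSpos : 0 < S := add_pos_of_nonneg_of_pos
    (Finset.sum_nonneg fun i _ => (N.up.arcN i).len_pos.le) N.mid.len_pos
  obtain ⟨w, hwC, hwM⟩ : ∃ w ∈ connectedComponentIn Jᶜ 0, M + S < ‖w‖ := by
    by_contra! hcon
    exact hunb (isBounded_iff_forall_norm_le.2 ⟨M + S, hcon⟩)
  have hwJ : w ∉ J := connectedComponentIn_subset _ _ hwC
  have hdist : ∀ z ∈ J, S ≤ ‖z - w‖ := by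
    intro z hz
    have h1 := hM z hz
    have h2 := norm_sub_norm_le w z
    rw [norm_sub_rev] at h2
    linarith
  have hsmall : ‖I w‖ ≤ 1 := by
    have h1 : ‖∑ i ∈ Finset.range (m + 1), (N.up.arcN i).windInt w‖ ≤
        ∑ i ∈ Finset.range (m + 1), (N.up.arcN i).len / S := by
      refine norm_sum_le_of_le _ fun i hi => (N.up.arcN i).norm_windInt_le hSpos fun z hz => ?_
      refine hdist z (Or.inl ?_)
      rw [Chain.carrier_eq]
      simp only [mem_iUnion]
      exact ⟨i, by rw [Finset.mem_range] at hi; omega, hz⟩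
    have h2 : ‖N.mid.windInt w‖ ≤ N.mid.len / S :=
      N.mid.norm_windInt_le hSpos fun z hz => hdist z (Or.inr hz)
    have h3 : ∑ i ∈ Finset.range (m + 1), (N.up.arcN i).len / S + N.mid.len / S = 1 := by
      rw [← Finset.sum_div, ← add_div, ← hS, div_self hSpos.ne']
    exact (norm_sub_le _ _).trans (by linarith)
  have hpi := Real.pi_gt_three
  have hIw : (I w).im = 0 := by
    obtain ⟨n, hn⟩ := hint w hwJ
    have h1 := (Complex.abs_im_le_norm (I w)).trans hsmall
    rw [hn] at h1
    have h2 := abs_le.1 h1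
    have l1 : (n : ℝ) < 1 := by nlinarith
    have l2 : (-1 : ℝ) < n := by nlinarith
    have l1' : n < 1 := by exact_mod_cast l1
    have l2' : -1 < n := by exact_mod_cast l2
    obtain rfl : n = 0 := by omega
    rw [hn]; simp
  have hI0 : (I 0).im = 0 := by
    obtain ⟨n, hn⟩ := hint 0 h0J
    by_contra hne
    have hn0 : n ≠ 0 := by rintro rfl; simp at hn; exact hne hn
    -- otherwise the value `± π` would be taken in between
    have hpc : IsPreconnected (connectedComponentIn Jᶜ (0 : ℂ)) :=
      isPreconnected_connectedComponentIn
    have hcO : ContinuousOn (fun w => (I w).im) (connectedComponentIn Jᶜ 0) := fun v hv =>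
      (hcont v (connectedComponentIn_subset _ _ hv)).continuousWithinAt
    have h0C : (0 : ℂ) ∈ connectedComponentIn Jᶜ 0 := mem_connectedComponentIn h0J
    have hno : ∀ v ∈ connectedComponentIn Jᶜ 0, ∀ k : ℤ, (I v).im ≠ (2 * k + 1) * Real.pi := by
      intro v hv k hk
      obtain ⟨l, hl⟩ := hint v (connectedComponentIn_subset _ _ hv)
      rw [hl] at hk
      have : (2 * l : ℝ) = 2 * k + 1 := by
        have : ((2 * l : ℝ) - (2 * k + 1)) * Real.pi = 0 := by linarith
        rcases mul_eq_zero.1 this with h | h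
        · linarith
        · linarith
      have : 2 * l = 2 * k + 1 := by exact_mod_cast this
      omega
    rcases lt_or_gt_of_ne hn0 with hneg | hpos
    · have h1 : (n : ℝ) ≤ -1 := by exact_mod_cast (by omega : n ≤ -1)
      obtain ⟨v, hv, hv2⟩ := hpc.intermediate_value h0C hwC hcO
        (⟨by simp only [hn]; nlinarith, by simp only [hIw]; linarith⟩ :
          -Real.pi ∈ Icc ((I 0).im) ((I w).im))
      exact hno v hv (-1) (hv2.trans (by push_cast; ring))
    · have h1 : (1 : ℝ) ≤ n := by exact_mod_cast hpos
      obtain ⟨v, hv, hv2⟩ := hpc.intermediate_value hwC h0C hcO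
        (⟨by simp only [hIw]; linarith, by simp only [hn]; nlinarith⟩ :
          Real.pi ∈ Icc ((I w).im) ((I 0).im))
      exact hno v hv 0 (hv2.trans (by push_cast; ring))
  have hsum : (∑ i ∈ Finset.range (m + 1), (N.up.arcN i).windInt 0).im = N.thetaUp := by
    rw [thetaUp, Chain.angle_eq, cumAngle, Complex.im_sum]
    refine Finset.sum_congr rfl fun i hi => ?_
    exact (N.up.arcN i).im_windInt_zero (hwup h0J i (by rw [Finset.mem_range] at hi; omega))
  have : (I 0).im = N.thetaUp - N.mid.angle := by
    rw [hI]
    simp only [Complex.sub_im]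
    rw [hsum, N.mid.im_windInt_zero hmid]
  linarith

end ThetaShrinker

/-! ### The directions at the triple junctions -/

/-- The tangential and normal parts of a vector `z` with respect to two of three unit vectors with
vanishing sum. -/
theorem frame {z a b d : ℂ} (ha : ‖a‖ = 1) (hb : ‖b‖ = 1) (hd : ‖d‖ = 1) (h : a + b + d = 0) :
    ∃ w : ℝ, (w = Real.sqrt 3 / 2 ∨ w = -(Real.sqrt 3 / 2)) ∧
      cross z b = -cross z a / 2 + w * inner ℝ z a ∧
      (inner ℝ z b : ℝ) = -inner ℝ z a / 2 - w * cross z a := by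
  obtain ⟨h1, h2⟩ := inner_cross_of_add_eq_zero ha hb hd h
  have a1 := normSq_eq a
  rw [ha] at a1
  refine ⟨cross a b, h2, ?_, ?_⟩
  · rw [inner_eq]
    unfold cross
    linear_combination (z.re * b.im - z.im * b.re) * a1 + (z.re * a.im - z.im * a.re) * h1
  · rw [inner_eq, inner_eq]
    unfold cross
    linear_combination (z.re * b.re + z.im * b.im) * a1 + (z.re * a.re + z.im * a.im) * h1

theorem Arc.kap_pos_of_angle_pos (γ : Arc) (h : 0 < γ.angle) : 0 < γ.kap 0 := by
  by_contra! hk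
  have : 0 ≤ ∫ s in (0 : ℝ)..γ.len, -(cross (γ.pos s) (γ.vel s) / ‖γ.pos s‖ ^ 2) := by
    refine intervalIntegral.integral_nonneg γ.len_pos.le fun s hs => ?_
    have h1 : cross (γ.pos s) (γ.vel s) ≤ 0 := by
      change γ.kap s ≤ 0
      rw [γ.kap_eq_mul_exp hs]
      exact mul_nonpos_of_nonpos_of_nonneg hk (Real.exp_pos _).le
    rw [neg_nonneg]
    exact div_nonpos_of_nonpos_of_nonneg h1 (by positivity)
  rw [intervalIntegral.integral_neg] at this
  rw [Arc.angle] at h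
  linarith

/-- An arc through the origin is a line segment. -/
theorem Arc.eq_of_kap_eq_zero (γ : Arc) (h : γ.kap 0 = 0) {s : ℝ} (hs : s ∈ Icc 0 γ.len) :
    γ.vel s = γ.vel 0 ∧ γ.pos s = γ.pos 0 + s * γ.vel 0 := by
  have hk : ∀ t ∈ Icc 0 γ.len, γ.kap t = 0 := fun t ht => by
    rw [γ.kap_eq_mul_exp ht, h, zero_mul]
  have hv : ∀ t ∈ Icc 0 γ.len, γ.vel t = γ.vel 0 := fun t ht => by
    refine eq_of_hasDerivWithinAt_zero (f := γ.vel) (fun u hu => ?_) ht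
    refine (γ.shrinker u hu).congr_deriv ?_
    have h1 := hk u hu
    have h2 := γ.vel_sq hu
    rw [Arc.kap_eq] at h1
    rw [inner_eq]
    apply Complex.ext
    · simp
      linear_combination (γ.pos u).re * h2 - (γ.vel u).im * h1
    · simp
      linear_combination (γ.pos u).im * h2 + (γ.vel u).re * h1
  refine ⟨hv s hs, ?_⟩
  have hd : ∀ t ∈ Icc 0 γ.len, HasDerivWithinAt (fun t : ℝ => γ.pos t - (t : ℂ) * γ.vel 0) 0
      (Icc 0 γ.len) t := fun t ht => by
    refine ((γ.hasDeriv_pos t ht).sub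
      ((Complex.ofRealCLM.hasDerivAt (x := t)).hasDerivWithinAt.mul_const (γ.vel 0))).congr_deriv ?_
    rw [hv t ht]
    simp
  have := eq_of_hasDerivWithinAt_zero hd hs
  simp only [Complex.ofReal_zero, zero_mul, sub_zero] at this
  rw [← this]; ring

namespace ThetaShrinker

variable (N : ThetaShrinker)

theorem source_up : (N.up.arcN 0).pos 0 = N.mid.pos 0 := by
  have := N.up_source
  rwa [N.up.first_eq] at this

theorem target_up :
    (N.up.arcN N.up.numRays).pos (N.up.arcN N.up.numRays).len = N.mid.pos N.mid.len := by
  have := N.up_target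
  rwa [N.up.last_eq] at this

theorem frame_start : ∃ w : ℝ, (w = Real.sqrt 3 / 2 ∨ w = -(Real.sqrt 3 / 2)) ∧
    N.mid.kap 0 = -(N.up.arcN 0).kap 0 / 2 + w * (N.up.arcN 0).sig 0 ∧
    N.mid.sig 0 = -(N.up.arcN 0).sig 0 / 2 - w * (N.up.arcN 0).kap 0 := by
  have h := N.herring_start
  have := frame (z := N.mid.pos 0) (N.up.first.norm_vel 0 N.up.first.zero_mem)
    (N.mid.norm_vel 0 N.mid.zero_mem) (N.down.first.norm_vel 0 N.down.first.zero_mem) h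
  rw [N.up.first_eq] at this
  simpa only [Arc.kap, Arc.sig, N.source_up] using this

theorem frame_end : ∃ w : ℝ, (w = Real.sqrt 3 / 2 ∨ w = -(Real.sqrt 3 / 2)) ∧
    N.mid.kap N.mid.len =
      -(N.up.arcN N.up.numRays).kap (N.up.arcN N.up.numRays).len / 2 +
        w * (N.up.arcN N.up.numRays).sig (N.up.arcN N.up.numRays).len ∧
    N.mid.sig N.mid.len =
      -(N.up.arcN N.up.numRays).sig (N.up.arcN N.up.numRays).len / 2 -
        w * (N.up.arcN N.up.numRays).kap (N.up.arcN N.up.numRays).len := by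
  have h := N.herring_end
  have := frame (z := N.mid.pos N.mid.len) (N.up.last.norm_vel _ N.up.last.len_mem)
    (N.mid.norm_vel _ N.mid.len_mem) (N.down.last.norm_vel _ N.down.last.len_mem) h
  rw [N.up.last_eq] at this
  simpa only [Arc.kap, Arc.sig, N.target_up] using this

theorem kap_down (hup : 0 < N.up.first.kap 0) (hm : 0 ≤ N.mid.kap 0) :
    N.down.first.kap 0 < 0 := by
  have e1 : N.up.first.pos 0 = N.mid.pos 0 := N.up_source
  have e2 : N.down.first.pos 0 = N.mid.pos 0 := N.down_source
  have h := N.herring_start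
  have hre := congrArg Complex.re h
  have him := congrArg Complex.im h
  simp only [Complex.add_re, Complex.add_im, Complex.zero_re, Complex.zero_im] at hre him
  rw [Arc.kap_eq, e1] at hup
  rw [Arc.kap_eq] at hm ⊢
  rw [e2]
  have : N.down.first.vel 0 = -(N.up.first.vel 0 + N.mid.vel 0) := by
    rw [eq_neg_iff_add_eq_zero, ← h]; ring
  rw [this]
  simp only [Complex.neg_re, Complex.neg_im, Complex.add_re, Complex.add_im]
  linarith

theorem thetaUp_eq_cumAngle : N.thetaUp = cumAngle N.up.arcN (N.up.numRays + 1) := N.up.angle_eq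

theorem thetaUp_pos (hup : 0 < N.up.first.kap 0) : 0 < N.thetaUp := by
  rw [thetaUp_eq_cumAngle]
  exact (N.up.ccwPath hup).cumAngle_pos (Nat.succ_pos _) le_rfl

/-- The inner curve either is a line segment through the origin, or runs counterclockwise. -/
theorem mid_cases (hup : 0 < N.up.first.kap 0) (h0 : (0 : ℂ) ∉ N.upperRegion) :
    (0 : ℂ) ∈ N.mid.carrier ∧ N.mid.kap 0 = 0 ∨
      (0 : ℂ) ∉ N.mid.carrier ∧ 0 < N.mid.kap 0 ∧ N.thetaUp = N.mid.angle := by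
  by_cases hm : (0 : ℂ) ∈ N.mid.carrier
  · refine Or.inl ⟨hm, ?_⟩
    obtain ⟨s, hs, hs0⟩ := hm
    have h1 := N.mid.kap_eq_mul_exp hs
    rw [Arc.kap_eq, hs0] at h1
    have h2 := Real.exp_pos ((‖(0 : ℂ)‖ ^ 2 - ‖N.mid.pos 0‖ ^ 2) / 2)
    simp only [Complex.zero_re, Complex.zero_im, zero_mul, sub_zero] at h1
    rcases mul_eq_zero.1 h1.symm with h | h
    · exact h
    · linarith
  · have h1 := N.thetaUp_eq_angle_mid hup h0 hm
    refine Or.inr ⟨hm, N.mid.kap_pos_of_angle_pos ?_, h1⟩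
    rw [← h1]
    exact N.thetaUp_pos hup

theorem loop (hup : 0 < N.up.first.kap 0) (h0 : (0 : ℂ) ∉ N.upperRegion) :
    CcwLoop N.loopArc N.loopLast := by
  refine N.ccwLoop hup (N.kap_down hup ?_)
  rcases N.mid_cases hup h0 with ⟨-, h⟩ | ⟨-, h, -⟩
  · exact h.ge
  · exact h.le

theorem dir_eq (hup : 0 < N.up.first.kap 0) (hm : (0 : ℂ) ∉ N.mid.carrier) {i : ℕ}
    (hi : i ≤ N.up.numRays) {s t : ℝ} (hs : s ∈ Icc 0 N.mid.len)
    (ht : t ∈ Icc 0 (N.up.arcN i).len) (e : N.mid.lift s = polarAngle N.up.arcN i t) :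
    Arc.dir ((N.up.arcN i).pos t) = Arc.dir (N.mid.pos s) := by
  rw [(N.up.ccwPath hup).dir_pos hi ht, N.mid.dir_pos hm hs, e, Arc.source, N.source_up, Arc.source]

/-- A point of the upper curve lies above the point of the inner curve with the same polar angle. -/
theorem norm_mid_lt (hup : 0 < N.up.first.kap 0) (h0 : (0 : ℂ) ∉ N.upperRegion)
    (hm : (0 : ℂ) ∉ N.mid.carrier) {i : ℕ} (hi : i ≤ N.up.numRays) {s t : ℝ}
    (hs : s ∈ Ioo 0 N.mid.len) (ht : t ∈ Icc 0 (N.up.arcN i).len)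
    (e : N.mid.lift s = polarAngle N.up.arcN i t) :
    ‖N.mid.pos s‖ < ‖(N.up.arcN i).pos t‖ :=
  N.norm_lt_of_dir_eq (N.loop hup h0) ⟨s, hs, rfl⟩ hi ht
    (N.dir_eq hup hm hi (Ioo_subset_Icc_self hs) ht e)

theorem outward_of_mem {p : ℂ} (hp : p ∈ N.mid.openCarrier) {i : ℕ} (hi : i < N.up.numRays)
    (hb : (N.up.ray ⟨i, hi⟩).base ≠ 0) {l : ℝ} (hl : l < 1)
    (e : p = (l : ℂ) * (N.up.ray ⟨i, hi⟩).base) :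
    0 < (inner ℝ (N.up.ray ⟨i, hi⟩).base (N.up.ray ⟨i, hi⟩).dir : ℝ) := by
  by_contra! hin
  have h1 := (N.up.ray ⟨i, hi⟩).mem_openCarrier_of_inward hin hb hl
  rw [← e] at h1
  have := N.cell_eq_of_mem (c := .inArc) (c' := .upRay ⟨i, hi⟩) hp h1
  cases this

theorem base_ne_zero (hup : 0 < N.up.first.kap 0) {i : ℕ} (hi : i < N.up.numRays) :
    (N.up.ray ⟨i, hi⟩).base ≠ 0 := by
  rw [← N.up.target_arcN hi]
  refine (N.up.arcN i).pos_ne_zero_of_kap_ne ?_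
  exact ((N.up.arcN i).kap_pos ((N.up.ccwPath hup).kap_pos i hi.le) (Arc.len_mem _)).ne'

/-- The rays at the upper curve point outwards, since they would hit the inner curve otherwise. -/
theorem outward (hup : 0 < N.up.first.kap 0) (h0 : (0 : ℂ) ∉ N.upperRegion) {i : ℕ}
    (hi : i < N.up.numRays) :
    0 < (inner ℝ (N.up.ray ⟨i, hi⟩).base (N.up.ray ⟨i, hi⟩).dir : ℝ) := by
  have hpath := N.up.ccwPath hup
  have hb := N.base_ne_zero hup hi
  rcases N.mid_cases hup h0 with ⟨hm, -⟩ | ⟨hm, hk, hθ⟩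
  · obtain ⟨s, hs, hs0⟩ := hm
    refine N.outward_of_mem ⟨s, ⟨lt_of_le_of_ne hs.1 fun e => ?_, lt_of_le_of_ne hs.2 fun e => ?_⟩,
      hs0⟩ hi hb (l := 0) one_pos (by simp)
    · refine (N.up.arcN 0).pos_ne_zero_of_kap_ne (hpath.kap_pos 0 (Nat.zero_le _)).ne' ?_
      rw [N.source_up, e, hs0]
    · refine (N.up.arcN N.up.numRays).pos_ne_zero_of_kap_ne
        ((N.up.arcN _).kap_pos (hpath.kap_pos _ le_rfl) (Arc.len_mem _)).ne' ?_
      rw [N.target_up, ← e, hs0]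
  · have hlen := (N.up.arcN i).len_mem
    have e1 : polarAngle N.up.arcN i (N.up.arcN i).len = cumAngle N.up.arcN (i + 1) :=
      polarAngle_len _ _
    have h1 := hpath.cumAngle_pos (i := i + 1) (Nat.succ_pos _) (by omega)
    have h2 := hpath.cumAngle_lt (i := i + 1) (by omega)
    rw [← N.thetaUp_eq_cumAngle, hθ] at h2
    obtain ⟨s, hs, es⟩ := N.mid.exists_lift_eq hk ⟨h1.le, h2.le⟩
    have hs' : s ∈ Ioo 0 N.mid.len := by
      refine ⟨lt_of_le_of_ne hs.1 fun e => ?_, lt_of_le_of_ne hs.2 fun e => ?_⟩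
      · rw [← e, Arc.lift_zero] at es; linarith
      · rw [e, ← Arc.angle_eq] at es; linarith
    have hlt := N.norm_mid_lt hup h0 hm hi.le hs' hlen (es.trans e1.symm)
    have hdir := N.dir_eq hup hm hi.le hs hlen (es.trans e1.symm)
    have ht : (N.up.arcN i).pos (N.up.arcN i).len = (N.up.ray ⟨i, hi⟩).base := N.up.target_arcN hi
    rw [ht] at hlt hdir
    have hbn : 0 < ‖(N.up.ray ⟨i, hi⟩).base‖ := norm_pos_iff.2 hb
    refine N.outward_of_mem ⟨s, hs', rfl⟩ hi hb
      (l := ‖N.mid.pos s‖ / ‖(N.up.ray ⟨i, hi⟩).base‖) (by rwa [div_lt_one hbn]) ?_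
    have hbc : (‖(N.up.ray ⟨i, hi⟩).base‖ : ℂ) ≠ 0 := by exact_mod_cast hbn.ne'
    conv_lhs => rw [← Arc.norm_mul_dir (N.mid.pos s), ← hdir, Arc.dir]
    push_cast
    field_simp

/-- If the inner curve does not meet the origin, it leaves both triple junctions below the upper
curve. -/
theorem slope_of_notMem (hup : 0 < N.up.first.kap 0) (h0 : (0 : ℂ) ∉ N.upperRegion)
    (hm : (0 : ℂ) ∉ N.mid.carrier) (hk : 0 < N.mid.kap 0) (hθ : N.thetaUp = N.mid.angle) :
    ∃ x, 1 < Real.sqrt 3 * x ∧ (N.up.arcN 0).sig 0 = x * (N.up.arcN 0).kap 0 ∧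
      (N.up.arcN N.up.numRays).sig (N.up.arcN N.up.numRays).len =
        -(x * (N.up.arcN N.up.numRays).kap (N.up.arcN N.up.numRays).len) ∧
      N.mid.sig 0 = -((x + Real.sqrt 3) / (Real.sqrt 3 * x - 1) * N.mid.kap 0) ∧
      N.mid.sig N.mid.len = (x + Real.sqrt 3) / (Real.sqrt 3 * x - 1) * N.mid.kap N.mid.len := by
  have hpath := N.up.ccwPath hup
  set m := N.up.numRays with hmdef
  have hk0 := hpath.kap_pos 0 (Nat.zero_le _)
  have hkm := hpath.kap_pos m le_rfl
  have hkL := (N.up.arcN m).kap_pos hkm (Arc.len_mem _)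
  have hkmid := N.mid.kap_pos hk N.mid.len_mem
  have h3 : 0 < Real.sqrt 3 := by positivity
  obtain ⟨w, hw, p1, p2⟩ := N.frame_start
  obtain ⟨v, hv, q1, q2⟩ := N.frame_end
  rw [← hmdef] at q1 q2
  -- the initial slopes
  have hstart := N.mid.sig_mul_kap_le (N.up.arcN 0) hk hk0 (by rw [N.source_up])
    fun s hs t ht e => N.norm_mid_lt hup h0 hm (Nat.zero_le _) hs (Ioo_subset_Icc_self ht)
      (by rw [polarAngle, cumAngle_zero, zero_add, e])
  have hw' : w = Real.sqrt 3 / 2 := by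
    rcases hw with hw | hw
    · exact hw
    · exfalso
      rw [p1, p2, hw] at hstart
      nlinarith [mul_pos h3 (mul_pos hk0 hk0), mul_nonneg h3.le (sq_nonneg ((N.up.arcN 0).sig 0))]
  -- the final slopes, from the mirror images
  have hend := N.mid.mirror.sig_mul_kap_le (N.up.arcN m).mirror
    (by simpa [Arc.kap_mirror] using hkmid)
    (by simpa [Arc.kap_mirror] using hkL)
    (by rw [Arc.norm_pos_mirror, Arc.norm_pos_mirror, sub_zero, sub_zero, N.target_up])
    fun s hs t ht e => by
      rw [Arc.len_mirror] at hs ht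
      rw [Arc.lift_mirror _ hk (Ioo_subset_Icc_self hs),
        Arc.lift_mirror _ hkm (Ioo_subset_Icc_self ht)] at e
      rw [Arc.norm_pos_mirror, Arc.norm_pos_mirror]
      refine N.norm_mid_lt hup h0 hm le_rfl ⟨by linarith [hs.2], by linarith [hs.1]⟩
        ⟨by linarith [ht.2], by linarith [ht.1]⟩ ?_
      rw [← hθ, N.thetaUp_eq_cumAngle, cumAngle_succ] at e
      rw [polarAngle]
      linarith
  rw [Arc.sig_mirror, Arc.sig_mirror, Arc.kap_mirror, Arc.kap_mirror] at hend
  simp only [sub_zero] at hend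
  have hv' : v = -(Real.sqrt 3 / 2) := by
    rcases hv with hv | hv
    · exfalso
      rw [q1, q2, hv] at hend
      nlinarith [mul_pos h3 (mul_pos hkL hkL),
        mul_nonneg h3.le (sq_nonneg ((N.up.arcN m).sig (N.up.arcN m).len))]
    · exact hv
  -- the ratio of the normal parts is the same at both junctions
  have hratio : N.mid.kap N.mid.len * (N.up.arcN 0).kap 0 =
      N.mid.kap 0 * (N.up.arcN m).kap (N.up.arcN m).len := by
    rw [N.mid.kap_eq_mul_exp N.mid.len_mem, N.up.kap_arcN_eq le_rfl (Arc.len_mem _), N.target_up,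
      N.up.first_eq, Arc.source, N.source_up]
    ring
  set x := (N.up.arcN 0).sig 0 / (N.up.arcN 0).kap 0 with hx
  have e0 : (N.up.arcN 0).sig 0 = x * (N.up.arcN 0).kap 0 := by rw [hx]; field_simp
  have hx1 : 1 < Real.sqrt 3 * x := by
    rw [p1, hw', e0] at hk
    by_contra! hcon
    nlinarith
  have eL : (N.up.arcN m).sig (N.up.arcN m).len =
      -(x * (N.up.arcN m).kap (N.up.arcN m).len) := by
    rw [q1, p1, hw', hv', e0] at hratio
    have h4 : Real.sqrt 3 / 2 * (N.up.arcN 0).kap 0 ≠ 0 := by positivity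
    refine mul_left_cancel₀ h4 ?_
    linarith
  have hne : Real.sqrt 3 * x - 1 ≠ 0 := by linarith
  have h33 : Real.sqrt 3 ^ 2 = 3 := Real.sq_sqrt (by norm_num)
  refine ⟨x, hx1, e0, eL, ?_, ?_⟩
  · have e : -(N.up.arcN 0).kap 0 / 2 + Real.sqrt 3 / 2 * (x * (N.up.arcN 0).kap 0) =
        (Real.sqrt 3 * x - 1) * ((N.up.arcN 0).kap 0 / 2) := by ring
    rw [p1, p2, hw', e0, e, ← mul_assoc, div_mul_cancel₀ _ hne]
    ring
  · have e : -(N.up.arcN m).kap (N.up.arcN m).len / 2 +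
        -(Real.sqrt 3 / 2) * -(x * (N.up.arcN m).kap (N.up.arcN m).len) =
        (Real.sqrt 3 * x - 1) * ((N.up.arcN m).kap (N.up.arcN m).len / 2) := by ring
    rw [q1, q2, hv', eL, e, ← mul_assoc, div_mul_cancel₀ _ hne]
    ring

/-- If the inner curve is a line segment through the origin, the slopes are `± 1 / √3`. -/
theorem slope_of_mem (hup : 0 < N.up.first.kap 0) (h0 : (0 : ℂ) ∉ N.upperRegion)
    (hm : (0 : ℂ) ∈ N.mid.carrier) (hk : N.mid.kap 0 = 0) :
    N.thetaUp = Real.pi ∧ (N.up.arcN 0).sig 0 = 1 / Real.sqrt 3 * (N.up.arcN 0).kap 0 ∧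
      (N.up.arcN N.up.numRays).sig (N.up.arcN N.up.numRays).len =
        -(1 / Real.sqrt 3 * (N.up.arcN N.up.numRays).kap (N.up.arcN N.up.numRays).len) := by
  have hpath := N.up.ccwPath hup
  set m := N.up.numRays with hmdef
  have hk0 := hpath.kap_pos 0 (Nat.zero_le _)
  have hkm := hpath.kap_pos m le_rfl
  have hkL := (N.up.arcN m).kap_pos hkm (Arc.len_mem _)
  have h3 : 0 < Real.sqrt 3 := by positivity
  have h33 : Real.sqrt 3 ^ 2 = 3 := Real.sq_sqrt (by norm_num)
  have hP0 : N.mid.pos 0 ≠ 0 := by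
    rw [← N.source_up]; exact Arc.pos_ne_zero_of_kap_ne _ hk0.ne'
  have hQ0 : N.mid.pos N.mid.len ≠ 0 := by
    rw [← N.target_up]; exact Arc.pos_ne_zero_of_kap_ne _ hkL.ne'
  obtain ⟨s, hs, hs0⟩ := hm
  have hs1 : 0 < s := lt_of_le_of_ne hs.1 fun e => hP0 (by rw [e, hs0])
  have hs2 : s < N.mid.len := lt_of_le_of_ne hs.2 fun e => hQ0 (by rw [← e, hs0])
  obtain ⟨-, es⟩ := N.mid.eq_of_kap_eq_zero hk hs
  obtain ⟨eV, eQ⟩ := N.mid.eq_of_kap_eq_zero hk N.mid.len_mem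
  rw [hs0] at es
  set V := N.mid.vel 0 with hV
  have hV1 : ‖V‖ = 1 := N.mid.norm_vel 0 N.mid.zero_mem
  have hV0 : V ≠ 0 := norm_ne_zero_iff.1 (by rw [hV1]; exact one_ne_zero)
  have hVsq := normSq_eq V
  rw [hV1] at hVsq
  have eP : N.mid.pos 0 = ((-s : ℝ) : ℂ) * V := by
    push_cast
    linear_combination -es
  have eQ' : N.mid.pos N.mid.len = ((N.mid.len - s : ℝ) : ℂ) * V := by
    rw [eQ, eP]; push_cast; ring
  have σP : N.mid.sig 0 = -s := by
    rw [Arc.sig_eq, eP, ← hV]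
    simp
    linear_combination s * hVsq
  have σQ : N.mid.sig N.mid.len = N.mid.len - s := by
    rw [Arc.sig_eq, eQ', eV]
    simp
    linear_combination (s - N.mid.len) * hVsq
  have hkQ : N.mid.kap N.mid.len = 0 := by
    rw [N.mid.kap_eq_mul_exp N.mid.len_mem, hk, zero_mul]
  obtain ⟨w, hw, p1, p2⟩ := N.frame_start
  obtain ⟨v, hv, q1, q2⟩ := N.frame_end
  rw [hk] at p1
  rw [σP] at p2
  rw [hkQ] at q1
  rw [σQ] at q2
  refine ⟨?_, ?_, ?_⟩
  · -- the polar angles of the endpoints differ by `π`, modulo `2π`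
    have hd := hpath.dir_pos le_rfl (N.up.arcN m).len_mem
    rw [polarAngle_len, ← N.thetaUp_eq_cumAngle, Arc.source, N.source_up, N.target_up, eQ', eP,
      Arc.dir_mul, Arc.dir_mul] at hd
    have d1 : Arc.dir ((-s : ℝ) : ℂ) = -1 := by
      have : (s : ℂ) ≠ 0 := by exact_mod_cast hs1.ne'
      rw [Arc.dir, Complex.norm_real, Real.norm_of_nonpos (by linarith), neg_neg]
      push_cast
      field_simp
    have d2 : Arc.dir ((N.mid.len - s : ℝ) : ℂ) = 1 := by
      have : ((N.mid.len - s : ℝ) : ℂ) ≠ 0 := by exact_mod_cast (by linarith : N.mid.len - s ≠ 0)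
      rw [Arc.dir, Complex.norm_real, Real.norm_of_nonneg (by linarith), div_self this]
    have d3 : Arc.dir V = V := by rw [Arc.dir, hV1]; simp
    rw [d1, d2, d3] at hd
    have he : Complex.exp (N.thetaUp * Complex.I) = -1 := by
      refine mul_left_cancel₀ hV0 ?_
      linear_combination hd
    have hpos := N.thetaUp_pos hup
    have hlt := N.thetaUp_lt_two_pi (N.loop hup h0)
    have he2 : Complex.exp ((N.thetaUp - Real.pi) * Complex.I) = 1 := by
      rw [sub_mul, Complex.exp_sub, he, Complex.exp_pi_mul_I, div_self (by norm_num)]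
    obtain ⟨n, hn⟩ := Complex.exp_eq_one_iff.1 he2
    have hn : N.thetaUp - Real.pi = n * (2 * Real.pi) := by
      have := congrArg Complex.im hn
      simpa using this
    have hpi := Real.pi_pos
    have l1 : (n : ℝ) < 1 := by nlinarith
    have l2 : (-1 : ℝ) < n := by nlinarith
    have l1' : n < 1 := by exact_mod_cast l1
    have l2' : -1 < n := by exact_mod_cast l2
    obtain rfl : n = 0 := by omega
    simp at hn
    linarith
  · rcases hw with hw | hw
    · rw [hw] at p1
      field_simp
      linear_combination (-2 : ℝ) * p1
    · exfalso
      rw [hw] at p1 p2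
      have e1 : Real.sqrt 3 * (N.up.arcN 0).sig 0 = -(N.up.arcN 0).kap 0 := by linarith
      have e2 : (N.up.arcN 0).sig 0 < 0 := by by_contra! h; nlinarith
      have := mul_pos h3 hk0
      linarith
  · rcases hv with hv | hv
    · exfalso
      rw [hv] at q1 q2
      have e1 : Real.sqrt 3 * (N.up.arcN m).sig (N.up.arcN m).len =
          (N.up.arcN m).kap (N.up.arcN m).len := by linarith
      have e2 : 0 < (N.up.arcN m).sig (N.up.arcN m).len := by by_contra! h; nlinarith
      have := mul_pos h3 hkL
      linarith
    · rw [hv] at q1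
      field_simp
      linear_combination (2 : ℝ) * q1

/-- The upper curve, as a chain of trajectories in the phase plane. -/
theorem flowChain (hup : 0 < N.up.first.kap 0) (h0 : (0 : ℂ) ∉ N.upperRegion) {x : ℝ}
    (hstart : (N.up.arcN 0).sig 0 = x * (N.up.arcN 0).kap 0)
    (hend : (N.up.arcN N.up.numRays).sig (N.up.arcN N.up.numRays).len =
        -(x * (N.up.arcN N.up.numRays).kap (N.up.arcN N.up.numRays).len)) :
    FlowChain N.cUp x N.up.numRays (fun i => (N.up.arcN i).len) (fun i => (N.up.arcN i).sig)
      (fun i => (N.up.arcN i).kap) where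
  len_pos i _ := (N.up.arcN i).len_pos
  flow i hi := by
    have := (N.up.arcN i).flow ((N.up.ccwPath hup).kap_pos i hi)
    rwa [N.up.energy_arcN hup.ne' hi] at this
  jump_left i hi := (N.up.jump hi ((N.up.arcN i).kap_pos
    ((N.up.ccwPath hup).kap_pos i hi.le) (Arc.len_mem _)) (N.outward hup h0 hi)).1
  jump_right i hi := (N.up.jump hi ((N.up.arcN i).kap_pos
    ((N.up.ccwPath hup).kap_pos i hi.le) (Arc.len_mem _)) (N.outward hup h0 hi)).2
  jump_snd i hi := N.up.kap_arcN_succ hi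
  fst_start := hstart
  fst_end := hend

theorem thetaUp_eq_sum : N.thetaUp = ∑ j ∈ Finset.range (N.up.numRays + 1),
    ang (N.up.arcN j).sig (N.up.arcN j).kap 0 (N.up.arcN j).len := by
  rw [thetaUp_eq_cumAngle, cumAngle]
  exact Finset.sum_congr rfl fun i _ => Arc.angle_eq _

end ThetaShrinker

/-- The angle `ψ` of the inner curve at its ends, in terms of that of the upper curve. -/
theorem arctan_add_arctan_eq {x : ℝ} (hx : 1 < Real.sqrt 3 * x) :
    Real.arctan x + Real.arctan ((x + Real.sqrt 3) / (Real.sqrt 3 * x - 1)) =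
      2 * Real.pi / 3 := by
  have h3 : 0 < Real.sqrt 3 := by positivity
  have h33 : Real.sqrt 3 ^ 2 = 3 := Real.sq_sqrt (by norm_num)
  have hx0 : 0 < x := by by_contra! h; nlinarith
  have hd : 0 < Real.sqrt 3 * x - 1 := by linarith
  have hxy : 1 < x * ((x + Real.sqrt 3) / (Real.sqrt 3 * x - 1)) := by
    rw [mul_div_assoc', lt_div_iff₀ hd]
    nlinarith
  rw [Real.arctan_add_eq_add_pi hxy hx0]
  have e : (x + (x + Real.sqrt 3) / (Real.sqrt 3 * x - 1)) /
      (1 - x * ((x + Real.sqrt 3) / (Real.sqrt 3 * x - 1))) = -Real.sqrt 3 := by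
    have e1 : x + (x + Real.sqrt 3) / (Real.sqrt 3 * x - 1) =
        -Real.sqrt 3 * (1 - x * ((x + Real.sqrt 3) / (Real.sqrt 3 * x - 1))) := by
      rw [eq_comm, mul_div_assoc', one_sub_div hd.ne', mul_div_assoc', add_div' _ _ _ hd.ne']
      congr 1
      ring
    rw [e1, mul_div_cancel_right₀ _ (by linarith)]
  rw [e, Real.arctan_neg, Real.arctan_sqrt_three]
  ring

/-! ### The upper curve against the inner curve -/

/-- If `K(R) = c sin δ` is close to `1` for a small angle `δ`, then `R` is close to `1`, and the
comparison angle `χ` is small. -/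
theorem chi_le_of_mul_sin_le {c δ : ℝ} (hc : 1 < c) (h0 : 0 < δ) (h1 : δ < 0.0171)
    (h : c * Real.sin δ ≤ 1.0095) : chi c δ ≤ 0.003 := by
  have hC := cos_omega_pos hc
  have hC2 := cos_omega_sq hc
  have hs0 := Real.sin_pos_of_pos_of_lt_pi h0 (by linarith [Real.pi_gt_three])
  have hs1 := Real.sin_lt h0
  have hcd := Real.cos_pos_of_mem_Ioo (x := δ) ⟨by linarith [Real.pi_gt_three],
    by linarith [Real.pi_gt_three]⟩
  have hcu := Real.cos_pos_of_mem_Ioo (x := 0.003) ⟨by linarith [Real.pi_gt_three],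
    by linarith [Real.pi_gt_three]⟩
  have hu := Real.sin_gt_sub_cube (x := 0.003) (by norm_num)
  have hu2 : 0.0000089 ≤ Real.sin 0.003 ^ 2 := by
    have : (0.00299 : ℝ) ≤ Real.sin 0.003 := by norm_num at hu ⊢; linarith
    nlinarith
  rw [chi, ← Real.arccos_cos (x := 0.003) (by norm_num) (by linarith [Real.pi_gt_three])]
  refine Real.arccos_le_arccos ?_
  rw [le_div_iff₀ hC]
  refine (pow_le_pow_iff_left₀ (by positivity) hcd.le two_ne_zero).1 ?_
  rw [mul_pow, hC2, Real.cos_sq', Real.cos_sq']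
  -- `1 / c` lies between `sin δ / 1.0095` and `1`
  set p := 1 / c ^ 2 with hp
  have hp1 : Real.sin δ ^ 2 ≤ 1.0095 ^ 2 * p := by
    rw [hp, mul_one_div, le_div_iff₀ (by positivity), ← mul_pow, mul_comm]
    exact pow_le_pow_left₀ (by positivity) h 2
  have hs2 : Real.sin δ ^ 2 ≤ 0.0171 ^ 2 := pow_le_pow_left₀ hs0.le (by linarith) 2
  have hp0 : 0 < p := by positivity
  have hp2 : p ≤ 1 := by rw [hp, div_le_one (by positivity)]; nlinarith
  have hw := Real.sin_sq_le_one 0.003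
  nlinarith [mul_nonneg (sub_nonneg.2 hu2) (sub_nonneg.2 hp2)]

/-- The lower bound for the change of angle of the inner curve, which meets the radial direction at
the small angle `δ` at both ends. -/
theorem Flow.lt_ang_of_psi {c a b δ : ℝ} {σ κ : ℝ → ℝ} (h : Flow c a b σ κ) (hc : 1 < c)
    (hab : a < b) (ha : σ a < 0) (hb : 0 < σ b) (h0 : 0 < δ) (h1 : δ < 0.0171)
    (hpa : psi σ κ a = Real.pi - δ) (hpb : psi σ κ b = δ) (hs : c * Real.sin δ ≤ 1.0095) :
    0.9947 * Real.pi < ang σ κ a b := by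
  have hle := (h.psi_sub_psi_le_ang hc hab ha hb).2
  rw [hpa, hpb, chi_pi_sub] at hle
  have hX := chi_le_of_mul_sin_le hc h0 h1 hs
  have hX0 := chi_nonneg c δ
  obtain ⟨r1, r2⟩ := one_div_sqrt_two_bounds
  set r := 1 / Real.sqrt 2
  have := Real.pi_gt_d4
  have e1 : r * chi c δ ≤ 0.70711 * 0.003 := mul_le_mul r2.le hX hX0 (by norm_num)
  have e2 : (1 - r) * δ ≤ 0.2929 * 0.0171 := mul_le_mul (by linarith) h1.le h0.le (by norm_num)
  linarith

/-- If the upper curve starts with the angle `α = π / 3 - δ` in the unit disk, then `c sin α > 1`,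
which forces `α` to be close to `π / 3` for `c < cBar`. -/
theorem lt_of_mul_sin_ge {c δ : ℝ} (hc0 : 0 < c) (hc : c < cBar) (h0 : δ ≤ Real.pi / 3)
    (h : 1 < c * Real.sin (Real.pi / 3 - δ)) : δ < 0.0171 := by
  by_contra! hd
  have h1 := sin_pi_div_three_sub_lt (d := 0.0171) (by norm_num)
  have hpi := Real.pi_pos
  have h2 := Real.sin_le_sin_of_le_of_le_pi_div_two (x := Real.pi / 3 - δ)
    (y := Real.pi / 3 - 0.0171) (by linarith) (by linarith) (by linarith)
  have h3 := cBar_lt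
  norm_num at h1
  nlinarith

namespace ThetaShrinker

variable (N : ThetaShrinker)

theorem cUp_pos (hup : 0 < N.up.first.kap 0) : 0 < N.cUp := by
  have hk := hup
  have h1 : 0 < ‖N.up.first.source‖ := norm_pos_iff.2 (Arc.pos_ne_zero_of_kap_ne _ hk.ne')
  rw [cUp, Chain.energy, Arc.energy_eq _ hk.ne']
  positivity

theorem rad_start :
    rad (N.up.arcN 0).sig (N.up.arcN 0).kap 0 = N.RStart := by
  rw [Arc.rad_eq _ (Arc.zero_mem _), N.source_up]; rfl

theorem rad_end :
    rad (N.up.arcN N.up.numRays).sig (N.up.arcN N.up.numRays).kap (N.up.arcN N.up.numRays).len =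
      N.REnd := by
  rw [Arc.rad_eq _ (Arc.len_mem _), N.target_up]; rfl

end ThetaShrinker

theorem CcwPath.polarAngle_mem_Ioo {f : ℕ → Arc} {m : ℕ} (h : CcwPath f m) {i : ℕ} (hi : i ≤ m)
    {s : ℝ} (hs : s ∈ Icc 0 (f i).len) (h0 : i = 0 → s ≠ 0) (hm : i = m → s ≠ (f m).len) :
    polarAngle f i s ∈ Ioo 0 (cumAngle f (m + 1)) := by
  have hmono := (f i).strictMonoOn_lift (h.kap_pos i hi)
  constructor
  · rw [polarAngle]
    rcases Nat.eq_zero_or_pos i with e | e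
    · subst e
      have := hmono (f 0).zero_mem hs (lt_of_le_of_ne hs.1 (h0 rfl).symm)
      rw [Arc.lift_zero] at this
      have := h.cumAngle_nonneg (i := 0) (by omega)
      linarith
    · have := h.cumAngle_pos e (by omega)
      have := (f i).lift_nonneg (h.kap_pos i hi) hs
      linarith
  · rw [polarAngle]
    rcases hi.lt_or_eq with e | e
    · have := h.cumAngle_lt (i := i + 1) (by omega)
      have := (f i).lift_le_angle (h.kap_pos i hi) hs
      rw [cumAngle_succ f i] at *
      linarith
    · subst e
      have := hmono hs (f i).len_mem (lt_of_le_of_ne hs.2 (hm rfl))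
      rw [← Arc.angle_eq] at this
      rw [cumAngle_succ]
      linarith

namespace ThetaShrinker

variable (N : ThetaShrinker)

/-- The inner curve has a higher energy than the upper one, if the latter has a point of least
radius: it comes closer to the origin. -/
theorem cUp_lt_energy_mid (hup : 0 < N.up.first.kap 0) (h0 : (0 : ℂ) ∉ N.upperRegion)
    (hm : (0 : ℂ) ∉ N.mid.carrier) (hk : 0 < N.mid.kap 0) (hθ : N.thetaUp = N.mid.angle) {i : ℕ}
    (hi : i ≤ N.up.numRays) {s : ℝ} (hs : s ∈ Icc 0 (N.up.arcN i).len)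
    (hσ0 : (N.up.arcN 0).sig 0 ≠ 0)
    (hσL : (N.up.arcN N.up.numRays).sig (N.up.arcN N.up.numRays).len ≠ 0)
    (hσ : (N.up.arcN i).sig s = 0) (hκ : (N.up.arcN i).kap s < 1) :
    N.cUp < N.mid.energy := by
  have hpath := N.up.ccwPath hup
  have hf := (N.up.arcN i).flow (hpath.kap_pos i hi)
  rw [N.up.energy_arcN hup.ne' hi] at hf
  have hM := N.mid.flow hk
  obtain ⟨e0, e1⟩ := hpath.polarAngle_mem_Ioo hi hs
    (fun hi0 hs0 => hσ0 (by subst hi0; rwa [hs0] at hσ))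
    (fun him hsL => hσL (by subst him; rwa [hsL] at hσ))
  rw [← N.thetaUp_eq_cumAngle, hθ] at e1
  obtain ⟨t, ht, et⟩ := N.mid.exists_lift_eq hk ⟨e0.le, e1.le⟩
  have ht' : t ∈ Ioo 0 N.mid.len := by
    refine ⟨lt_of_le_of_ne ht.1 fun e => ?_, lt_of_le_of_ne ht.2 fun e => ?_⟩
    · rw [← e, Arc.lift_zero] at et; linarith
    · rw [e, ← Arc.angle_eq] at et; linarith
  have hlt := N.norm_mid_lt hup h0 hm hi ht' hs et
  rw [← Arc.rad_eq _ hs, ← Arc.rad_eq _ ht, hf.rad_eq_of_fst_eq_zero hs hσ] at hlt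
  have h1 := hM.rad_pos ht
  have h2 := strictAntiOn_K ⟨h1, by linarith⟩ ⟨hf.pos s hs, hκ.le⟩ hlt
  rw [hf.K_snd_of_fst_eq_zero hs hσ] at h2
  refine lt_of_lt_of_le h2 (hM.K_rad_le ?_ ht)
  rw [Arc.energy_eq _ hk.ne']
  positivity

/-- The inner curve has no point of largest radius, since the upper curve would have to pass above
it. -/
theorem kap_mid_lt_one (hup : 0 < N.up.first.kap 0) (h0 : (0 : ℂ) ∉ N.upperRegion)
    (hm : (0 : ℂ) ∉ N.mid.carrier) (hk : 0 < N.mid.kap 0) (hθ : N.thetaUp = N.mid.angle)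
    (hlt : N.cUp < N.mid.energy) {s : ℝ} (hs : s ∈ Ioo 0 N.mid.len)
    (hσ : N.mid.sig s = 0) : N.mid.kap s < 1 := by
  have hpath := N.up.ccwPath hup
  have hM := N.mid.flow hk
  have hs' := Ioo_subset_Icc_self hs
  by_contra! h1
  have hl := N.mid.strictMonoOn_lift hk hs' N.mid.len_mem hs.2
  rw [← Arc.angle_eq, ← hθ, N.thetaUp_eq_cumAngle] at hl
  obtain ⟨i, hi, t, ht, et⟩ := hpath.exists_polarAngle_eq ⟨N.mid.lift_nonneg hk hs', hl⟩
  have ht' := Ico_subset_Icc_self ht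
  have hf := (N.up.arcN i).flow (hpath.kap_pos i hi)
  rw [N.up.energy_arcN hup.ne' hi] at hf
  have hn := N.norm_mid_lt hup h0 hm hi hs ht' et.symm
  rw [← Arc.rad_eq _ ht', ← Arc.rad_eq _ hs', hM.rad_eq_of_fst_eq_zero hs' hσ] at hn
  have h2 := strictMonoOn_K (mem_Ici.2 h1) (mem_Ici.2 (h1.trans hn.le)) hn
  rw [hM.K_snd_of_fst_eq_zero hs' hσ] at h2
  exact absurd (hf.K_rad_le (N.cUp_pos hup) ht') (not_le.2 (hlt.trans h2))

/-- The case of an inner curve through the origin. -/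
theorem bounds_of_mem (hup : 0 < N.up.first.kap 0) (h0 : (0 : ℂ) ∉ N.upperRegion)
    (hm : (0 : ℂ) ∈ N.mid.carrier) (hk : N.mid.kap 0 = 0) (hR : N.RStart < 1 ∨ N.REnd < 1) :
    h1 N.cUp + 2 * h2 N.cUp + 2 * thetaNA N.cUp < N.thetaUp ∧ cStar < N.cUp ∧
      N.thetaUp = Real.pi := by
  obtain ⟨hθ, e0, eL⟩ := N.slope_of_mem hup h0 hm hk
  have FC := N.flowChain hup h0 e0 eL
  have hx : 1 / 3 ≤ (1 / Real.sqrt 3) ^ 2 := by rw [div_pow, Real.sq_sqrt (by norm_num)]; norm_num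
  have hx0 : 0 < 1 / Real.sqrt 3 := by positivity
  have hR' := hR
  rw [← N.rad_start, ← N.rad_end] at hR'
  have hc := FC.cStar_lt (N.cUp_pos hup) hx hR'
  have ha : Real.arctan (1 / Real.sqrt 3) = Real.pi / 6 := by
    rw [one_div, Real.arctan_inv_of_pos (by positivity), Real.arctan_sqrt_three]; ring
  refine ⟨?_, hc, hθ⟩
  rw [N.thetaUp_eq_sum]
  by_cases hb : ∃ i ≤ N.up.numRays, ∃ s ∈ Icc 0 (N.up.arcN i).len, (N.up.arcN i).sig s = 0 ∧
      (N.up.arcN i).kap s < 1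
  · obtain ⟨i, hi, s, hs, hσ, hκ⟩ := hb
    exact FC.lt_sum_of_bottom hc hx0 hx hi hs hσ hκ hR'
  · exfalso
    push Not at hb
    have := FC.sum_lt_of_no_bottom (one_lt_of_cStar_lt hc) hx0 (by rw [ha]; linarith)
      fun i hi s hs => hb i hi s hs
    rw [← N.thetaUp_eq_sum, hθ, ha] at this
    linarith

/-- The case of an inner curve that misses the origin. -/
theorem bounds_of_notMem (hup : 0 < N.up.first.kap 0) (h0 : (0 : ℂ) ∉ N.upperRegion)
    (hm : (0 : ℂ) ∉ N.mid.carrier) (hk : 0 < N.mid.kap 0) (hθ : N.thetaUp = N.mid.angle)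
    (hR : N.RStart < 1 ∨ N.REnd < 1) :
    h1 N.cUp + 2 * h2 N.cUp + 2 * thetaNA N.cUp < N.thetaUp ∧ cStar < N.cUp ∧
      N.thetaUp ≤ Real.pi ∧ 0.9947 * Real.pi < N.thetaUp := by
  have hpi := Real.pi_pos
  have hs3 := sqrt_three_bounds
  obtain ⟨x, hx1, e0, eL, m0, mL⟩ := N.slope_of_notMem hup h0 hm hk hθ
  have FC := N.flowChain hup h0 e0 eL
  have hpath := N.up.ccwPath hup
  have hsum := arctan_add_arctan_eq hx1
  set y := (x + Real.sqrt 3) / (Real.sqrt 3 * x - 1) with hy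
  have hx0 : 0 < x := by by_contra! h; nlinarith
  have hy0 : 0 < y := div_pos (by linarith) (by linarith)
  have hx : 1 / 3 ≤ x ^ 2 := by
    have h33 : Real.sqrt 3 ^ 2 = 3 := Real.sq_sqrt (by norm_num)
    have : (1 : ℝ) ≤ (Real.sqrt 3 * x) ^ 2 := one_le_pow₀ hx1.le
    rw [mul_pow, h33] at this
    linarith
  have hR' := hR
  rw [← N.rad_start, ← N.rad_end] at hR'
  have hc := FC.cStar_lt (N.cUp_pos hup) hx hR'
  have hM := N.mid.flow hk
  have hkL := N.mid.kap_pos hk N.mid.len_mem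
  have ra : rad N.mid.sig N.mid.kap 0 = N.RStart := Arc.rad_eq _ N.mid.zero_mem
  have rb : rad N.mid.sig N.mid.kap N.mid.len = N.REnd := Arc.rad_eq _ N.mid.len_mem
  have hRm := hR
  rw [← ra, ← rb] at hRm
  have hcm0 : 0 < N.mid.energy := by
    rw [Arc.energy_eq _ hk.ne']; positivity
  have hcm : 1 < N.mid.energy := by
    rcases hRm with h | h
    · exact (one_lt_K (hM.rad_pos N.mid.zero_mem) h.ne).trans_le (hM.K_rad_le hcm0 N.mid.zero_mem)
    · exact (one_lt_K (hM.rad_pos N.mid.len_mem) h.ne).trans_le (hM.K_rad_le hcm0 N.mid.len_mem)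
  have hma : N.mid.sig 0 < 0 := by rw [m0]; linarith [mul_pos hy0 hk]
  have hmb : 0 < N.mid.sig N.mid.len := by rw [mL]; exact mul_pos hy0 hkL
  have pa : psi N.mid.sig N.mid.kap 0 = Real.pi / 2 + Real.arctan y := by
    rw [psi, m0, neg_div, mul_div_cancel_right₀ _ hk.ne', Real.arctan_neg]; ring
  have pb : psi N.mid.sig N.mid.kap N.mid.len = Real.pi / 2 - Real.arctan y := by
    rw [psi, mL, mul_div_cancel_right₀ _ hkL.ne']
  have hang : N.thetaUp = ang N.mid.sig N.mid.kap 0 N.mid.len := hθ.trans N.mid.angle_eq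
  have hy1 := Real.arctan_lt_pi_div_two y
  by_cases hb : ∃ i ≤ N.up.numRays, ∃ s ∈ Icc 0 (N.up.arcN i).len, (N.up.arcN i).sig s = 0 ∧
      (N.up.arcN i).kap s < 1
  · obtain ⟨i, hi, s, hs, hσ, hκ⟩ := hb
    have hf := FC.lt_sum_of_bottom hc hx0 hx hi hs hσ hκ hR'
    rw [← N.thetaUp_eq_sum] at hf
    have hk0 := hpath.kap_pos 0 (Nat.zero_le _)
    have hkm := (N.up.arcN _).kap_pos (hpath.kap_pos _ le_rfl) (Arc.len_mem _)
    have hlt := N.cUp_lt_energy_mid hup h0 hm hk hθ hi hs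
      (by rw [e0]; exact (mul_pos hx0 hk0).ne') (by rw [eL]; exact (neg_neg_of_pos
        (mul_pos hx0 hkm)).ne) hσ hκ
    have hle : N.thetaUp ≤ Real.pi := by
      rw [hang]
      refine hM.ang_le_pi hcm N.mid.len_pos hma hmb (fun s hs h => ?_) (by rw [pa, pb]; ring) hRm
      refine N.kap_mid_lt_one hup h0 hm hk hθ hlt ⟨lt_of_le_of_ne hs.1 fun e => ?_,
        lt_of_le_of_ne hs.2 fun e => ?_⟩ h
      · rw [← e] at h; linarith
      · rw [e] at h; linarith
    have hcBar : N.cUp < cBar := by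
      by_contra! h
      linarith [pi_lt_of_cBar_le h]
    refine ⟨hf, hc, hle, ?_⟩
    -- `K` at the junction in the unit disk, in terms of both curves
    have hKlt : 1 < N.cUp * Real.sin (Real.pi / 2 - Real.arctan x) ∧
        N.mid.energy * Real.sin (Real.pi / 2 - Real.arctan y) ≤ Real.sqrt 3 / 2 * N.cUp := by
      have hf0 := FC.flow 0 (Nat.zero_le _)
      have z0 := FC.zero_mem (Nat.zero_le _)
      have hle0 := hf0.K_rad_le_of_fst_eq (N.cUp_pos hup) z0 hx (by rw [FC.fst_start])
      have hK0 := hf0.K_rad z0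
      have hKe := FC.K_rad_start_eq
      have hKm := hM.K_rad N.mid.len_mem
      rw [pb, rb, ← N.rad_end] at hKm
      rw [psi, FC.fst_start, mul_div_cancel_right₀ _ (hf0.pos _ z0).ne'] at hK0
      rw [← hK0, ← hKm]
      refine ⟨?_, by rw [← hKe]; exact hle0⟩
      rcases hR' with h | h
      · exact one_lt_K (hf0.rad_pos z0) h.ne
      · rw [hKe]
        exact one_lt_K ((FC.flow _ le_rfl).rad_pos (FC.len_mem le_rfl)) h.ne
    have hδ : Real.pi / 2 - Real.arctan y < 0.0171 := by
      refine lt_of_mul_sin_ge (N.cUp_pos hup) hcBar ?_ ?_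
      · linarith [Real.arctan_lt_pi_div_two x]
      · convert hKlt.1 using 3
        linarith
    rw [hang]
    refine hM.lt_ang_of_psi hcm N.mid.len_pos hma hmb (by linarith) hδ (by rw [pa]; ring) pb ?_
    refine hKlt.2.trans ?_
    nlinarith [cBar_lt, N.cUp_pos hup]
  · exfalso
    push Not at hb
    have h1 := FC.sum_lt_of_no_bottom (one_lt_of_cStar_lt hc) hx0 (by linarith)
      fun i hi s hs => hb i hi s hs
    have h2 := (hM.psi_sub_psi_le_ang hcm N.mid.len_pos hma hmb).1
    rw [← N.thetaUp_eq_sum] at h1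
    rw [← hang, pa, pb] at h2
    linarith

end ThetaShrinker

end Shrinker

end

theorem mainTheorem8 :
    (∀ c : ℝ, Shrinker.cBar ≤ c →
      Real.pi < Shrinker.h1 c + 2 * Shrinker.h2 c + 2 * Shrinker.thetaNA c) ∧
    ∀ N : Shrinker.ThetaShrinker,
      -- the upper region does not contain the origin, and `γ_up` is the curve that leaves the
      -- starting point counterclockwise around the origin
      (0 : ℂ) ∉ N.upperRegion →
      0 < Shrinker.cross N.up.first.source (N.up.first.vel 0) →
      (N.RStart < 1 ∨ N.REnd < 1) →
        Shrinker.h1 N.cUp + 2 * Shrinker.h2 N.cUp + 2 * Shrinker.thetaNA N.cUp < N.thetaUp ∧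
        N.cUp ∈ Set.Ioo Shrinker.cStar Shrinker.cBar ∧
        N.thetaUp = N.thetaIn ∧
        N.thetaUp ∈ Set.Ioc (0.9947 * Real.pi) Real.pi := by
  refine ⟨fun c hc => Shrinker.pi_lt_of_cBar_le hc, fun N h0 hup hR => ?_⟩
  have hpi := Real.pi_pos
  have key : Shrinker.h1 N.cUp + 2 * Shrinker.h2 N.cUp + 2 * Shrinker.thetaNA N.cUp < N.thetaUp ∧
      Shrinker.cStar < N.cUp ∧ N.thetaUp = N.thetaIn ∧ N.thetaUp ≤ Real.pi ∧
      0.9947 * Real.pi < N.thetaUp := by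
    rcases N.mid_cases hup h0 with ⟨hm, hk⟩ | ⟨hm, hk, hθ⟩
    · obtain ⟨a1, a2, a3⟩ := N.bounds_of_mem hup h0 hm hk hR
      refine ⟨a1, a2, ?_, a3.le, ?_⟩
      · rw [Shrinker.ThetaShrinker.thetaIn, if_pos hm, a3]
      · rw [a3]; linarith
    · obtain ⟨a1, a2, a3, a4⟩ := N.bounds_of_notMem hup h0 hm hk hθ hR
      exact ⟨a1, a2, by rw [Shrinker.ThetaShrinker.thetaIn, if_neg hm, hθ], a3, a4⟩
  obtain ⟨a1, a2, a3, a4, a5⟩ := key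
  refine ⟨a1, ⟨a2, ?_⟩, a3, a5, a4⟩
  by_contra! h
  linarith [Shrinker.pi_lt_of_cBar_le h]
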